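/- For $u_0:\mathbb{R}^d\to\mathbb{R}$ let $$P_y(x)=c_d\,\frac{y}{(|x|^2+y^2)^{(d+1)/2}},\qquad c_d=\frac{\Gamma\left(\frac{d+1}{2}\right)}{\pi^{(d+1)/2}},\qquad x\in\mathbb{R}^d,\ y>0,$$ be the Poisson kernel of the upper half-space, and let $$u^\star(x)=\sup_{y>0}\,(|u_0|*P_y)(x)\in[0,\infty]$$ be the Poisson maximal function of $u_0$. Write $W^{1,p}(\mathbb{R}^d)$ for the space of functions in $L^p(\mathbb{R}^d)$ whose weak gradient is in $L^p$, $\|\nabla f\|_p$ for the $L^p$-norm of the Euclidean length $|\nabla f|$ of the weak gradient (for $d=1$, $f'$ is the weak derivative), and $V(f)$ for the total variation of $f:\mathbb{R}\to\mathbb{R}$, that is, the supremum of $\sum_i|f(x_{i+1})-f(x_i)|$ over all finite sequences $x_1\le x_2\le\dots\le x_N$. Then the following hold. (i) Let $1<p\le\infty$ and $u_0\in W^{1,p}(\mathbb{R})$. Then $u^\star$ is finite everywhere, $u^\star\in W^{1,p}(\mathbb{R})$ and $\|(u^\star)'\|_p\le\|u_0'\|_p$. (ii) Let $u_0\in W^{1,1}(\mathbb{R})$.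 Then $u^\star$ is finite everywhere, $u^\star\in L^\infty(\mathbb{R})$, and $u^\star$ has a weak derivative $(u^\star)'$ that satisfies $\|(u^\star)'\|_1\le\|u_0'\|_1$. (iii) Let $u_0$ be of bounded variation on $\mathbb{R}$, that is, $V(u_0)<\infty$. Then $u^\star$ is finite everywhere and of bounded variation on $\mathbb{R}$, and $V(u^\star)\le V(u_0)$. (iv) Let $d>1$ and $u_0\in W^{1,p}(\mathbb{R}^d)$ for $p=2$ or $p=\infty$. Then $u^\star$ is finite almost everywhere, $u^\star\in W^{1,p}(\mathbb{R}^d)$ and $\|\nabla u^\star\|_p\le\|\nabla u_0\|_p$. -/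

import Mathlib

open MeasureTheory Set
open scoped ENNReal ContDiff

section PoissonMaximal

variable {E : Type*} [NormedAddCommGroup E] [InnerProductSpace ℝ E] [MeasureSpace E]

/-- The Poisson kernel of the upper half-space over a `d`-dimensional Euclidean space,
`P_y(x) = c_d * y / (|x|^2 + y^2)^((d+1)/2)` with `c_d = Γ((d+1)/2) / π^((d+1)/2)`,
where `d` is the dimension of `E`. -/
noncomputable def halfSpacePoissonKernel (y : ℝ) (x : E) : ℝ :=
  Real.Gamma (((Module.finrank ℝ E : ℝ) + 1) / 2)
      / Real.pi ^ (((Module.finrank ℝ E : ℝ) + 1) / 2)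
    * (y / (‖x‖ ^ 2 + y ^ 2) ^ (((Module.finrank ℝ E : ℝ) + 1) / 2))

/-- The convolution `(|u| * P_y)(x) = ∫ |u z| P_y(x - z) dz`. The integrand is nonnegative, so the
integral always exists in `[0, ∞]`. -/
noncomputable def poissonExtensionAbs (u : E → ℝ) (y : ℝ) (x : E) : ℝ≥0∞ :=
  ∫⁻ z, ENNReal.ofReal (|u z| * halfSpacePoissonKernel y (x - z))

/-- The Poisson maximal function `x ↦ sup_{y > 0} (|u| * P_y)(x)`, with values in `[0, ∞]`. -/
noncomputable def poissonMaximal (u : E → ℝ) (x : E) : ℝ≥0∞ :=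
  ⨆ (y : ℝ) (_ : 0 < y), poissonExtensionAbs u y x

/-- `G` is a weak gradient of `u`: both are locally integrable and, for all test functions
`φ ∈ C_c^∞(E)` and all directions `v`, one has `∫ u ∂_v φ = - ∫ ⟨G, v⟩ φ`. For `E = ℝ` this says
that `G` is the weak derivative of `u`. -/
structure HasWeakGradient (u : E → ℝ) (G : E → E) : Prop where
  locallyIntegrable : LocallyIntegrable u volume
  locallyIntegrable_grad : LocallyIntegrable G volume
  integral_eq : ∀ φ : E → ℝ, ContDiff ℝ ∞ φ → HasCompactSupport φ → ∀ v : E,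
    ∫ x, u x * fderiv ℝ φ x v = - ∫ x, inner ℝ (G x) v * φ x

/-- The Sobolev space `W^{1,p}(E)`: functions in `L^p` with a weak gradient in `L^p`. -/
def MemW1 (p : ℝ≥0∞) (u : E → ℝ) : Prop :=
  MemLp u p volume ∧ ∃ G : E → E, HasWeakGradient u G ∧ MemLp G p volume

end PoissonMaximal

/-!
`(x, y) ↦ (|u| * P_y)(x)` is harmonic. Truncate the maximal function to
`u*_ε = sup_{y ≥ ε} |u| * P_y`. At a point where `u*_ε` exceeds `f = |u| * P_ε`, the supremum is
attained at a level `y > ε` (or approached as `y → ∞`), where the vertical second difference is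
nonpositive; by harmonicity the horizontal discrete Laplacian of `|u| * P_y`, and with it that of
`u*_ε`, is then nonnegative up to `O(r ^ 3)` for steps of length `r`. So `u*_ε` is subharmonic where
it is detached from `f`.

On the line this means that `u*_ε` is convex between its contact points with `f`, so that for every
even convex `ψ` its `ψ`-energy is at most that of `f`, and by Jensen at most that of `u`. Taking
`ψ = |·|`, `|·| ^ p` and `(|·| - M)₊` and letting `ε → 0` gives the variation bound, the `L^p` bound
and absolute continuity. For `p = 2` in any dimension, testing the discrete Laplacian of `u*_ε`
against `u*_ε - f ≥ 0` compares the discrete Dirichlet energies; the error disappears when a step is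
split into many small ones, which avoids any regularity theory. For `p = ∞`, translation invariance
makes `u*` as Lipschitz as `u`.
-/

section SecondDifference

theorem nonneg_of_hasDerivAt_nonneg {g g' : ℝ → ℝ} {r : ℝ} (h0 : g 0 = 0)
    (hg : ∀ t ∈ Icc 0 r, HasDerivAt g (g' t) t) (hg' : ∀ t ∈ Icc 0 r, 0 ≤ g' t) :
    ∀ t ∈ Icc 0 r, 0 ≤ g t := by
  intro t ht
  have hmono : MonotoneOn g (Icc 0 r) :=
    monotoneOn_of_hasDerivWithinAt_nonneg (convex_Icc 0 r)
      (fun s hs => (hg s hs).continuousAt.continuousWithinAt)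
      (fun s hs => (hg s (interior_subset hs)).hasDerivWithinAt)
      (fun s hs => hg' s (interior_subset hs))
  simpa only [h0] using hmono (left_mem_Icc.2 (ht.1.trans ht.2)) ht ht.1

theorem second_difference_ge {h h₁ h₂ h₃ : ℝ → ℝ} {r M : ℝ} (hr : 0 ≤ r)
    (hd : ∀ t ∈ Icc (-r) r, HasDerivAt h (h₁ t) t)
    (hd₁ : ∀ t ∈ Icc (-r) r, HasDerivAt h₁ (h₂ t) t)
    (hd₂ : ∀ t ∈ Icc (-r) r, HasDerivAt h₂ (h₃ t) t)
    (hM : ∀ t ∈ Icc (-r) r, |h₃ t| ≤ M) :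
    r ^ 2 * (h₂ 0 - M * r / 3) ≤ h r + h (-r) - 2 * h 0 := by
  have mem : ∀ t ∈ Icc 0 r, t ∈ Icc (-r) r := fun t ht => ⟨by linarith [ht.1], ht.2⟩
  have neg_mem : ∀ t ∈ Icc 0 r, -t ∈ Icc (-r) r := fun t ht =>
    ⟨by linarith [ht.2], by linarith [ht.1]⟩
  have comp_neg : ∀ {f f' : ℝ → ℝ} {t : ℝ}, HasDerivAt f (f' (-t)) (-t) →
      HasDerivAt (fun t => f (-t)) (-f' (-t)) t := fun {f f' t} hf =>
    (HasDerivAt.comp t hf (hasDerivAt_neg t)).congr_deriv (by ring)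
  have H₂ : ∀ t ∈ Icc 0 r, 0 ≤ h₂ t + h₂ (-t) - 2 * h₂ 0 + 2 * M * t := by
    refine nonneg_of_hasDerivAt_nonneg (g' := fun t => h₃ t - h₃ (-t) + 2 * M) (by simp; ring)
      (fun t ht => ?_) fun t ht => ?_
    · exact ((((hd₂ t (mem t ht)).add (comp_neg (hd₂ _ (neg_mem t ht)))).sub_const _).add
        ((hasDerivAt_id t).const_mul (2 * M))).congr_deriv (by ring)
    · linarith [(abs_le.1 (hM t (mem t ht))).1, (abs_le.1 (hM _ (neg_mem t ht))).2]
  have H₁ : ∀ t ∈ Icc 0 r, 0 ≤ h₁ t - h₁ (-t) - 2 * h₂ 0 * t + M * t ^ 2 := by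
    refine nonneg_of_hasDerivAt_nonneg (by simp) (fun t ht => ?_) H₂
    exact ((((hd₁ t (mem t ht)).sub (comp_neg (hd₁ _ (neg_mem t ht)))).sub
      ((hasDerivAt_id t).const_mul (2 * h₂ 0))).add
        ((hasDerivAt_pow 2 t).const_mul M)).congr_deriv (by push_cast; ring)
  have H₀ : ∀ t ∈ Icc 0 r, 0 ≤ h t + h (-t) - 2 * h 0 - h₂ 0 * t ^ 2 + M / 3 * t ^ 3 := by
    refine nonneg_of_hasDerivAt_nonneg (by simp; ring) (fun t ht => ?_) H₁
    exact (((((hd t (mem t ht)).add (comp_neg (hd _ (neg_mem t ht)))).sub_const _).sub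
      ((hasDerivAt_pow 2 t).const_mul (h₂ 0))).add
        ((hasDerivAt_pow 3 t).const_mul (M / 3))).congr_deriv (by push_cast; ring)
  linarith [H₀ r (right_mem_Icc.2 hr)]

end SecondDifference

section LineProfile

/-- The squared norm `‖X + t • V‖ ^ 2` along a line with `‖X‖ ^ 2 = q`, `⟪X, V⟫ = β`,
`‖V‖ = 1`. -/
def lineNormSq (q β t : ℝ) : ℝ := q + 2 * β * t + t ^ 2

/-- The restriction of `(x, y) ↦ y * (‖x‖ ^ 2 + y ^ 2) ^ (-a)` to a line of unit speed in `E × ℝ`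
whose vertical component is `y + τ * t`; with `2 * a = dim E + 1` this is the Poisson kernel up to
its normalizing constant. -/
noncomputable def lineProfile (a y τ q β t : ℝ) : ℝ := (y + τ * t) * lineNormSq q β t ^ (-a)

/-- The second derivative of `lineProfile` in `t`. -/
noncomputable def lineProfileDeriv₂ (a y τ q β t : ℝ) : ℝ :=
  (-(4 * a * τ * (β + t)) - 2 * a * (y + τ * t)) * lineNormSq q β t ^ (-a - 1)
    + 4 * a * (a + 1) * ((y + τ * t) * (β + t) ^ 2) * lineNormSq q β t ^ (-a - 1 - 1)

/-- The third derivative of `lineProfile` in `t`. -/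
noncomputable def lineProfileDeriv₃ (a y τ q β t : ℝ) : ℝ :=
  -(6 * a * τ) * lineNormSq q β t ^ (-a - 1)
    + 12 * a * (a + 1) * (τ * (β + t) ^ 2 + (y + τ * t) * (β + t))
      * lineNormSq q β t ^ (-a - 1 - 1)
    - 8 * a * (a + 1) * (a + 2) * ((y + τ * t) * (β + t) ^ 3)
      * lineNormSq q β t ^ (-a - 1 - 1 - 1)

variable {a y τ q β t : ℝ}

theorem hasDerivAt_lineNormSq_rpow (p : ℝ) (hQ : 0 < lineNormSq q β t) :
    HasDerivAt (fun t => lineNormSq q β t ^ p)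
      (2 * (β + t) * p * lineNormSq q β t ^ (p - 1)) t := by
  have hq : HasDerivAt (lineNormSq q β) (2 * (β + t)) t :=
    ((((hasDerivAt_id t).const_mul (2 * β)).const_add q).add (hasDerivAt_pow 2 t)).congr_deriv
      (by push_cast; ring)
  exact hq.rpow_const (Or.inl hQ.ne')

theorem hasDerivAt_lineProfile (hQ : 0 < lineNormSq q β t) :
    HasDerivAt (lineProfile a y τ q β)
      (τ * lineNormSq q β t ^ (-a)
        - 2 * a * ((y + τ * t) * (β + t)) * lineNormSq q β t ^ (-a - 1)) t := by
  have hl : HasDerivAt (fun t => y + τ * t) τ t := by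
    simpa using ((hasDerivAt_id t).const_mul τ).const_add y
  exact (hl.mul (hasDerivAt_lineNormSq_rpow (-a) hQ)).congr_deriv (by ring)

theorem hasDerivAt_deriv_lineProfile (hQ : 0 < lineNormSq q β t) :
    HasDerivAt (fun t => τ * lineNormSq q β t ^ (-a)
        - 2 * a * ((y + τ * t) * (β + t)) * lineNormSq q β t ^ (-a - 1))
      (lineProfileDeriv₂ a y τ q β t) t := by
  have hl : HasDerivAt (fun t => y + τ * t) τ t := by
    simpa using ((hasDerivAt_id t).const_mul τ).const_add y
  have hs : HasDerivAt (fun t => β + t) 1 t := (hasDerivAt_id t).const_add β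
  refine (((hasDerivAt_lineNormSq_rpow (-a) hQ).const_mul τ).sub
    (((hl.mul hs).const_mul (2 * a)).mul
      (hasDerivAt_lineNormSq_rpow (-a - 1) hQ))).congr_deriv ?_
  simp only [lineProfileDeriv₂, Pi.mul_apply]
  ring

theorem hasDerivAt_lineProfileDeriv₂ (hQ : 0 < lineNormSq q β t) :
    HasDerivAt (lineProfileDeriv₂ a y τ q β) (lineProfileDeriv₃ a y τ q β t) t := by
  have hl : HasDerivAt (fun t => y + τ * t) τ t := by
    simpa using ((hasDerivAt_id t).const_mul τ).const_add y
  have hs : HasDerivAt (fun t => β + t) 1 t := (hasDerivAt_id t).const_add β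
  refine ((((hs.const_mul (4 * a * τ)).neg.sub (hl.const_mul (2 * a))).mul
    (hasDerivAt_lineNormSq_rpow (-a - 1) hQ)).add
      (((hl.mul (hs.pow 2)).const_mul (4 * a * (a + 1))).mul
        (hasDerivAt_lineNormSq_rpow (-a - 1 - 1) hQ))).congr_deriv ?_
  simp only [lineProfileDeriv₃, Pi.mul_apply, Pi.pow_apply, Pi.sub_apply, Pi.neg_apply]
  push_cast
  ring

theorem lineProfileDeriv₃_eq (hl : 0 < y + τ * t) (hQ : 0 < lineNormSq q β t) :
    lineProfileDeriv₃ a y τ q β t = lineProfile a y τ q β t *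
      (-(6 * a) * (τ / ((y + τ * t) * lineNormSq q β t))
        + 12 * a * (a + 1) * (τ * (β + t) ^ 2 / ((y + τ * t) * lineNormSq q β t ^ 2)
          + (β + t) / lineNormSq q β t ^ 2)
        - 8 * a * (a + 1) * (a + 2) * ((β + t) ^ 3 / lineNormSq q β t ^ 3)) := by
  unfold lineProfileDeriv₃ lineProfile
  rw [Real.rpow_sub_one hQ.ne' (-a - 1 - 1), Real.rpow_sub_one hQ.ne' (-a - 1),
    Real.rpow_sub_one hQ.ne' (-a)]
  field_simp

theorem abs_pow_div_pow_le {s l k : ℝ} (hl : 0 < l) (hs : |s| ≤ k) (hlk : l ≤ k) (i : ℕ) {j : ℕ} :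
    |s ^ i / k ^ (i + j)| ≤ 1 / l ^ j := by
  have hk : 0 < k := hl.trans_le hlk
  rw [abs_div, abs_pow, abs_of_pos (pow_pos hk _), div_le_div_iff₀ (by positivity) (by positivity),
    pow_add, one_mul]
  gcongr

theorem abs_lineProfileDeriv₃_le (ha : 0 ≤ a) (hτ : |τ| ≤ 1) (hl : 0 < y + τ * t)
    (hlQ : (y + τ * t) ^ 2 ≤ lineNormSq q β t) (hsQ : (β + t) ^ 2 ≤ lineNormSq q β t) :
    |lineProfileDeriv₃ a y τ q β t| ≤
      lineProfile a y τ q β t *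
        ((6 * a + 24 * a * (a + 1) + 8 * a * (a + 1) * (a + 2)) / (y + τ * t) ^ 3) := by
  have hQ : 0 < lineNormSq q β t := (pow_pos hl 2).trans_le hlQ
  have hh : 0 < lineProfile a y τ q β t := mul_pos hl (Real.rpow_pos_of_pos hQ _)
  rw [lineProfileDeriv₃_eq hl hQ, abs_mul, abs_of_pos hh]
  refine mul_le_mul_of_nonneg_left ?_ hh.le
  set l := y + τ * t
  set s := β + t
  set k := √(lineNormSq q β t)
  have hk : lineNormSq q β t = k ^ 2 := (Real.sq_sqrt hQ.le).symm
  have hlk : l ≤ k := Real.le_sqrt_of_sq_le hlQ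
  have bound := fun i j : ℕ => abs_pow_div_pow_le hl (Real.abs_le_sqrt hsQ) hlk i (j := j)
  have hτl : ∀ z : ℝ, |z| ≤ 1 / l ^ 2 → |τ / l * z| ≤ 1 / l ^ 3 := fun z hz => by
    rw [abs_mul, abs_div, abs_of_pos hl, show 1 / l ^ 3 = 1 / l * (1 / l ^ 2) by field_simp]
    gcongr
  have b₀ := abs_le.1 (hτl _ (bound 0 2))
  have b₁ := abs_le.1 (hτl _ (bound 2 2))
  have b₂ := abs_le.1 (bound 1 3)
  have b₃ := abs_le.1 (bound 3 3)
  have e : ∀ c : ℝ, c / l ^ 3 = c * (1 / l ^ 3) := fun c => by ring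
  have hcoef : 0 ≤ 12 * a * (a + 1) ∧ 0 ≤ 8 * a * (a + 1) * (a + 2) := by
    constructor <;> positivity
  rw [hk, e, show τ / (l * k ^ 2) = τ / l * (s ^ 0 / k ^ (0 + 2)) by field_simp,
    show τ * s ^ 2 / (l * (k ^ 2) ^ 2) = τ / l * (s ^ 2 / k ^ (2 + 2)) by
      rw [← pow_mul]; field_simp,
    show s / (k ^ 2) ^ 2 = s ^ 1 / k ^ (1 + 3) by ring,
    show s ^ 3 / (k ^ 2) ^ 3 = s ^ 3 / k ^ (3 + 3) by ring, abs_le]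
  constructor <;> nlinarith

end LineProfile

section ProdNorm

variable {E : Type*} [SeminormedAddCommGroup E]

theorem norm_toLp_prod_eq_sqrt (x : E) (y : ℝ) :
    ‖WithLp.toLp 2 (x, y)‖ = √(‖x‖ ^ 2 + y ^ 2) := by
  simp only [WithLp.prod_norm_eq_of_L2, Real.norm_eq_abs, sq_abs, WithLp.toLp_fst,
    WithLp.toLp_snd]

theorem sqrt_norm_sq_add_sq_le (x x' : E) (y y' : ℝ) :
    √(‖x'‖ ^ 2 + y' ^ 2) ≤ √(‖x‖ ^ 2 + y ^ 2) + (‖x' - x‖ + |y' - y|) := by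
  have htri := norm_le_insert' (WithLp.toLp 2 (x', y')) (WithLp.toLp 2 (x, y))
  rw [← WithLp.toLp_sub, Prod.mk_sub_mk, norm_toLp_prod_eq_sqrt,
    norm_toLp_prod_eq_sqrt, norm_toLp_prod_eq_sqrt] at htri
  refine htri.trans (add_le_add_right ?_ _)
  refine Real.sqrt_le_iff.2 ⟨by positivity, ?_⟩
  nlinarith [sq_abs (y' - y), mul_nonneg (norm_nonneg (x' - x)) (abs_nonneg (y' - y))]

end ProdNorm

section PoissonKernel

variable {E : Type*} [NormedAddCommGroup E] [InnerProductSpace ℝ E]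

/-- The constant `c_d` of the Poisson kernel in dimension `d = dim E`. -/
noncomputable def poissonConst (E : Type*) [NormedAddCommGroup E] [InnerProductSpace ℝ E] : ℝ :=
  Real.Gamma (((Module.finrank ℝ E : ℝ) + 1) / 2) / Real.pi ^ (((Module.finrank ℝ E : ℝ) + 1) / 2)

theorem poissonConst_pos : 0 < poissonConst E := by
  have : 0 < Real.Gamma (((Module.finrank ℝ E : ℝ) + 1) / 2) :=
    Real.Gamma_pos_of_pos (by positivity)
  unfold poissonConst
  positivity

theorem halfSpacePoissonKernel_pos {y : ℝ} (hy : 0 < y) (x : E) :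
    0 < halfSpacePoissonKernel y x := by
  have : 0 < poissonConst E := poissonConst_pos
  change 0 < poissonConst E * _
  positivity

theorem continuous_halfSpacePoissonKernel {y : ℝ} (hy : 0 < y) :
    Continuous (fun x : E => halfSpacePoissonKernel y x) := by
  unfold halfSpacePoissonKernel
  refine continuous_const.mul (continuous_const.div ?_ fun x => by positivity)
  exact (by fun_prop : Continuous fun x : E => ‖x‖ ^ 2 + y ^ 2).rpow_const
    fun x => Or.inl (by positivity)

theorem halfSpacePoissonKernel_eq_sqrt (y : ℝ) (x : E) :
    halfSpacePoissonKernel y x =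
      poissonConst E * (y / √(‖x‖ ^ 2 + y ^ 2) ^ (Module.finrank ℝ E + 1)) := by
  unfold halfSpacePoissonKernel poissonConst
  rw [Real.rpow_div_two_eq_sqrt _ (by positivity : 0 ≤ ‖x‖ ^ 2 + y ^ 2)]
  norm_cast

theorem halfSpacePoissonKernel_harnack {y y' δ : ℝ} (hy : 0 < y) (x x' : E)
    (h : ‖x' - x‖ + |y' - y| ≤ δ) (hδ : δ ≤ y) :
    (1 - δ / y) ^ (Module.finrank ℝ E + 2) * halfSpacePoissonKernel y x ≤
      halfSpacePoissonKernel y' x' := by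
  rw [halfSpacePoissonKernel_eq_sqrt, halfSpacePoissonKernel_eq_sqrt, mul_left_comm]
  refine mul_le_mul_of_nonneg_left ?_ poissonConst_pos.le
  have hδ0 : 0 ≤ δ := le_trans (by positivity) h
  have hdist : √(‖x'‖ ^ 2 + y' ^ 2) ≤ √(‖x‖ ^ 2 + y ^ 2) + δ :=
    (sqrt_norm_sq_add_sq_le x x' y y').trans (by gcongr)
  have hρ : y ≤ √(‖x‖ ^ 2 + y ^ 2) := Real.le_sqrt_of_sq_le (by nlinarith [sq_nonneg ‖x‖])
  set ρ := √(‖x‖ ^ 2 + y ^ 2)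
  obtain ⟨t, rfl⟩ : ∃ t, δ = t * y := ⟨δ / y, by field_simp⟩
  rw [mul_div_cancel_right₀ t hy.ne']
  have ht0 : 0 ≤ t := nonneg_of_mul_nonneg_left hδ0 hy
  have ht1 : t ≤ 1 := le_of_mul_le_mul_right (by linarith) hy
  have hyy' : (1 - t) * y ≤ y' := by
    linarith [(abs_le.1 ((le_add_of_nonneg_left (norm_nonneg (x' - x))).trans h)).1]
  rcases ht1.eq_or_lt with rfl | ht1
  · have : 0 ≤ y' := by linarith
    simp only [sub_self, ne_eq, Nat.add_eq_zero_iff, OfNat.ofNat_ne_zero, and_false,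
      not_false_eq_true, zero_pow, zero_mul]
    positivity
  have hy' : 0 < y' := (mul_pos (by linarith) hy).trans_le hyy'
  have hρ' : 0 < √(‖x'‖ ^ 2 + y' ^ 2) := Real.sqrt_pos.2 (by positivity)
  set ρ' := √(‖x'‖ ^ 2 + y' ^ 2)
  have hρρ' : (1 - t) * ρ' ≤ ρ := by
    calc (1 - t) * ρ' ≤ (1 - t) * (ρ * (1 + t)) := by gcongr; nlinarith
      _ = ρ * (1 - t ^ 2) := by ring
      _ ≤ ρ := by nlinarith [sq_nonneg t]
  rw [mul_div_assoc', div_le_div_iff₀ (by positivity) (pow_pos hρ' _)]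
  calc (1 - t) ^ (Module.finrank ℝ E + 2) * y * ρ' ^ (Module.finrank ℝ E + 1)
      = ((1 - t) * y) * ((1 - t) * ρ') ^ (Module.finrank ℝ E + 1) := by rw [mul_pow]; ring
    _ ≤ y' * ρ ^ (Module.finrank ℝ E + 1) := by gcongr

theorem halfSpacePoissonKernel_le_two_pow {y y' : ℝ} (hy : 0 < y) (x x' : E)
    (h : ‖x' - x‖ + |y' - y| ≤ y / 2) :
    halfSpacePoissonKernel y x ≤
      2 ^ (Module.finrank ℝ E + 2) * halfSpacePoissonKernel y' x' := by
  have hhar := halfSpacePoissonKernel_harnack hy x x' h (by linarith)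
  rwa [show 1 - y / 2 / y = (1 / 2 : ℝ) by field_simp; norm_num, one_div, inv_pow,
    inv_mul_le_iff₀ (by positivity)] at hhar

theorem norm_add_smul_sq_add_sq {e : E} {τ : ℝ} (he : ‖e‖ ^ 2 + τ ^ 2 = 1) (x : E) (y t : ℝ) :
    ‖x + t • e‖ ^ 2 + (y + τ * t) ^ 2 =
      lineNormSq (‖x‖ ^ 2 + y ^ 2) (inner ℝ x e + y * τ) t := by
  rw [norm_add_sq_real, inner_smul_right, norm_smul, mul_pow, Real.norm_eq_abs, sq_abs,
    lineNormSq]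
  linear_combination t ^ 2 * he

theorem halfSpacePoissonKernel_line {e : E} {τ : ℝ} (he : ‖e‖ ^ 2 + τ ^ 2 = 1) (x : E) (y t : ℝ) :
    halfSpacePoissonKernel (y + τ * t) (x + t • e) =
      poissonConst E * lineProfile (((Module.finrank ℝ E : ℝ) + 1) / 2) y τ
        (‖x‖ ^ 2 + y ^ 2) (inner ℝ x e + y * τ) t := by
  rw [lineProfile, ← norm_add_smul_sq_add_sq he, Real.rpow_neg (by positivity)]
  rfl

theorem inner_add_mul_add_sq_le_lineNormSq {e : E} {τ : ℝ} (he : ‖e‖ ^ 2 + τ ^ 2 = 1) (x : E)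
    (y t : ℝ) :
    (inner ℝ x e + y * τ + t) ^ 2 ≤ lineNormSq (‖x‖ ^ 2 + y ^ 2) (inner ℝ x e + y * τ) t := by
  have hcauchy := real_inner_mul_inner_self_le (WithLp.toLp 2 (x, y)) (WithLp.toLp 2 (e, τ))
  simp only [WithLp.prod_inner_apply, real_inner_self_eq_norm_sq, RCLike.inner_apply,
    conj_trivial, ← sq, he, mul_one, mul_comm τ y] at hcauchy
  unfold lineNormSq
  linarith

/-- A bound for `y ^ 3` times the third derivatives of the Poisson kernel along lines of unit speed,
relative to the kernel itself. -/
noncomputable def poissonThirdConst (E : Type*) [NormedAddCommGroup E]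
    [InnerProductSpace ℝ E] : ℝ :=
  let a := ((Module.finrank ℝ E : ℝ) + 1) / 2
  8 * (6 * a + 24 * a * (a + 1) + 8 * a * (a + 1) * (a + 2)) * 2 ^ (Module.finrank ℝ E + 2)

theorem poissonThirdConst_nonneg : 0 ≤ poissonThirdConst E := by
  unfold poissonThirdConst
  positivity

theorem abs_poissonConst_mul_lineProfileDeriv₃_le {e : E} {y r τ t : ℝ} (hy : 0 < y)
    (hry : r ≤ y / 8) (he : ‖e‖ ^ 2 + τ ^ 2 = 1) (x : E) (ht : |t| ≤ r) :
    |poissonConst E * lineProfileDeriv₃ (((Module.finrank ℝ E : ℝ) + 1) / 2) y τ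
        (‖x‖ ^ 2 + y ^ 2) (inner ℝ x e + y * τ) t| ≤
      poissonThirdConst E / y ^ 3 * halfSpacePoissonKernel y x := by
  have hτ : |τ| ≤ 1 := (sq_le_one_iff_abs_le_one τ).1 (by nlinarith [sq_nonneg ‖e‖])
  have he1 : ‖e‖ ≤ 1 := by nlinarith [sq_nonneg τ, norm_nonneg e]
  have hτt : |τ * t| ≤ y / 8 :=
    ((abs_mul τ t).trans_le ((mul_le_of_le_one_left (abs_nonneg t) hτ).trans ht)).trans hry
  have hl : y / 2 ≤ y + τ * t := by linarith [(abs_le.1 hτt).1]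
  have hkernel : halfSpacePoissonKernel (y + τ * t) (x + t • e) ≤
      2 ^ (Module.finrank ℝ E + 2) * halfSpacePoissonKernel y x := by
    refine halfSpacePoissonKernel_le_two_pow (by linarith) _ _ ?_
    have : ‖t • e‖ ≤ |t| := by
      rw [norm_smul, Real.norm_eq_abs]
      exact mul_le_of_le_one_right (abs_nonneg t) he1
    simp only [sub_add_cancel_left, norm_neg, abs_neg]
    linarith [(abs_le.1 hτt).1]
  have hthird := abs_lineProfileDeriv₃_le (a := ((Module.finrank ℝ E : ℝ) + 1) / 2)
    (by positivity) hτ (hl.trans_lt' (by linarith))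
    (by rw [← norm_add_smul_sq_add_sq he]; nlinarith [sq_nonneg ‖x + t • e‖])
    (inner_add_mul_add_sq_le_lineNormSq he x y t)
  set a := ((Module.finrank ℝ E : ℝ) + 1) / 2 with ha
  rw [abs_mul, abs_of_pos poissonConst_pos]
  calc _ ≤ halfSpacePoissonKernel (y + τ * t) (x + t • e) *
        ((6 * a + 24 * a * (a + 1) + 8 * a * (a + 1) * (a + 2)) / (y + τ * t) ^ 3) := by
        rw [halfSpacePoissonKernel_line he, mul_assoc]
        exact mul_le_mul_of_nonneg_left hthird poissonConst_pos.le
    _ ≤ 2 ^ (Module.finrank ℝ E + 2) * halfSpacePoissonKernel y x *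
        ((6 * a + 24 * a * (a + 1) + 8 * a * (a + 1) * (a + 2)) / (y / 2) ^ 3) := by
        have := halfSpacePoissonKernel_pos hy x
        have : 0 ≤ y + τ * t := by linarith
        gcongr
    _ = poissonThirdConst E / y ^ 3 * halfSpacePoissonKernel y x := by
        simp only [poissonThirdConst, ← ha]
        field_simp
        norm_num

theorem halfSpacePoissonKernel_second_difference_ge {e : E} {y r τ : ℝ} (hy : 0 < y) (hr : 0 ≤ r)
    (hry : r ≤ y / 8) (he : ‖e‖ ^ 2 + τ ^ 2 = 1) (x : E) :
    r ^ 2 * (poissonConst E * lineProfileDeriv₂ (((Module.finrank ℝ E : ℝ) + 1) / 2) y τ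
        (‖x‖ ^ 2 + y ^ 2) (inner ℝ x e + y * τ) 0
        - poissonThirdConst E / y ^ 3 * halfSpacePoissonKernel y x * r) ≤
      halfSpacePoissonKernel (y + τ * r) (x + r • e)
        + halfSpacePoissonKernel (y - τ * r) (x - r • e) - 2 * halfSpacePoissonKernel y x := by
  have hτ : |τ| ≤ 1 := (sq_le_one_iff_abs_le_one τ).1 (by nlinarith [sq_nonneg ‖e‖])
  have hQ : ∀ t ∈ Icc (-r) r, 0 < lineNormSq (‖x‖ ^ 2 + y ^ 2) (inner ℝ x e + y * τ) t :=
    fun t ht => by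
      have hτt : |τ * t| ≤ r :=
        (abs_mul τ t).trans_le ((mul_le_of_le_one_left (abs_nonneg t) hτ).trans (abs_le.2 ht))
      rw [← norm_add_smul_sq_add_sq he]
      exact add_pos_of_nonneg_of_pos (sq_nonneg _) (pow_pos (by linarith [(abs_le.1 hτt).1]) 2)
  have key := second_difference_ge hr
    (fun t ht => (hasDerivAt_lineProfile (hQ t ht)).const_mul (poissonConst E))
    (fun t ht => (hasDerivAt_deriv_lineProfile (hQ t ht)).const_mul (poissonConst E))
    (fun t ht => (hasDerivAt_lineProfileDeriv₂ (hQ t ht)).const_mul (poissonConst E))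
    (fun t ht => abs_poissonConst_mul_lineProfileDeriv₃_le hy hry he x (abs_le.2 ht))
  simp only [← halfSpacePoissonKernel_line he, mul_neg, mul_zero, add_zero, neg_smul, zero_smul,
    ← sub_eq_add_neg] at key
  refine le_trans ?_ key
  have hK : 0 ≤ poissonThirdConst E / y ^ 3 * halfSpacePoissonKernel y x :=
    mul_nonneg (div_nonneg poissonThirdConst_nonneg (by positivity))
      (halfSpacePoissonKernel_pos hy x).le
  gcongr
  linarith [mul_nonneg hK hr]

theorem sum_lineProfileDeriv₂_eq_zero {ι : Type*} [Fintype ι] (b : OrthonormalBasis ι ℝ E) {y : ℝ}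
    (hy : 0 < y) (x : E) :
    ∑ i, lineProfileDeriv₂ (((Module.finrank ℝ E : ℝ) + 1) / 2) y 0
        (‖x‖ ^ 2 + y ^ 2) (inner ℝ x (b i) + y * 0) 0
      + lineProfileDeriv₂ (((Module.finrank ℝ E : ℝ) + 1) / 2) y 1
        (‖x‖ ^ 2 + y ^ 2) (inner ℝ x (0 : E) + y * 1) 0 = 0 := by
  have hcard : (Module.finrank ℝ E : ℝ) = Fintype.card ι := by
    rw [Module.finrank_eq_card_basis b.toBasis]
  have hparseval : ∑ i, inner ℝ x (b i) ^ 2 = ‖x‖ ^ 2 := by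
    simpa only [Real.norm_eq_abs, sq_abs] using b.sum_sq_norm_inner_left x
  have hq : 0 < ‖x‖ ^ 2 + y ^ 2 := by positivity
  simp only [lineProfileDeriv₂, lineNormSq, hcard, mul_zero, add_zero, zero_mul, mul_one, neg_zero,
    zero_sub, inner_zero_right, zero_add, ne_eq, OfNat.ofNat_ne_zero, not_false_eq_true, zero_pow,
    Finset.sum_add_distrib, Finset.sum_const, Finset.card_univ, nsmul_eq_mul, ← Finset.sum_mul,
    ← Finset.mul_sum, hparseval]
  rw [Real.rpow_sub_one hq.ne' (_ - 1)]
  field_simp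
  ring

theorem halfSpacePoissonKernel_second_differences {ι : Type*} [Fintype ι]
    (b : OrthonormalBasis ι ℝ E) {y r s : ℝ} (hy : 0 < y) (hr : 0 < r) (hry : r ≤ y / 8)
    (hs : 0 < s) (hsy : s ≤ y / 8) (x : E) :
    0 ≤ (∑ i, (halfSpacePoissonKernel y (x + r • b i) + halfSpacePoissonKernel y (x - r • b i)
        - 2 * halfSpacePoissonKernel y x)) / r ^ 2
      + (halfSpacePoissonKernel (y + s) x + halfSpacePoissonKernel (y - s) x
        - 2 * halfSpacePoissonKernel y x) / s ^ 2
      + poissonThirdConst E / y ^ 3 * (Fintype.card ι * r + s) * halfSpacePoissonKernel y x := by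
  have hhor := Finset.sum_le_sum fun i (_ : i ∈ Finset.univ) =>
    halfSpacePoissonKernel_second_difference_ge (e := b i) (τ := 0) hy hr.le hry
      (by simp [b.orthonormal.1 i]) x
  have hver := halfSpacePoissonKernel_second_difference_ge (e := (0 : E)) (τ := 1) hy hs.le hsy
    (by simp) x
  rw [← Finset.mul_sum, mul_comm, ← le_div_iff₀ (by positivity), Finset.sum_sub_distrib,
    ← Finset.mul_sum, Finset.sum_const, Finset.card_univ, nsmul_eq_mul] at hhor
  rw [mul_comm, ← le_div_iff₀ (by positivity)] at hver
  have hharmonic := congrArg (poissonConst E * ·) (sum_lineProfileDeriv₂_eq_zero b hy x)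
  simp only [zero_mul, one_mul, smul_zero, add_zero, sub_zero, mul_add, mul_zero]
    at hhor hver hharmonic
  linarith

end PoissonKernel

section PoissonKernelMass

theorem lintegral_ofReal_eq_of_integral_eq {α : Type*} [MeasurableSpace α] {μ : Measure α}
    {f : α → ℝ} {c : ℝ} (hf : 0 ≤ᵐ[μ] f) (hc : c ≠ 0) (h : ∫ x, f x ∂μ = c) :
    ∫⁻ x, ENNReal.ofReal (f x) ∂μ = ENNReal.ofReal c := by
  rw [← h, ofReal_integral_eq_lintegral_ofReal (.of_integral_ne_zero (h ▸ hc)) hf]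

theorem lintegral_rpow_mul_exp_neg_mul_Ioi {a q : ℝ} (ha : 0 < a) (hq : 0 < q) :
    ∫⁻ t in Ioi (0 : ℝ), ENNReal.ofReal (t ^ (a - 1) * Real.exp (-(q * t))) =
      ENNReal.ofReal (Real.Gamma a * q ^ (-a)) := by
  refine lintegral_ofReal_eq_of_integral_eq ?_
    (mul_pos (Real.Gamma_pos_of_pos ha) (Real.rpow_pos_of_pos hq _)).ne' ?_
  · filter_upwards [ae_restrict_mem measurableSet_Ioi] with t (ht : 0 < t)
    exact mul_nonneg (Real.rpow_nonneg ht.le _) (Real.exp_pos _).le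
  · rw [Real.integral_rpow_mul_exp_neg_mul_Ioi ha hq, one_div, Real.inv_rpow hq.le,
      Real.rpow_neg hq.le, mul_comm]

variable {E : Type*} [NormedAddCommGroup E] [InnerProductSpace ℝ E]

theorem ofReal_halfSpacePoissonKernel_eq_lintegral {y : ℝ} (hy : 0 < y) (z : E) :
    ENNReal.ofReal (halfSpacePoissonKernel y z) =
      ENNReal.ofReal (y / Real.pi ^ (((Module.finrank ℝ E : ℝ) + 1) / 2)) *
        ∫⁻ t in Ioi (0 : ℝ), ENNReal.ofReal (t ^ (((Module.finrank ℝ E : ℝ) + 1) / 2 - 1)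
          * Real.exp (-((‖z‖ ^ 2 + y ^ 2) * t))) := by
  rw [lintegral_rpow_mul_exp_neg_mul_Ioi (by positivity) (by positivity),
    ← ENNReal.ofReal_mul (by positivity), halfSpacePoissonKernel, Real.rpow_neg (by positivity)]
  ring_nf

variable [FiniteDimensional ℝ E] [MeasurableSpace E] [BorelSpace E]

theorem lintegral_rpow_mul_exp_neg_norm_sq_add_mul (c q : ℝ) {t : ℝ} (ht : 0 < t) :
    ∫⁻ z : E, ENNReal.ofReal (t ^ c * Real.exp (-((‖z‖ ^ 2 + q) * t))) =
      ENNReal.ofReal (Real.pi ^ ((Module.finrank ℝ E : ℝ) / 2)) *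
        ENNReal.ofReal (t ^ (c - (Module.finrank ℝ E : ℝ) / 2) * Real.exp (-(q * t))) := by
  rw [← ENNReal.ofReal_mul (by positivity)]
  refine lintegral_ofReal_eq_of_integral_eq (.of_forall fun z => by positivity)
    (by positivity) ?_
  have hsplit : ∀ z : E, t ^ c * Real.exp (-((‖z‖ ^ 2 + q) * t)) =
      (t ^ c * Real.exp (-(q * t))) * Real.exp (-t * ‖z‖ ^ 2) := fun z => by
    rw [mul_assoc, ← Real.exp_add]
    ring_nf
  simp_rw [hsplit]
  rw [integral_const_mul, GaussianFourier.integral_rexp_neg_mul_sq_norm ht,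
    Real.div_rpow Real.pi_pos.le ht.le, Real.rpow_sub ht]
  ring

-- The Gamma integral writes `P_y` as a superposition of Gaussians, whose masses are known.
theorem lintegral_halfSpacePoissonKernel {y : ℝ} (hy : 0 < y) :
    ∫⁻ z : E, ENNReal.ofReal (halfSpacePoissonKernel y z) = 1 := by
  simp_rw [ofReal_halfSpacePoissonKernel_eq_lintegral hy]
  set d : ℝ := (Module.finrank ℝ E : ℝ)
  have hmeas : Measurable (fun p : E × ℝ => ENNReal.ofReal
      (p.2 ^ ((d + 1) / 2 - 1) * Real.exp (-((‖p.1‖ ^ 2 + y ^ 2) * p.2)))) := by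
    fun_prop
  rw [lintegral_const_mul _ hmeas.lintegral_prod_right',
    lintegral_lintegral_swap hmeas.aemeasurable,
    setLIntegral_congr_fun measurableSet_Ioi
      fun t ht => lintegral_rpow_mul_exp_neg_norm_sq_add_mul _ (y ^ 2) ht,
    lintegral_const_mul _ (by fun_prop),
    show (d + 1) / 2 - 1 - d / 2 = 1 / 2 - 1 by ring,
    lintegral_rpow_mul_exp_neg_mul_Ioi (by norm_num) (by positivity),
    ← ENNReal.ofReal_mul (by positivity), ← ENNReal.ofReal_mul (by positivity),
    ENNReal.ofReal_eq_one, Real.Gamma_one_half_eq, Real.sqrt_eq_rpow, Real.rpow_neg (by positivity),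
    ← Real.sqrt_eq_rpow (y ^ 2), Real.sqrt_sq hy.le, show (d + 1) / 2 = d / 2 + 1 / 2 by ring,
    Real.rpow_add Real.pi_pos]
  field_simp
  rfl

end PoissonKernelMass

section Harnack

open Filter Topology

variable {X : Type*} [PseudoMetricSpace X] {F : X → ℝ≥0∞} {r : ℝ} {n : ℕ}

theorem tendsto_one_sub_dist_div_pow (r : ℝ) (n : ℕ) (x : X) :
    Tendsto (fun x' => (1 - dist x' x / r) ^ n) (𝓝 x) (𝓝 1) := by
  have hc : Continuous fun x' : X => (1 - dist x' x / r) ^ n := by fun_prop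
  simpa using hc.tendsto x

theorem lowerSemicontinuous_of_harnack (hr : 0 < r)
    (hF : ∀ x x', dist x' x ≤ r → ENNReal.ofReal ((1 - dist x' x / r) ^ n) * F x ≤ F x') :
    LowerSemicontinuous F := by
  intro x b hb
  have hlim : Tendsto (fun x' : X => ENNReal.ofReal ((1 - dist x' x / r) ^ n) * F x) (𝓝 x)
      (𝓝 (F x)) := by
    simpa using ENNReal.Tendsto.mul_const (b := F x)
      (ENNReal.tendsto_ofReal (tendsto_one_sub_dist_div_pow r n x)) (Or.inl (by simp))
  filter_upwards [hlim.eventually (lt_mem_nhds hb), Metric.ball_mem_nhds x hr] with x' hx' hball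
  exact hx'.trans_le (hF x x' (Metric.mem_ball.1 hball).le)

theorem continuous_toReal_of_harnack (hr : 0 < r)
    (hF : ∀ x x', dist x' x ≤ r → ENNReal.ofReal ((1 - dist x' x / r) ^ n) * F x ≤ F x')
    (hfin : ∀ x, F x ≠ ⊤) : Continuous fun x => (F x).toReal := by
  have hreal : ∀ x x', dist x' x ≤ r →
      (1 - dist x' x / r) ^ n * (F x).toReal ≤ (F x').toReal := fun x x' h => by
    simpa [ENNReal.toReal_ofReal (pow_nonneg (sub_nonneg.2 ((div_le_one hr).2 h)) n)]
      using ENNReal.toReal_mono (hfin x') (hF x x' h)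
  refine continuous_iff_continuousAt.2 fun x => ?_
  have hlim := tendsto_one_sub_dist_div_pow r n x
  have hball : ∀ᶠ x' in 𝓝 x, dist x' x < r := Metric.ball_mem_nhds x hr
  refine tendsto_of_tendsto_of_tendsto_of_le_of_le'
    (g := fun x' => (1 - dist x' x / r) ^ n * (F x).toReal)
    (h := fun x' => (F x).toReal / (1 - dist x' x / r) ^ n) ?_ ?_ ?_ ?_
  · simpa using hlim.mul_const (F x).toReal
  · simpa [Pi.div_def] using (tendsto_const_nhds (x := (F x).toReal)).div hlim one_ne_zero
  · exact hball.mono fun x' h => hreal x x' h.le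
  · refine hball.mono fun x' h => ?_
    rw [le_div_iff₀ (pow_pos (sub_pos.2 ((div_lt_one hr).2 h)) n), mul_comm]
    simpa only [dist_comm x x'] using hreal x' x (by rw [dist_comm]; exact h.le)

end Harnack

section PoissonExtension

open Filter Topology

variable {E : Type*} [NormedAddCommGroup E] [InnerProductSpace ℝ E]

theorem abs_mul_halfSpacePoissonKernel_nonneg (u : E → ℝ) {y : ℝ} (hy : 0 < y) (x z : E) :
    0 ≤ |u z| * halfSpacePoissonKernel y (x - z) :=
  mul_nonneg (abs_nonneg _) (halfSpacePoissonKernel_pos hy _).le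

variable [FiniteDimensional ℝ E] [MeasurableSpace E] [BorelSpace E]

theorem poissonExtensionAbs_harnack (u : E → ℝ) {y y' δ : ℝ} (hy : 0 < y) (x x' : E)
    (h : ‖x' - x‖ + |y' - y| ≤ δ) (hδ : δ ≤ y) :
    ENNReal.ofReal ((1 - δ / y) ^ (Module.finrank ℝ E + 2)) * poissonExtensionAbs u y x ≤
      poissonExtensionAbs u y' x' := by
  refine (lintegral_const_mul_le _ _).trans (lintegral_mono fun z => ?_)
  rw [← ENNReal.ofReal_mul (pow_nonneg (sub_nonneg.2 ((div_le_one hy).2 hδ)) _), mul_left_comm]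
  exact ENNReal.ofReal_le_ofReal (mul_le_mul_of_nonneg_left
    (halfSpacePoissonKernel_harnack hy _ _ (by simpa using h) hδ) (abs_nonneg _))

theorem poissonExtensionAbs_harnack_dist (u : E → ℝ) {y : ℝ} (hy : 0 < y) (x x' : E)
    (h : dist x' x ≤ y) :
    ENNReal.ofReal ((1 - dist x' x / y) ^ (Module.finrank ℝ E + 2)) * poissonExtensionAbs u y x ≤
      poissonExtensionAbs u y x' :=
  poissonExtensionAbs_harnack u hy x x' (by simp [dist_eq_norm]) h

/-- The truncated Poisson maximal function, in which only the levels `y ≥ ε` are used. -/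
noncomputable def poissonMaximalFrom (u : E → ℝ) (ε : ℝ) (x : E) : ℝ≥0∞ :=
  ⨆ (y : ℝ) (_ : ε ≤ y), poissonExtensionAbs u y x

theorem poissonExtensionAbs_le_poissonMaximalFrom (u : E → ℝ) {ε y : ℝ} (h : ε ≤ y) (x : E) :
    poissonExtensionAbs u y x ≤ poissonMaximalFrom u ε x :=
  le_iSup₂_of_le y h le_rfl

theorem poissonMaximalFrom_le_poissonMaximal (u : E → ℝ) {ε : ℝ} (hε : 0 < ε) (x : E) :
    poissonMaximalFrom u ε x ≤ poissonMaximal u x :=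
  iSup₂_le fun y hy => le_iSup₂_of_le y (hε.trans_le hy) le_rfl

theorem poissonMaximalFrom_anti (u : E → ℝ) {ε ε' : ℝ} (h : ε ≤ ε') (x : E) :
    poissonMaximalFrom u ε' x ≤ poissonMaximalFrom u ε x :=
  iSup₂_le fun y hy => le_iSup₂_of_le y (h.trans hy) le_rfl

theorem tendsto_poissonMaximalFrom (u : E → ℝ) (x : E) :
    Tendsto (fun k : ℕ => poissonMaximalFrom u (1 / ((k : ℝ) + 1)) x) atTop
      (𝓝 (poissonMaximal u x)) := by
  have hmono : Monotone (fun k : ℕ => poissonMaximalFrom u (1 / ((k : ℝ) + 1)) x) := by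
    intro k l hkl
    apply poissonMaximalFrom_anti
    gcongr
  convert tendsto_atTop_iSup hmono using 2
  refine le_antisymm (iSup₂_le fun y hy => ?_)
    (iSup_le fun k => poissonMaximalFrom_le_poissonMaximal u (by positivity) x)
  obtain ⟨k, hk⟩ := exists_nat_one_div_lt hy
  exact le_iSup_of_le k (poissonExtensionAbs_le_poissonMaximalFrom u hk.le x)

theorem poissonMaximalFrom_harnack (u : E → ℝ) {ε : ℝ} (hε : 0 < ε) (x x' : E)
    (h : dist x' x ≤ ε) :
    ENNReal.ofReal ((1 - dist x' x / ε) ^ (Module.finrank ℝ E + 2)) * poissonMaximalFrom u ε x ≤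
      poissonMaximalFrom u ε x' := by
  rw [poissonMaximalFrom]
  simp_rw [ENNReal.mul_iSup]
  refine iSup₂_le fun y hy => ?_
  refine le_trans ?_ ((poissonExtensionAbs_harnack_dist u (hε.trans_le hy) x x' (h.trans hy)).trans
    (poissonExtensionAbs_le_poissonMaximalFrom u hy x'))
  gcongr
  exact sub_nonneg.2 ((div_le_one hε).2 h)

theorem lowerSemicontinuous_poissonExtensionAbs (u : E → ℝ) {y : ℝ} (hy : 0 < y) :
    LowerSemicontinuous (poissonExtensionAbs u y) :=
  lowerSemicontinuous_of_harnack hy (poissonExtensionAbs_harnack_dist u hy)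

theorem lowerSemicontinuous_poissonMaximal (u : E → ℝ) : LowerSemicontinuous (poissonMaximal u) :=
  lowerSemicontinuous_biSup fun _ hy => lowerSemicontinuous_poissonExtensionAbs u hy

theorem continuous_poissonMaximalFrom (u : E → ℝ) {ε : ℝ} (hε : 0 < ε)
    (hfin : ∀ x, poissonMaximalFrom u ε x ≠ ⊤) :
    Continuous fun x => (poissonMaximalFrom u ε x).toReal :=
  continuous_toReal_of_harnack hε (poissonMaximalFrom_harnack u hε) hfin

theorem continuous_poissonExtensionAbs (u : E → ℝ) {y : ℝ} (hy : 0 < y)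
    (hfin : ∀ x, poissonExtensionAbs u y x ≠ ⊤) :
    Continuous fun x => (poissonExtensionAbs u y x).toReal :=
  continuous_toReal_of_harnack hy (poissonExtensionAbs_harnack_dist u hy) hfin

theorem continuousOn_poissonExtensionAbs_level (u : E → ℝ) {ε : ℝ} (hε : 0 < ε) (x : E)
    (hfin : ∀ y, ε ≤ y → poissonExtensionAbs u y x ≠ ⊤) :
    ContinuousOn (fun y => (poissonExtensionAbs u y x).toReal) (Ici ε) := by
  rw [continuousOn_iff_continuous_domRestrict]
  refine continuous_toReal_of_harnack (X := Ici ε) (F := fun y => poissonExtensionAbs u y x)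
    (n := Module.finrank ℝ E + 2) hε (fun y y' h => ?_) fun y => hfin y y.2
  have hy : 0 < (y : ℝ) := hε.trans_le y.2
  refine le_trans ?_ (poissonExtensionAbs_harnack u hy x x (δ := dist y' y)
    (by simp [Subtype.dist_eq, Real.dist_eq]) (h.trans y.2))
  gcongr
  exacts [sub_nonneg.2 ((div_le_one hε).2 h), y.2]

section SecondDifferences

variable {u : E → ℝ} {y : ℝ}

theorem aestronglyMeasurable_abs_mul_halfSpacePoissonKernel
    (hu : AEStronglyMeasurable u volume) (hy : 0 < y) (x : E) :
    AEStronglyMeasurable (fun z => |u z| * halfSpacePoissonKernel y (x - z)) volume :=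
  hu.norm.mul ((continuous_halfSpacePoissonKernel hy).comp
    (continuous_const.sub continuous_id)).aestronglyMeasurable

theorem integrable_poissonExtensionAbs (hu : AEStronglyMeasurable u volume)
    (hy : 0 < y) {x : E} (hfin : poissonExtensionAbs u y x ≠ ⊤) :
    Integrable (fun z => |u z| * halfSpacePoissonKernel y (x - z)) := by
  refine ⟨aestronglyMeasurable_abs_mul_halfSpacePoissonKernel hu hy x, ?_⟩
  rw [hasFiniteIntegral_iff_ofReal (.of_forall (abs_mul_halfSpacePoissonKernel_nonneg u hy x))]
  exact hfin.lt_top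

theorem toReal_poissonExtensionAbs (hu : AEStronglyMeasurable u volume) (hy : 0 < y) (x : E) :
    (poissonExtensionAbs u y x).toReal = ∫ z, |u z| * halfSpacePoissonKernel y (x - z) :=
  (integral_eq_lintegral_of_nonneg_ae (.of_forall (abs_mul_halfSpacePoissonKernel_nonneg u hy x))
    (aestronglyMeasurable_abs_mul_halfSpacePoissonKernel hu hy x)).symm

theorem integral_add_sub_two_mul {α : Type*} [MeasurableSpace α] {μ : Measure α} {f g h : α → ℝ}
    (hf : Integrable f μ) (hg : Integrable g μ) (hh : Integrable h μ) :
    ∫ x, (f x + g x - 2 * h x) ∂μ = ∫ x, f x ∂μ + ∫ x, g x ∂μ - 2 * ∫ x, h x ∂μ := by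
  rw [integral_sub (hf.fun_add hg) (hh.const_mul 2), integral_add hf hg, integral_const_mul]

theorem integral_second_differences {α ι : Type*} [MeasurableSpace α] {μ : Measure α} [Fintype ι]
    {f g : ι → α → ℝ} {v w h : α → ℝ} (hf : ∀ i, Integrable (f i) μ) (hg : ∀ i, Integrable (g i) μ)
    (hv : Integrable v μ) (hw : Integrable w μ) (hh : Integrable h μ) (a b c : ℝ) :
    ∫ z, ((∑ i, (f i z + g i z - 2 * h z)) / a + (v z + w z - 2 * h z) / b + c * h z) ∂μ =
      (∑ i, (∫ z, f i z ∂μ + ∫ z, g i z ∂μ - 2 * ∫ z, h z ∂μ)) / a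
        + (∫ z, v z ∂μ + ∫ z, w z ∂μ - 2 * ∫ z, h z ∂μ) / b + c * ∫ z, h z ∂μ := by
  have hfg : ∀ i, Integrable (fun z => f i z + g i z - 2 * h z) μ :=
    fun i => ((hf i).add (hg i)).sub (hh.const_mul 2)
  have hsum : Integrable (fun z => (∑ i, (f i z + g i z - 2 * h z)) / a) μ :=
    (integrable_finsetSum _ fun i _ => hfg i).div_const a
  have hvw : Integrable (fun z => (v z + w z - 2 * h z) / b) μ :=
    ((hv.fun_add hw).sub (hh.const_mul 2)).div_const b
  rw [integral_add (hsum.fun_add hvw) (hh.const_mul c), integral_add hsum hvw, integral_div,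
    integral_div, integral_const_mul, integral_finsetSum _ fun i _ => hfg i,
    integral_add_sub_two_mul hv hw hh]
  simp_rw [fun i => integral_add_sub_two_mul (hf i) (hg i) hh]

theorem poissonExtensionAbs_second_differences {ι : Type*} [Fintype ι] (b : OrthonormalBasis ι ℝ E)
    (hu : AEStronglyMeasurable u volume) {r s : ℝ} (hy : 0 < y) (hr : 0 < r)
    (hry : r ≤ y / 8) (hs : 0 < s) (hsy : s ≤ y / 8) (x : E)
    (hfin : ∀ x, poissonExtensionAbs u y x ≠ ⊤) (hfin_add : poissonExtensionAbs u (y + s) x ≠ ⊤)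
    (hfin_sub : poissonExtensionAbs u (y - s) x ≠ ⊤) :
    0 ≤ (∑ i, ((poissonExtensionAbs u y (x + r • b i)).toReal
          + (poissonExtensionAbs u y (x - r • b i)).toReal
          - 2 * (poissonExtensionAbs u y x).toReal)) / r ^ 2
      + ((poissonExtensionAbs u (y + s) x).toReal + (poissonExtensionAbs u (y - s) x).toReal
        - 2 * (poissonExtensionAbs u y x).toReal) / s ^ 2
      + poissonThirdConst E / y ^ 3 * (Fintype.card ι * r + s)
        * (poissonExtensionAbs u y x).toReal := by
  have hadd : 0 < y + s := by linarith
  have hsub : 0 < y - s := by linarith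
  have hint := fun x => integrable_poissonExtensionAbs hu hy (hfin x)
  simp_rw [toReal_poissonExtensionAbs hu hy, toReal_poissonExtensionAbs hu hsub,
    toReal_poissonExtensionAbs hu hadd]
  rw [← integral_second_differences (fun i => hint (x + r • b i)) (fun i => hint (x - r • b i))
    (integrable_poissonExtensionAbs hu hadd hfin_add)
    (integrable_poissonExtensionAbs hu hsub hfin_sub) (hint x)]
  refine integral_nonneg fun z => ?_
  refine (mul_nonneg (abs_nonneg (u z))
    (halfSpacePoissonKernel_second_differences b hy hr hry hs hsy (x - z))).trans_eq ?_
  simp only [add_sub_right_comm, sub_right_comm x _ z, mul_add, mul_div_assoc', Finset.mul_sum,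
    mul_sub]
  simp only [mul_left_comm |u z|]

end SecondDifferences

end PoissonExtension

section Detachment

open Filter Topology

theorem nonneg_of_forall_small_nonneg_add_mul {A B s₀ : ℝ} (hs₀ : 0 < s₀)
    (h : ∀ s, 0 < s → s ≤ s₀ → 0 ≤ A + B * s) : 0 ≤ A := by
  have hc : Tendsto (fun s : ℝ => A + B * s) (𝓝[>] 0) (𝓝 A) := by
    have hcont : Continuous fun s : ℝ => A + B * s := by fun_prop
    simpa using (hcont.tendsto 0).mono_left (nhdsWithin_le_nhds (s := Ioi 0))
  refine ge_of_tendsto hc ?_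
  filter_upwards [Ioc_mem_nhdsGT hs₀] with s hs using h s hs.1 hs.2

variable {E : Type*} [NormedAddCommGroup E] [InnerProductSpace ℝ E] [FiniteDimensional ℝ E]
  [MeasurableSpace E] [BorelSpace E] {u : E → ℝ} {ε : ℝ} {x : E}

theorem exists_lt_poissonExtensionAbs_of_not_attained (hε : 0 < ε)
    (hfin : poissonMaximalFrom u ε x ≠ ⊤)
    (h : ∀ y, ε ≤ y → poissonExtensionAbs u y x ≠ poissonMaximalFrom u ε x) {N : ℝ} (hN : ε ≤ N)
    {c : ℝ≥0∞} (hc : c < poissonMaximalFrom u ε x) :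
    ∃ y, N < y ∧ c < poissonExtensionAbs u y x := by
  have hle : ∀ y, ε ≤ y → poissonExtensionAbs u y x ≤ poissonMaximalFrom u ε x :=
    fun y hy => poissonExtensionAbs_le_poissonMaximalFrom u hy x
  have hfin' : ∀ y, ε ≤ y → poissonExtensionAbs u y x ≠ ⊤ :=
    fun y hy => ne_top_of_le_ne_top hfin (hle y hy)
  obtain ⟨y₀, hy₀, hmax⟩ := isCompact_Icc.exists_isMaxOn (nonempty_Icc.2 hN)
    ((continuousOn_poissonExtensionAbs_level u hε x hfin').mono
      (Icc_subset_Ici_self : Icc ε N ⊆ Ici ε))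
  have hlt : max c (poissonExtensionAbs u y₀ x) < poissonMaximalFrom u ε x :=
    max_lt hc ((hle y₀ hy₀.1).lt_of_ne (h y₀ hy₀.1))
  simp only [poissonMaximalFrom, lt_iSup_iff] at hlt
  obtain ⟨y, hy, hcy⟩ := hlt
  refine ⟨y, ?_, (le_max_left _ _).trans_lt hcy⟩
  by_contra! hyN
  exact ((le_max_right _ _).trans_lt hcy).not_ge
    ((ENNReal.toReal_le_toReal (hfin' y hy) (hfin' y₀ hy₀.1)).1 (hmax ⟨hy, hyN⟩))

-- The supremum is then approached as `y → ∞`, where the Harnack constant tends to `1`.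
theorem poissonMaximalFrom_le_of_not_attained (hε : 0 < ε) (hfin : poissonMaximalFrom u ε x ≠ ⊤)
    (h : ∀ y, ε ≤ y → poissonExtensionAbs u y x ≠ poissonMaximalFrom u ε x) (x' : E) :
    poissonMaximalFrom u ε x ≤ poissonMaximalFrom u ε x' := by
  refine le_of_forall_lt_imp_le_of_dense fun c hc => ?_
  set δ := dist x' x
  set n := Module.finrank ℝ E + 2
  have hlim : Tendsto (fun N : ℝ => ENNReal.ofReal ((1 - δ / N) ^ n) * c) atTop (𝓝 c) := by
    have hδ : Tendsto (fun N : ℝ => δ / N) atTop (𝓝 0) := tendsto_const_nhds.div_atTop tendsto_id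
    simpa using ENNReal.Tendsto.mul_const (b := c) (ENNReal.tendsto_ofReal
      (((tendsto_const_nhds (x := (1 : ℝ))).sub hδ).pow n)) (Or.inl (by simp))
  refine le_of_tendsto hlim ?_
  filter_upwards [eventually_ge_atTop ε, eventually_ge_atTop δ] with N hεN hδN
  obtain ⟨y, hNy, hcy⟩ := exists_lt_poissonExtensionAbs_of_not_attained hε hfin h hεN hc
  have hN : 0 < N := hε.trans_le hεN
  calc ENNReal.ofReal ((1 - δ / N) ^ n) * c
      ≤ ENNReal.ofReal ((1 - δ / y) ^ n) * poissonExtensionAbs u y x := by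
        gcongr
        exact sub_nonneg.2 ((div_le_one hN).2 hδN)
    _ ≤ poissonExtensionAbs u y x' :=
        poissonExtensionAbs_harnack_dist u (hN.trans hNy) x x' (hδN.trans hNy.le)
    _ ≤ poissonMaximalFrom u ε x' :=
        poissonExtensionAbs_le_poissonMaximalFrom u (hεN.trans hNy.le) x'

variable {ι : Type*} [Fintype ι] {r : ℝ}

-- At an interior maximum in `y` the vertical second difference is nonpositive.
theorem poissonExtensionAbs_sum_second_differences_nonneg (b : OrthonormalBasis ι ℝ E)
    (hu : AEStronglyMeasurable u volume) (hε : 0 < ε)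
    (hfin : ∀ y, ε ≤ y → ∀ x, poissonExtensionAbs u y x ≠ ⊤) {y : ℝ} (hy : ε < y)
    (hmax : ∀ y', ε ≤ y' → poissonExtensionAbs u y' x ≤ poissonExtensionAbs u y x)
    (hr : 0 < r) (hry : r ≤ y / 8) :
    0 ≤ ∑ i, ((poissonExtensionAbs u y (x + r • b i)).toReal
          + (poissonExtensionAbs u y (x - r • b i)).toReal
          - 2 * (poissonExtensionAbs u y x).toReal)
      + poissonThirdConst E * Fintype.card ι / y ^ 3 * r ^ 3
        * (poissonExtensionAbs u y x).toReal := by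
  set V := (poissonExtensionAbs u y x).toReal
  set S := ∑ i, ((poissonExtensionAbs u y (x + r • b i)).toReal
    + (poissonExtensionAbs u y (x - r • b i)).toReal - 2 * V)
  have hmax' : ∀ y', ε ≤ y' → (poissonExtensionAbs u y' x).toReal ≤ V :=
    fun y' hy' => ENNReal.toReal_mono (hfin y hy.le x) (hmax y' hy')
  have key : 0 ≤ S / r ^ 2 + poissonThirdConst E / y ^ 3 * (Fintype.card ι * r) * V := by
    refine nonneg_of_forall_small_nonneg_add_mul (B := poissonThirdConst E / y ^ 3 * V)
      (s₀ := min (y / 8) (y - ε)) (lt_min (by linarith) (by linarith)) fun s hs hs_le => ?_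
    obtain ⟨hsy, hsε⟩ := le_min_iff.1 hs_le
    have hadd : ε ≤ y + s := by linarith
    have hsub : ε ≤ y - s := by linarith
    have hdiff := poissonExtensionAbs_second_differences b hu (hε.trans hy) hr hry hs hsy x
      (hfin y hy.le) (hfin _ hadd x) (hfin _ hsub x)
    have hver : ((poissonExtensionAbs u (y + s) x).toReal
        + (poissonExtensionAbs u (y - s) x).toReal - 2 * V) / s ^ 2 ≤ 0 :=
      div_nonpos_of_nonpos_of_nonneg (by linarith [hmax' _ hadd, hmax' _ hsub]) (sq_nonneg s)
    linarith
  calc 0 ≤ r ^ 2 * (S / r ^ 2 + poissonThirdConst E / y ^ 3 * (Fintype.card ι * r) * V) :=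
        mul_nonneg (sq_nonneg r) key
    _ = S + poissonThirdConst E * Fintype.card ι / y ^ 3 * r ^ 3 * V := by
        rw [mul_add, mul_div_cancel₀ _ (by positivity)]
        ring

theorem poissonMaximalFrom_second_differences (b : OrthonormalBasis ι ℝ E)
    (hu : AEStronglyMeasurable u volume) (hε : 0 < ε) (hfin : ∀ x, poissonMaximalFrom u ε x ≠ ⊤)
    (hx : (poissonExtensionAbs u ε x).toReal < (poissonMaximalFrom u ε x).toReal)
    (hr : 0 < r) (hrε : r ≤ ε / 8) :
    0 ≤ ∑ i, ((poissonMaximalFrom u ε (x + r • b i)).toReal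
          + (poissonMaximalFrom u ε (x - r • b i)).toReal
          - 2 * (poissonMaximalFrom u ε x).toReal)
      + poissonThirdConst E * Fintype.card ι / ε ^ 3 * r ^ 3
        * (poissonMaximalFrom u ε x).toReal := by
  have hC := poissonThirdConst_nonneg (E := E)
  have hle : ∀ y, ε ≤ y → ∀ x, poissonExtensionAbs u y x ≤ poissonMaximalFrom u ε x :=
    fun y hy x => poissonExtensionAbs_le_poissonMaximalFrom u hy x
  by_cases hattained : ∃ y, ε ≤ y ∧ poissonExtensionAbs u y x = poissonMaximalFrom u ε x
  · obtain ⟨y, hy, hyx⟩ := hattained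
    have hεy : ε < y := hy.lt_of_ne fun h => by simp [h, hyx] at hx
    have hbase := poissonExtensionAbs_sum_second_differences_nonneg b hu hε
      (fun y hy x => ne_top_of_le_ne_top (hfin x) (hle y hy x)) hεy
      (fun y' hy' => (hle y' hy' x).trans_eq hyx.symm) hr (hrε.trans (by linarith))
    rw [hyx] at hbase
    refine hbase.trans (add_le_add (Finset.sum_le_sum fun i _ => ?_) (by gcongr))
    linarith [ENNReal.toReal_mono (hfin _) (hle y hy (x + r • b i)),
      ENNReal.toReal_mono (hfin _) (hle y hy (x - r • b i))]
  · push Not at hattained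
    have hmin := fun x' => ENNReal.toReal_mono (hfin x')
      (poissonMaximalFrom_le_of_not_attained hε (hfin x) hattained x')
    refine add_nonneg (Finset.sum_nonneg fun i _ => ?_) (by positivity)
    linarith [hmin (x + r • b i), hmin (x - r • b i)]

end Detachment

section SecondDifferenceConvexity

open Filter Topology

theorem nonpos_of_second_difference_pos {H : ℝ → ℝ} {a b : ℝ} (hH : ContinuousOn H (Icc a b))
    (ha : H a ≤ 0) (hb : H b ≤ 0)
    (h : ∀ t ∈ Ioo a b, ∀ᶠ r in 𝓝[>] 0, 0 < H (t + r) + H (t - r) - 2 * H t)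
    {v : ℝ} (hv : v ∈ Icc a b) : H v ≤ 0 := by
  by_contra! hpos
  obtain ⟨t, ht, hmax⟩ := isCompact_Icc.exists_isMaxOn ⟨v, hv⟩ hH
  have hHt : 0 < H t := hpos.trans_le (hmax hv)
  have hat : a < t := ht.1.lt_of_ne fun h => by linarith [h ▸ hHt]
  have htb : t < b := ht.2.lt_of_ne fun h => by linarith [h ▸ hHt]
  have hsmall : ∀ᶠ r in 𝓝[>] (0 : ℝ), r ∈ Ioc 0 (min (t - a) (b - t)) :=
    Ioc_mem_nhdsGT (lt_min (sub_pos.2 hat) (sub_pos.2 htb))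
  obtain ⟨r, hr, hr0, hr_le⟩ := ((h t ⟨hat, htb⟩).and hsmall).exists
  obtain ⟨hra, hrb⟩ := le_min_iff.1 hr_le
  have hadd : H (t + r) ≤ H t := hmax ⟨by linarith, by linarith⟩
  have hsub : H (t - r) ≤ H t := hmax ⟨by linarith, by linarith⟩
  linarith

theorem le_chord_of_second_difference {g : ℝ → ℝ} {a b C r₀ : ℝ} (hab : a < b)
    (hg : ContinuousOn g (Icc a b)) (hr₀ : 0 < r₀)
    (h : ∀ z ∈ Ioo a b, ∀ r, 0 < r → r ≤ r₀ → 0 ≤ g (z + r) + g (z - r) - 2 * g z + C * r ^ 3)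
    {v : ℝ} (hv : v ∈ Icc a b) : g v ≤ g a + (g b - g a) / (b - a) * (v - a) := by
  set m := (g b - g a) / (b - a)
  have hm : m * (b - a) = g b - g a := div_mul_cancel₀ _ (sub_pos.2 hab).ne'
  have hperturbed : ∀ η, 0 < η → η ≤ 1 →
      0 ≤ -(g v - (g a + m * (v - a))) + (v - a) * (b - v) * η := by
    intro η hη _
    have hle := nonpos_of_second_difference_pos
      (H := fun t => g t - (g a + m * (t - a)) + η * ((t - a) * (t - b)))
      (by fun_prop) (by simp) (by simp [hm]) (fun t ht => ?_) hv
    · linarith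
    have hC : ∀ᶠ r in 𝓝[>] (0 : ℝ), 0 < 2 * η - C * r := by
      have hcont : Continuous fun r => 2 * η - C * r := by fun_prop
      exact nhdsWithin_le_nhds ((hcont.tendsto 0).eventually (lt_mem_nhds (by simpa)))
    filter_upwards [Ioc_mem_nhdsGT hr₀, hC] with r hr hrC
    linarith [h t ht r hr.1 hr.2, mul_pos (pow_pos hr.1 2) hrC]
  linarith [nonneg_of_forall_small_nonneg_add_mul one_pos hperturbed]

theorem convexOn_Icc_of_second_difference {g : ℝ → ℝ} {x y C r₀ : ℝ}
    (hg : ContinuousOn g (Icc x y)) (hr₀ : 0 < r₀)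
    (h : ∀ z ∈ Ioo x y, ∀ r, 0 < r → r ≤ r₀ → 0 ≤ g (z + r) + g (z - r) - 2 * g z + C * r ^ 3) :
    ConvexOn ℝ (Icc x y) g := by
  refine LinearOrder.convexOn_of_lt (convex_Icc x y) fun a ha b hb hab p q hp hq hpq => ?_
  have hsub : Icc a b ⊆ Icc x y := Icc_subset_Icc ha.1 hb.2
  have hpa : p • a + q • b - a = q * (b - a) := by
    simp only [smul_eq_mul]
    linear_combination a * hpq
  have hmem : p • a + q • b ∈ Icc a b :=
    convex_Icc a b ⟨le_rfl, hab.le⟩ ⟨hab.le, le_rfl⟩ hp.le hq.le hpq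
  refine (le_chord_of_second_difference hab (hg.mono hsub) hr₀
    (fun z hz => h z ⟨ha.1.trans_lt hz.1, hz.2.trans_le hb.2⟩) hmem).trans_eq ?_
  rw [hpa, mul_left_comm, div_mul_cancel₀ _ (sub_pos.2 hab).ne', smul_eq_mul, smul_eq_mul]
  linear_combination -g a * hpq

end SecondDifferenceConvexity

section ContactEnergy

/-- An even convex energy density `ψ` with `ψ 0 = 0`, and a selection `σ` of its subgradients with
`σ 0 = 0`. -/
structure IsEnergyDensity (ψ σ : ℝ → ℝ) : Prop where
  map_zero : ψ 0 = 0
  even : ψ.Even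
  continuous : Continuous ψ
  subgradient : ∀ s t, ψ t + σ t * (s - t) ≤ ψ s
  subgradient_zero : σ 0 = 0

variable {ψ σ : ℝ → ℝ}

theorem IsEnergyDensity.monotone (h : IsEnergyDensity ψ σ) : Monotone σ := by
  intro s t hst
  rcases hst.eq_or_lt with rfl | hst
  · rfl
  have hmul : 0 ≤ (σ t - σ s) * (t - s) := by linarith [h.subgradient s t, h.subgradient t s]
  exact sub_nonneg.1 (nonneg_of_mul_nonneg_left hmul (sub_pos.2 hst))

theorem IsEnergyDensity.subgradient_nonneg (h : IsEnergyDensity ψ σ) {t : ℝ} (ht : 0 ≤ t) :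
    0 ≤ σ t :=
  h.subgradient_zero.symm.trans_le (h.monotone ht)

theorem IsEnergyDensity.subgradient_nonpos (h : IsEnergyDensity ψ σ) {t : ℝ} (ht : t ≤ 0) :
    σ t ≤ 0 :=
  (h.monotone ht).trans_eq h.subgradient_zero

theorem IsEnergyDensity.nonneg (h : IsEnergyDensity ψ σ) (t : ℝ) : 0 ≤ ψ t := by
  simpa [h.map_zero, h.subgradient_zero] using h.subgradient t 0

theorem IsEnergyDensity.map_abs (h : IsEnergyDensity ψ σ) (t : ℝ) : ψ |t| = ψ t := by
  rcases abs_choice t with ht | ht <;> simp only [ht, h.even t]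

theorem IsEnergyDensity.mono_abs (h : IsEnergyDensity ψ σ) {s t : ℝ} (hst : |s| ≤ |t|) :
    ψ s ≤ ψ t := by
  rw [← h.map_abs s, ← h.map_abs t]
  have hnonneg := mul_nonneg (h.subgradient_nonneg (abs_nonneg s)) (sub_nonneg.2 hst)
  linarith [h.subgradient |t| |s|]

/-- The `ψ`-energy of the chord of `w` over `[a, b]`. -/
noncomputable def chordEnergy (ψ w : ℝ → ℝ) (a b : ℝ) : ℝ := ψ ((w b - w a) / (b - a)) * (b - a)

/-- `PartialEnergy ψ w x T` holds if `T` is the sum of the chord energies of `w` along a partition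
that ends in `x`. -/
inductive PartialEnergy (ψ w : ℝ → ℝ) : ℝ → ℝ → Prop
  | start (x : ℝ) : PartialEnergy ψ w x 0
  | step {x x' T : ℝ} : PartialEnergy ψ w x T → x ≤ x' →
      PartialEnergy ψ w x' (T + chordEnergy ψ w x x')

/-- The increments of `e : ℝ → [0, K]` dominate the `ψ`-energies of the chords of `w`. -/
structure IsCumulativeEnergy (ψ w e : ℝ → ℝ) (K : ℝ) : Prop where
  nonneg : ∀ x, 0 ≤ e x
  le : ∀ x, e x ≤ K
  chord_le : ∀ {a b}, a < b → chordEnergy ψ w a b ≤ e b - e a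

@[simp] theorem chordEnergy_self (ψ w : ℝ → ℝ) (a : ℝ) : chordEnergy ψ w a a = 0 := by
  simp [chordEnergy]

theorem chordEnergy_nonneg (h : IsEnergyDensity ψ σ) (w : ℝ → ℝ) {a b : ℝ} (hab : a ≤ b) :
    0 ≤ chordEnergy ψ w a b :=
  mul_nonneg (h.nonneg _) (sub_nonneg.2 hab)

theorem subgradient_le_chordEnergy (h : IsEnergyDensity ψ σ) (w : ℝ → ℝ) {a b : ℝ} (hab : a < b)
    (t : ℝ) : ψ t * (b - a) + σ t * (w b - w a - t * (b - a)) ≤ chordEnergy ψ w a b := by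
  have hpos : 0 < b - a := sub_pos.2 hab
  calc ψ t * (b - a) + σ t * (w b - w a - t * (b - a))
      = (ψ t + σ t * ((w b - w a) / (b - a) - t)) * (b - a) := by field_simp
    _ ≤ chordEnergy ψ w a b := mul_le_mul_of_nonneg_right (h.subgradient _ t) hpos.le

theorem chordEnergy_le_add (h : IsEnergyDensity ψ σ) (w : ℝ → ℝ) {a c b : ℝ} (hac : a ≤ c)
    (hcb : c ≤ b) : chordEnergy ψ w a b ≤ chordEnergy ψ w a c + chordEnergy ψ w c b := by
  rcases hac.eq_or_lt with rfl | hac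
  · simp
  rcases hcb.eq_or_lt with rfl | hcb
  · simp
  set t := (w b - w a) / (b - a) with ht
  have hslope : w b - w a = t * (b - a) := (div_mul_cancel₀ _ (sub_pos.2 (hac.trans hcb)).ne').symm
  calc chordEnergy ψ w a b
      = ψ t * (b - a) + σ t * (w b - w a - t * (b - a)) := by
        rw [hslope, sub_self, mul_zero, add_zero, chordEnergy, ← ht]
    _ = ψ t * (c - a) + σ t * (w c - w a - t * (c - a))
        + (ψ t * (b - c) + σ t * (w b - w c - t * (b - c))) := by ring
    _ ≤ _ := add_le_add (subgradient_le_chordEnergy h w hac t)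
        (subgradient_le_chordEnergy h w hcb t)

theorem chordEnergy_le_tangent (h : IsEnergyDensity ψ σ) (f g : ℝ → ℝ) {a b : ℝ} (hab : a < b) :
    chordEnergy ψ g a b ≤ chordEnergy ψ f a b
      + σ ((g b - g a) / (b - a)) * ((g b - f b) - (g a - f a)) := by
  set t := (g b - g a) / (b - a) with ht
  have hslope : t * (b - a) = g b - g a := div_mul_cancel₀ _ (sub_pos.2 hab).ne'
  have hf := subgradient_le_chordEnergy h f hab t
  rw [hslope] at hf
  rw [chordEnergy, ← ht]
  linarith

theorem chordEnergy_abs_le (h : IsEnergyDensity ψ σ) (w : ℝ → ℝ) {a b : ℝ} (hab : a ≤ b) :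
    chordEnergy ψ (fun x => |w x|) a b ≤ chordEnergy ψ w a b := by
  refine mul_le_mul_of_nonneg_right (h.mono_abs ?_) (sub_nonneg.2 hab)
  rw [abs_div, abs_div]
  exact div_le_div_of_nonneg_right (abs_abs_sub_abs_le _ _) (abs_nonneg _)

theorem IsCumulativeEnergy.monotone (h : IsEnergyDensity ψ σ) {w e : ℝ → ℝ} {K : ℝ}
    (he : IsCumulativeEnergy ψ w e K) : Monotone e := by
  intro a b hab
  rcases hab.eq_or_lt with rfl | hlt
  · rfl
  · exact sub_nonneg.1 ((chordEnergy_nonneg h w hab).trans (he.chord_le hlt))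

theorem IsCumulativeEnergy.abs (h : IsEnergyDensity ψ σ) {w e : ℝ → ℝ} {K : ℝ}
    (he : IsCumulativeEnergy ψ w e K) : IsCumulativeEnergy ψ (fun x => |w x|) e K :=
  ⟨he.nonneg, he.le, fun hab => (chordEnergy_abs_le h w hab.le).trans (he.chord_le hab)⟩

/-- A function `g` that is bounded above, and convex on the intervals where it is detached from
`f ≤ g`; `e` is a bounded cumulative energy of `f`. -/
structure ContactData (ψ f g e : ℝ → ℝ) (K : ℝ) : Prop where
  le : ∀ x, f x ≤ g x
  continuous_f : Continuous f
  continuous_g : Continuous g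
  convex : ∀ {x y}, x < y → (∀ z ∈ Ioo x y, f z < g z) → ConvexOn ℝ (Icc x y) g
  bdd : BddAbove (range g)
  energy : IsCumulativeEnergy ψ f e K

/-- The invariant of the induction along a partition: the energy `T` of `g` up to `x` is at most
`e x`, up to an error which pays for the gap `g x - f x` with the slope of any chord starting in
`x` over which `g` stays detached. -/
def ContactInvariant (σ f g e : ℝ → ℝ) (x T : ℝ) : Prop :=
  (f x = g x → T ≤ e x) ∧ ∀ y, x < y → (∀ z ∈ Ioo x y, f z < g z) →
    T ≤ e x + σ ((g y - g x) / (y - x)) * (g x - f x)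

variable {f g e : ℝ → ℝ} {K : ℝ}

theorem ContactInvariant.mono {x T T' : ℝ} (h : ContactInvariant σ f g e x T) (hT : T' ≤ T) :
    ContactInvariant σ f g e x T' :=
  ⟨fun hx => hT.trans (h.1 hx), fun y hy hz => hT.trans (h.2 y hy hz)⟩

theorem contactInvariant_of_contact {x T : ℝ} (hx : f x = g x) (hT : T ≤ e x) :
    ContactInvariant σ f g e x T :=
  ⟨fun _ => hT, fun y _ _ => by rwa [hx, sub_self, mul_zero, add_zero]⟩

theorem ContactInvariant.step_detached (h : IsEnergyDensity ψ σ) (D : ContactData ψ f g e K)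
    {x x' T : ℝ} (hI : ContactInvariant σ f g e x T) (hx : x ≤ x')
    (hd : ∀ z ∈ Ioo x x', f z < g z) :
    ContactInvariant σ f g e x' (T + chordEnergy ψ g x x') := by
  rcases hx.eq_or_lt with rfl | hx
  · simpa using hI
  set s := (g x' - g x) / (x' - x)
  have hend : T + chordEnergy ψ g x x' ≤ e x' + σ s * (g x' - f x') := by
    linarith [hI.2 x' hx hd, chordEnergy_le_tangent h f g hx, D.energy.chord_le hx]
  by_cases hc : f x' = g x'
  · refine contactInvariant_of_contact hc ?_
    rwa [hc, sub_self, mul_zero, add_zero] at hend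
  refine ⟨fun hc' => absurd hc' hc, fun y hy hdy => ?_⟩
  have hlt : f x' < g x' := (D.le x').lt_of_ne hc
  have hconvex := D.convex (hx.trans hy) fun z hz => by
    rcases lt_trichotomy z x' with hz' | rfl | hz'
    · exact hd z ⟨hz.1, hz'⟩
    · exact hlt
    · exact hdy z ⟨hz', hz.2⟩
  have hslope := hconvex.slope_mono_adjacent ⟨le_rfl, (hx.trans hy).le⟩
    ⟨(hx.trans hy).le, le_rfl⟩ hx hy
  refine hend.trans (add_le_add_right (mul_le_mul_of_nonneg_right (h.monotone hslope) ?_) _)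
  linarith

theorem ContactInvariant.step (h : IsEnergyDensity ψ σ) (D : ContactData ψ f g e K)
    {x x' T : ℝ} (hI : ContactInvariant σ f g e x T) (hx : x ≤ x') :
    ContactInvariant σ f g e x' (T + chordEnergy ψ g x x') := by
  by_cases hd : ∀ z ∈ Ioo x x', f z < g z
  · exact hI.step_detached h D hx hd
  push Not at hd
  obtain ⟨c, hc, hcg⟩ := hd
  have hcompact : IsCompact (Icc x x' ∩ {z | f z = g z}) :=
    isCompact_Icc.inter_right (isClosed_eq D.continuous_f D.continuous_g)
  have hne : (Icc x x' ∩ {z | f z = g z}).Nonempty :=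
    ⟨c, ⟨hc.1.le, hc.2.le⟩, (D.le c).antisymm hcg⟩
  obtain ⟨b, ⟨hb, hfb : f b = g b⟩, hleast⟩ := hcompact.exists_isLeast hne
  obtain ⟨a, ⟨ha, hfa : f a = g a⟩, hgreatest⟩ := hcompact.exists_isGreatest hne
  have hba : b ≤ a := hleast ⟨ha, hfa⟩
  have hIb := hI.step_detached h D hb.1 fun z hz => (D.le z).lt_of_ne fun hz' =>
    hz.2.not_ge (hleast ⟨⟨hz.1.le, hz.2.le.trans hb.2⟩, hz'⟩)
  have hIa : ContactInvariant σ f g e a (T + chordEnergy ψ g x b + chordEnergy ψ g b a) := by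
    refine contactInvariant_of_contact hfa ?_
    rcases hba.eq_or_lt with rfl | hba
    · simpa using hIb.1 hfb
    · have hfg : chordEnergy ψ g b a = chordEnergy ψ f b a := by simp only [chordEnergy, hfa, hfb]
      linarith [hIb.1 hfb, D.energy.chord_le hba]
  have hIx' := hIa.step_detached h D ha.2 fun z hz => (D.le z).lt_of_ne fun hz' =>
    hz.1.not_ge (hgreatest ⟨⟨ha.1.trans hz.1.le, hz.2.le⟩, hz'⟩)
  refine hIx'.mono ?_
  linarith [chordEnergy_le_add h g hb.1 hb.2, chordEnergy_le_add h g hba ha.2]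

theorem nonpos_of_forall_add_mul_le {a s B : ℝ} (h : ∀ t, 0 < t → a + s * t ≤ B) : s ≤ 0 := by
  by_contra! hs
  have hBa : 0 < B - a + 1 := by linarith [h 1 one_pos]
  have hlarge := h ((B - a + 1) / s) (div_pos hBa hs)
  rw [mul_div_cancel₀ _ hs.ne'] at hlarge
  linarith

theorem ContactData.slope_nonneg (D : ContactData ψ f g e K) {x y : ℝ} (hxy : x < y)
    (hd : ∀ z < y, f z < g z) : 0 ≤ (g y - g x) / (y - x) := by
  obtain ⟨B, hB⟩ := D.bdd
  rw [← neg_nonpos]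
  refine nonpos_of_forall_add_mul_le (a := g x) (B := B) fun t ht => ?_
  have hconvex := D.convex (x := x - t) (y := y) (by linarith) fun z hz => hd z hz.2
  have hslope := hconvex.slope_mono_adjacent (x := x - t) (y := x) (z := y)
    ⟨le_rfl, by linarith⟩ ⟨by linarith, le_rfl⟩ (by linarith) hxy
  rw [div_le_iff₀ (by linarith)] at hslope
  linarith [hB (mem_range_self (x - t))]

theorem ContactData.slope_nonpos (D : ContactData ψ f g e K) {x y : ℝ} (hxy : x < y)
    (hd : ∀ z, x < z → f z < g z) : (g y - g x) / (y - x) ≤ 0 := by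
  obtain ⟨B, hB⟩ := D.bdd
  refine nonpos_of_forall_add_mul_le (a := g y) (B := B) fun t ht => ?_
  have hconvex := D.convex (x := x) (y := y + t) (by linarith) fun z hz => hd z hz.1
  have hslope := hconvex.slope_mono_adjacent (x := x) (y := y) (z := y + t)
    ⟨le_rfl, by linarith⟩ ⟨by linarith, le_rfl⟩ hxy (by linarith)
  rw [le_div_iff₀ (by linarith)] at hslope
  linarith [hB (mem_range_self (y + t))]

theorem ContactData.exists_start (h : IsEnergyDensity ψ σ) (D : ContactData ψ f g e K) (x : ℝ) :
    ∃ T, 0 ≤ T ∧ ContactInvariant σ f g e x T := by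
  by_cases hc : ∃ c ≤ x, f c = g c
  · obtain ⟨c, hcx, hc⟩ := hc
    refine ⟨0 + chordEnergy ψ g c x, ?_, ?_⟩
    · rw [zero_add]
      exact chordEnergy_nonneg h g hcx
    · exact (contactInvariant_of_contact hc (D.energy.nonneg c)).step h D hcx
  push Not at hc
  refine ⟨0, le_rfl, fun _ => D.energy.nonneg x, fun y hy hd => ?_⟩
  have hslope : 0 ≤ (g y - g x) / (y - x) := D.slope_nonneg hy fun z hz =>
    (le_or_gt z x).elim (fun h => (D.le z).lt_of_ne (hc z h)) fun h => hd z ⟨h, hz⟩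
  exact add_nonneg (D.energy.nonneg x)
    (mul_nonneg (h.subgradient_nonneg hslope) (sub_nonneg.2 (D.le x)))

theorem ContactInvariant.le (h : IsEnergyDensity ψ σ) (D : ContactData ψ f g e K) {x T : ℝ}
    (hI : ContactInvariant σ f g e x T) : T ≤ K := by
  by_cases hc : ∃ c ≥ x, f c = g c
  · obtain ⟨c, hcx, hc⟩ := hc
    linarith [(hI.step h D hcx).1 hc, chordEnergy_nonneg h g hcx, D.energy.le c]
  push Not at hc
  have hd : ∀ z, x < z → f z < g z := fun z hz => (D.le z).lt_of_ne (hc z hz.le)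
  have hx : x < x + 1 := lt_add_one x
  have herror : σ ((g (x + 1) - g x) / (x + 1 - x)) * (g x - f x) ≤ 0 :=
    mul_nonpos_of_nonpos_of_nonneg (h.subgradient_nonpos (D.slope_nonpos hx hd))
      (sub_nonneg.2 (D.le x))
  linarith [hI.2 (x + 1) hx fun z hz => hd z hz.1, D.energy.le x]

theorem PartialEnergy.le_of_contactData (h : IsEnergyDensity ψ σ) (D : ContactData ψ f g e K)
    {x T : ℝ} (hT : PartialEnergy ψ g x T) : T ≤ K := by
  suffices ∃ T', T ≤ T' ∧ ContactInvariant σ f g e x T' by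
    obtain ⟨T', hT', hI⟩ := this
    exact hT'.trans (hI.le h D)
  induction hT with
  | start x => exact D.exists_start h x
  | step _ hx ih =>
    obtain ⟨T', hT', hI⟩ := ih
    exact ⟨_, add_le_add_left hT' _, hI.step h D hx⟩

end ContactEnergy

section BoundedExtension

variable {E : Type*} [NormedAddCommGroup E] [InnerProductSpace ℝ E] [FiniteDimensional ℝ E]
  [MeasurableSpace E] [BorelSpace E]

theorem poissonExtensionAbs_congr {u v : E → ℝ} (h : u =ᵐ[volume] v) (y : ℝ) (x : E) :
    poissonExtensionAbs u y x = poissonExtensionAbs v y x := by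
  refine lintegral_congr_ae ?_
  filter_upwards [h] with z hz
  rw [hz]

theorem poissonMaximal_congr {u v : E → ℝ} (h : u =ᵐ[volume] v) :
    poissonMaximal u = poissonMaximal v := by
  funext x
  simp only [poissonMaximal, poissonExtensionAbs_congr h]

theorem poissonExtensionAbs_le_of_bound {u : E → ℝ} {B : ℝ} (hB : ∀ᵐ z, |u z| ≤ B) {y : ℝ}
    (hy : 0 < y) (x : E) : poissonExtensionAbs u y x ≤ ENNReal.ofReal B := by
  calc poissonExtensionAbs u y x
      ≤ ∫⁻ z, ENNReal.ofReal B * ENNReal.ofReal (halfSpacePoissonKernel y (x - z)) := by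
        refine lintegral_mono_ae ?_
        filter_upwards [hB] with z hz
        rw [ENNReal.ofReal_mul (abs_nonneg _)]
        gcongr
    _ = ENNReal.ofReal B := by
        rw [lintegral_const_mul' _ _ ENNReal.ofReal_ne_top,
          lintegral_sub_left_eq_self (fun z => ENNReal.ofReal (halfSpacePoissonKernel y z)) x,
          lintegral_halfSpacePoissonKernel hy, mul_one]

theorem poissonMaximal_le_of_bound {u : E → ℝ} {B : ℝ} (hB : ∀ᵐ z, |u z| ≤ B) (x : E) :
    poissonMaximal u x ≤ ENNReal.ofReal B :=
  iSup₂_le fun _ hy => poissonExtensionAbs_le_of_bound hB hy x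

theorem memLp_top_poissonMaximal {u : E → ℝ} {B : ℝ} (hB : ∀ᵐ z, |u z| ≤ B) :
    MemLp (fun x => (poissonMaximal u x).toReal) ⊤ volume := by
  refine memLp_top_of_bound
    (lowerSemicontinuous_poissonMaximal u).measurable.ennreal_toReal.aestronglyMeasurable
    (max B 0) (.of_forall fun x => ?_)
  rw [Real.norm_of_nonneg ENNReal.toReal_nonneg, ← ENNReal.toReal_ofReal']
  exact ENNReal.toReal_mono ENNReal.ofReal_ne_top (poissonMaximal_le_of_bound hB x)

variable (E) in
/-- The probability measure on `E` with the Poisson kernel `P_y` as its density: the harmonic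
measure of the half-space, seen from height `y` above the origin. -/
noncomputable def poissonMeasure (y : ℝ) : Measure E :=
  volume.withDensity fun z => ENNReal.ofReal (halfSpacePoissonKernel y z)

theorem isProbabilityMeasure_poissonMeasure {y : ℝ} (hy : 0 < y) :
    IsProbabilityMeasure (poissonMeasure E y) :=
  ⟨by rw [poissonMeasure, withDensity_apply _ .univ, setLIntegral_univ,
    lintegral_halfSpacePoissonKernel hy]⟩

theorem poissonExtensionAbs_eq_lintegral_poissonMeasure {u : E → ℝ}
    (hu : AEStronglyMeasurable u volume) {y : ℝ} (hy : 0 < y) (x : E) :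
    poissonExtensionAbs u y x = ∫⁻ z, ‖u (x - z)‖ₑ ∂poissonMeasure E y := by
  have hux : AEStronglyMeasurable (fun z => u (x - z)) volume :=
    hu.comp_quasiMeasurePreserving (quasiMeasurePreserving_sub_left volume x)
  rw [poissonMeasure, lintegral_withDensity_eq_lintegral_mul₀
      (continuous_halfSpacePoissonKernel hy).measurable.ennreal_ofReal.aemeasurable hux.enorm,
    poissonExtensionAbs, ← lintegral_sub_left_eq_self _ x]
  refine lintegral_congr fun z => ?_
  rw [sub_sub_cancel, ENNReal.ofReal_mul (abs_nonneg _), ← Real.norm_eq_abs, ofReal_norm, mul_comm]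
  rfl

theorem toReal_poissonExtensionAbs_eq_integral_poissonMeasure {u : E → ℝ} (hu : Measurable u)
    {y : ℝ} (hy : 0 < y) (x : E) :
    (poissonExtensionAbs u y x).toReal = ∫ z, |u (x - z)| ∂poissonMeasure E y := by
  rw [poissonExtensionAbs_eq_lintegral_poissonMeasure hu.aestronglyMeasurable hy]
  exact (integral_norm_eq_lintegral_enorm
    (hu.comp (measurable_const.sub measurable_id)).aestronglyMeasurable).symm

end BoundedExtension

section PartialEnergyPoissonMaximal

open Filter Topology

variable {ψ σ : ℝ → ℝ}

theorem PartialEnergy.exists_tendsto (hψ : Continuous ψ) {g : ℕ → ℝ → ℝ} {w : ℝ → ℝ}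
    (hg : ∀ x, Tendsto (fun k => g k x) atTop (𝓝 (w x))) {x T : ℝ} (hT : PartialEnergy ψ w x T) :
    ∃ S : ℕ → ℝ, (∀ k, PartialEnergy ψ (g k) x (S k)) ∧ Tendsto S atTop (𝓝 T) := by
  induction hT with
  | start x => exact ⟨fun _ => 0, fun _ => .start x, tendsto_const_nhds⟩
  | @step x x' T _ hx ih =>
    obtain ⟨S, hS, hST⟩ := ih
    refine ⟨fun k => S k + chordEnergy ψ (g k) x x', fun k => (hS k).step hx, hST.add ?_⟩
    exact ((hψ.tendsto _).comp (((hg x').sub (hg x)).div_const _)).mul_const _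

theorem exists_isCumulativeEnergy (h : IsEnergyDensity ψ σ) {w : ℝ → ℝ} {K : ℝ}
    (hK : ∀ x T, PartialEnergy ψ w x T → T ≤ K) : ∃ e, IsCumulativeEnergy ψ w e K := by
  let A : ℝ → Set ℝ := fun x => {T | ∃ x' ≤ x, PartialEnergy ψ w x' T}
  have hK' : ∀ x, K ∈ upperBounds (A x) := fun _ T ⟨x', _, hT⟩ => hK x' T hT
  have h0 : ∀ x, (0 : ℝ) ∈ A x := fun x => ⟨x, le_rfl, .start x⟩
  refine ⟨fun x => sSup (A x), fun x => le_csSup ⟨K, hK' x⟩ (h0 x),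
    fun x => csSup_le ⟨0, h0 x⟩ (hK' x), fun {a b} hab => ?_⟩
  rw [le_sub_comm]
  refine csSup_le ⟨0, h0 a⟩ fun T ⟨x', hx', hT⟩ => ?_
  have hext : T + chordEnergy ψ w x' a + chordEnergy ψ w a b ≤ sSup (A b) :=
    le_csSup ⟨K, hK' b⟩ ⟨b, le_rfl, (hT.step hx').step hab.le⟩
  linarith [chordEnergy_nonneg h w hx']

-- Jensen's inequality, through the subgradient of `ψ` at the slope of the averaged chord.
theorem IsCumulativeEnergy.average (h : IsEnergyDensity ψ σ) (μ : Measure ℝ)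
    [IsProbabilityMeasure μ] {v e : ℝ → ℝ} {B K : ℝ} (hv : Measurable v) (hB : ∀ z, |v z| ≤ B)
    (he : IsCumulativeEnergy ψ v e K) :
    IsCumulativeEnergy ψ (fun x => ∫ z, v (x - z) ∂μ) (fun x => ∫ z, e (x - z) ∂μ) K := by
  have hvint : ∀ x, Integrable (fun z => v (x - z)) μ := fun x =>
    .of_bound (hv.comp (measurable_const.sub measurable_id)).aestronglyMeasurable B
      (.of_forall fun z => hB (x - z))
  have heint : ∀ x, Integrable (fun z => e (x - z)) μ := fun x =>
    .of_bound ((he.monotone h).measurable.comp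
      (measurable_const.sub measurable_id)).aestronglyMeasurable K
      (.of_forall fun z => (Real.norm_of_nonneg (he.nonneg _)).trans_le (he.le _))
  refine ⟨fun x => integral_nonneg fun z => he.nonneg _, fun x => ?_, fun {a b} hab => ?_⟩
  · simpa using integral_mono (heint x) (integrable_const K) fun z => he.le (x - z)
  set s := ((∫ z, v (b - z) ∂μ) - ∫ z, v (a - z) ∂μ) / (b - a)
  have hslope : s * (b - a) = (∫ z, v (b - z) ∂μ) - ∫ z, v (a - z) ∂μ :=
    div_mul_cancel₀ _ (sub_pos.2 hab).ne'
  have hpointwise : ∀ z, ψ s * (b - a) + σ s * (v (b - z) - v (a - z) - s * (b - a)) ≤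
      e (b - z) - e (a - z) := fun z => by
    have hz := subgradient_le_chordEnergy h v (sub_lt_sub_right hab z) s
    rw [sub_sub_sub_cancel_right] at hz
    exact hz.trans (he.chord_le (sub_lt_sub_right hab z))
  have hdiff : Integrable (fun z => v (b - z) - v (a - z)) μ := (hvint b).sub (hvint a)
  have hdev : Integrable (fun z => v (b - z) - v (a - z) - s * (b - a)) μ :=
    hdiff.sub (integrable_const _)
  have hmean : ∫ z, v (b - z) - v (a - z) - s * (b - a) ∂μ = 0 := by
    rw [integral_sub hdiff (integrable_const _), integral_sub (hvint b) (hvint a), hslope,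
      integral_const, probReal_univ, one_smul, sub_self]
  calc ψ s * (b - a) = ∫ z, ψ s * (b - a) + σ s * (v (b - z) - v (a - z) - s * (b - a)) ∂μ := by
        rw [integral_add (integrable_const _) (hdev.const_mul _), integral_const_mul (σ s), hmean,
          integral_const, probReal_univ, one_smul, mul_zero, add_zero]
    _ ≤ ∫ z, e (b - z) - e (a - z) ∂μ :=
        integral_mono ((integrable_const _).add (hdev.const_mul _))
          ((heint b).sub (heint a)) hpointwise
    _ = _ := integral_sub (heint b) (heint a)

theorem isCumulativeEnergy_poissonExtensionAbs (h : IsEnergyDensity ψ σ) {u e : ℝ → ℝ} {B K : ℝ}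
    (hu : Measurable u) (hB : ∀ z, |u z| ≤ B) (he : IsCumulativeEnergy ψ u e K) {y : ℝ}
    (hy : 0 < y) :
    IsCumulativeEnergy ψ (fun x => (poissonExtensionAbs u y x).toReal)
      (fun x => ∫ z, e (x - z) ∂poissonMeasure ℝ y) K := by
  have := isProbabilityMeasure_poissonMeasure (E := ℝ) hy
  simp only [toReal_poissonExtensionAbs_eq_integral_poissonMeasure hu hy]
  exact (he.abs h).average h _ hu.norm fun z => (abs_abs (u z)).trans_le (hB z)

theorem poissonMaximalFrom_le_of_bound {u : ℝ → ℝ} {B : ℝ} (hB : ∀ z, |u z| ≤ B) {ε : ℝ}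
    (hε : 0 < ε) (x : ℝ) : poissonMaximalFrom u ε x ≤ ENNReal.ofReal B :=
  (poissonMaximalFrom_le_poissonMaximal u hε x).trans
    (poissonMaximal_le_of_bound (.of_forall hB) x)

theorem poissonMaximalFrom_ne_top_of_bound {u : ℝ → ℝ} {B : ℝ} (hB : ∀ z, |u z| ≤ B) {ε : ℝ}
    (hε : 0 < ε) (x : ℝ) : poissonMaximalFrom u ε x ≠ ⊤ :=
  ne_top_of_le_ne_top ENNReal.ofReal_ne_top (poissonMaximalFrom_le_of_bound hB hε x)

theorem toReal_poissonMaximalFrom_le {u : ℝ → ℝ} {B : ℝ} (hB : ∀ z, |u z| ≤ B) {ε : ℝ}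
    (hε : 0 < ε) (x : ℝ) : (poissonMaximalFrom u ε x).toReal ≤ B :=
  ENNReal.toReal_le_of_le_ofReal ((abs_nonneg _).trans (hB 0))
    (poissonMaximalFrom_le_of_bound hB hε x)

theorem convexOn_poissonMaximalFrom {u : ℝ → ℝ} {B : ℝ} (hu : AEStronglyMeasurable u volume)
    (hB : ∀ z, |u z| ≤ B) {ε : ℝ} (hε : 0 < ε) {x y : ℝ}
    (hd : ∀ z ∈ Ioo x y, (poissonExtensionAbs u ε z).toReal < (poissonMaximalFrom u ε z).toReal) :
    ConvexOn ℝ (Icc x y) fun z => (poissonMaximalFrom u ε z).toReal := by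
  have hfin := poissonMaximalFrom_ne_top_of_bound hB hε
  refine convexOn_Icc_of_second_difference (continuous_poissonMaximalFrom u hε hfin).continuousOn
    (C := poissonThirdConst ℝ / ε ^ 3 * B) (r₀ := ε / 8) (by positivity) fun z hz r hr hrε => ?_
  have hsecond := poissonMaximalFrom_second_differences (OrthonormalBasis.singleton (Fin 1) ℝ) hu hε
    hfin (hd z hz) hr hrε
  simp only [Finset.univ_unique, Finset.sum_singleton, OrthonormalBasis.coe_singleton,
    Pi.one_apply, smul_eq_mul, mul_one, Fintype.card_unique, Nat.cast_one] at hsecond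
  refine hsecond.trans (add_le_add_right ?_ _)
  have hC := poissonThirdConst_nonneg (E := ℝ)
  rw [mul_right_comm _ B]
  gcongr
  exact toReal_poissonMaximalFrom_le hB hε z

theorem contactData_poissonMaximalFrom (h : IsEnergyDensity ψ σ) {u e : ℝ → ℝ} {B K : ℝ}
    (hu : Measurable u) (hB : ∀ z, |u z| ≤ B) (he : IsCumulativeEnergy ψ u e K) {ε : ℝ}
    (hε : 0 < ε) :
    ContactData ψ (fun x => (poissonExtensionAbs u ε x).toReal)
      (fun x => (poissonMaximalFrom u ε x).toReal)
      (fun x => ∫ z, e (x - z) ∂poissonMeasure ℝ ε) K where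
  le x := ENNReal.toReal_mono (poissonMaximalFrom_ne_top_of_bound hB hε x)
    (poissonExtensionAbs_le_poissonMaximalFrom u le_rfl x)
  continuous_f := continuous_poissonExtensionAbs u hε fun x =>
    ne_top_of_le_ne_top (poissonMaximalFrom_ne_top_of_bound hB hε x)
      (poissonExtensionAbs_le_poissonMaximalFrom u le_rfl x)
  continuous_g := continuous_poissonMaximalFrom u hε (poissonMaximalFrom_ne_top_of_bound hB hε)
  convex _ hd := convexOn_poissonMaximalFrom hu.aestronglyMeasurable hB hε hd
  bdd := ⟨B, forall_mem_range.2 fun x => toReal_poissonMaximalFrom_le hB hε x⟩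
  energy := isCumulativeEnergy_poissonExtensionAbs h hu hB he hε

theorem partialEnergy_poissonMaximal_le (h : IsEnergyDensity ψ σ) {u e : ℝ → ℝ} {B K : ℝ}
    (hu : Measurable u) (hB : ∀ z, |u z| ≤ B) (he : IsCumulativeEnergy ψ u e K) {x T : ℝ}
    (hT : PartialEnergy ψ (fun x => (poissonMaximal u x).toReal) x T) : T ≤ K := by
  have hfin : ∀ x, poissonMaximal u x ≠ ⊤ := fun x =>
    ne_top_of_le_ne_top ENNReal.ofReal_ne_top (poissonMaximal_le_of_bound (.of_forall hB) x)
  obtain ⟨S, hS, hST⟩ := hT.exists_tendsto h.continuous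
    (g := fun k x => (poissonMaximalFrom u (1 / ((k : ℝ) + 1)) x).toReal)
    (fun x => (ENNReal.tendsto_toReal (hfin x)).comp (tendsto_poissonMaximalFrom u x))
  exact le_of_tendsto' hST fun k =>
    (hS k).le_of_contactData h (contactData_poissonMaximalFrom h hu hB he (by positivity))

end PartialEnergyPoissonMaximal

section EnergyDensities

theorem isEnergyDensity_truncated {M : ℝ} (hM : 0 ≤ M) :
    IsEnergyDensity (fun t => max (|t| - M) 0)
      (fun t => if M < t then 1 else if t < -M then -1 else 0) where
  map_zero := by simp [hM]
  even t := by simp only [abs_neg]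
  continuous := by fun_prop
  subgradient s t := by
    have hleft := le_max_left (|s| - M) 0
    have hright := le_max_right (|s| - M) 0
    split_ifs with hpos hneg
    · rw [abs_of_nonneg (by linarith : 0 ≤ t), max_eq_left (by linarith)]
      linarith [le_abs_self s]
    · rw [abs_of_nonpos (by linarith : t ≤ 0), max_eq_left (by linarith)]
      linarith [neg_le_abs s]
    · rw [max_eq_right (sub_nonpos.2 (abs_le.2 ⟨not_lt.1 hneg, not_lt.1 hpos⟩))]
      linarith
  subgradient_zero := by rw [if_neg hM.not_gt, if_neg (by linarith)]

theorem convexOn_abs_rpow {p : ℝ} (hp : 1 ≤ p) : ConvexOn ℝ univ fun t : ℝ => |t| ^ p := by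
  refine ConvexOn.comp (f := fun t : ℝ => |t|) (g := fun t => t ^ p)
    ((convexOn_rpow hp).subset ?_ ?_) convexOn_univ_norm fun x hx y _ hxy => ?_
  · rintro _ ⟨t, -, rfl⟩
    exact abs_nonneg t
  · exact (isPreconnected_univ.image _ continuous_abs.continuousOn).ordConnected.convex
  · obtain ⟨t, -, rfl⟩ := hx
    exact Real.rpow_le_rpow (abs_nonneg t) hxy (zero_le_one.trans hp)

theorem isEnergyDensity_rpow {p : ℝ} (hp : 1 < p) :
    IsEnergyDensity (fun t => |t| ^ p) (fun t => p * |t| ^ (p - 2) * t) where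
  map_zero := by simp [(zero_lt_one.trans hp).ne']
  even t := by simp only [abs_neg]
  continuous := continuous_abs.rpow_const fun _ => .inr (zero_le_one.trans hp.le)
  subgradient s t := by
    have hderiv := hasDerivAt_abs_rpow t hp
    rcases lt_trichotomy s t with h | rfl | h
    · have hslope := (convexOn_abs_rpow hp.le).slope_le_of_hasDerivAt trivial trivial h hderiv
      rw [slope_def_field, div_le_iff₀ (sub_pos.2 h)] at hslope
      linarith
    · simp
    · have hslope := (convexOn_abs_rpow hp.le).le_slope_of_hasDerivAt trivial trivial h hderiv
      rw [slope_def_field, le_div_iff₀ (sub_pos.2 h)] at hslope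
      linarith
  subgradient_zero := mul_zero _

theorem exists_isEnergyDensity_rpow {p : ℝ} (hp : 1 ≤ p) :
    ∃ σ, IsEnergyDensity (fun t => |t| ^ p) σ := by
  rcases hp.eq_or_lt with rfl | hp
  · have heq : (fun t : ℝ => max (|t| - 0) 0) = fun t => |t| ^ (1 : ℝ) := by
      funext t
      simp
    exact ⟨_, heq ▸ isEnergyDensity_truncated le_rfl⟩
  · exact ⟨_, isEnergyDensity_rpow hp⟩

end EnergyDensities

section BoundedVariation

theorem measurable_of_boundedVariationOn {u : ℝ → ℝ} (hu : BoundedVariationOn u univ) :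
    Measurable u := by
  obtain ⟨p, q, hp, hq, rfl⟩ := hu.locallyBoundedVariationOn.exists_monotoneOn_sub_monotoneOn
  exact (monotoneOn_univ.1 hp).measurable.sub (monotoneOn_univ.1 hq).measurable

theorem abs_le_of_boundedVariationOn {u : ℝ → ℝ} (hu : BoundedVariationOn u univ) (z : ℝ) :
    |u z| ≤ |u 0| + (eVariationOn u univ).toReal := by
  have hdist := hu.dist_le (mem_univ z) (mem_univ 0)
  rw [Real.dist_eq] at hdist
  linarith [abs_sub_abs_le_abs_sub (u z) (u 0)]

theorem chordEnergy_abs {w : ℝ → ℝ} {a b : ℝ} (hab : a ≤ b) :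
    chordEnergy (fun t => max (|t| - 0) 0) w a b = |w b - w a| := by
  rcases hab.eq_or_lt with rfl | hab
  · simp
  have hpos : 0 < b - a := sub_pos.2 hab
  simp only [chordEnergy, sub_zero]
  rw [max_eq_left (abs_nonneg _), abs_div, abs_of_pos hpos, div_mul_cancel₀ _ hpos.ne']

theorem isCumulativeEnergy_eVariationOn_Iic {u : ℝ → ℝ} (hu : BoundedVariationOn u univ) :
    IsCumulativeEnergy (fun t => max (|t| - 0) 0) u (fun x => (eVariationOn u (Iic x)).toReal)
      (eVariationOn u univ).toReal := by
  have hfin : ∀ x, eVariationOn u (Iic x) ≠ ⊤ := fun x => hu.mono (subset_univ _)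
  refine ⟨fun _ => ENNReal.toReal_nonneg,
    fun _ => ENNReal.toReal_mono hu (eVariationOn.mono u (subset_univ _)), fun {a b} hab => ?_⟩
  have hunion : eVariationOn u (Iic a) + eVariationOn u (Icc a b) ≤ eVariationOn u (Iic b) := by
    rw [← Iic_union_Icc_eq_Iic hab.le]
    exact eVariationOn.add_le_union u fun x hx y hy => le_trans hx hy.1
  have hedist : eVariationOn u (Iic a) + edist (u b) (u a) ≤ eVariationOn u (Iic b) :=
    (add_le_add_right (eVariationOn.edist_le u (right_mem_Icc.2 hab.le)
      (left_mem_Icc.2 hab.le)) _).trans hunion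
  have hreal := ENNReal.toReal_mono (hfin b) hedist
  rw [ENNReal.toReal_add (hfin a) (edist_ne_top _ _), edist_dist,
    ENNReal.toReal_ofReal dist_nonneg, Real.dist_eq] at hreal
  rw [chordEnergy_abs hab.le]
  linarith

theorem partialEnergy_sum_abs (w : ℝ → ℝ) {s : ℕ → ℝ} (hs : Monotone s) (n : ℕ) :
    PartialEnergy (fun t => max (|t| - 0) 0) w (s n)
      (∑ i ∈ Finset.range n, |w (s (i + 1)) - w (s i)|) := by
  induction n with
  | zero => exact .start _
  | succ n ih =>
    rw [Finset.sum_range_succ, ← chordEnergy_abs (hs n.le_succ)]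
    exact ih.step (hs n.le_succ)

theorem eVariationOn_le_of_partialEnergy {w : ℝ → ℝ} {K : ℝ}
    (h : ∀ x T, PartialEnergy (fun t => max (|t| - 0) 0) w x T → T ≤ K) :
    eVariationOn w univ ≤ ENNReal.ofReal K := by
  refine iSup_le fun ⟨n, s, hs, _⟩ => ?_
  refine Eq.trans_le ?_ (ENNReal.ofReal_le_ofReal (h _ _ (partialEnergy_sum_abs w hs n)))
  simp only [ENNReal.ofReal_sum_of_nonneg fun _ _ => abs_nonneg _, edist_dist, Real.dist_eq]

theorem boundedVariation_poissonMaximal {u : ℝ → ℝ} (hu : BoundedVariationOn u univ) :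
    (∀ x, poissonMaximal u x < ⊤) ∧
      BoundedVariationOn (fun x => (poissonMaximal u x).toReal) univ ∧
      eVariationOn (fun x => (poissonMaximal u x).toReal) univ ≤ eVariationOn u univ := by
  have hB := abs_le_of_boundedVariationOn hu
  have hle : eVariationOn (fun x => (poissonMaximal u x).toReal) univ ≤ eVariationOn u univ :=
    (eVariationOn_le_of_partialEnergy fun _ _ =>
      partialEnergy_poissonMaximal_le (isEnergyDensity_truncated le_rfl)
        (measurable_of_boundedVariationOn hu) hB (isCumulativeEnergy_eVariationOn_Iic hu)).trans_eq
      (ENNReal.ofReal_toReal hu)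
  exact ⟨fun x => (poissonMaximal_le_of_bound (.of_forall hB) x).trans_lt ENNReal.ofReal_lt_top,
    ne_top_of_le_ne_top hu hle, hle⟩

end BoundedVariation

section AbsoluteContinuity

open Filter Topology

theorem sum_increments_le {e : ℝ → ℝ} {K : ℝ} (he : Monotone e) (he0 : ∀ x, 0 ≤ e x)
    (heK : ∀ x, e x ≤ K) {n : ℕ} {a b : ℕ → ℝ} (hab : ∀ i, a i ≤ b i)
    (hd : (Finset.range n : Set ℕ).PairwiseDisjoint fun i => Ioc (a i) (b i)) :
    ∑ i ∈ Finset.range n, (e (b i) - e (a i)) ≤ K := by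
  have hde : (Finset.range n : Set ℕ).PairwiseDisjoint fun i => Ioc (e (a i)) (e (b i)) := by
    intro i hi j hj hij
    refine Set.disjoint_left.2 fun z hz hz' => ?_
    have hlt : max (a i) (a j) < min (b i) (b j) := by
      rw [max_lt_iff, lt_min_iff, lt_min_iff]
      exact ⟨⟨he.reflect_lt (hz.1.trans_le hz.2), he.reflect_lt (hz.1.trans_le hz'.2)⟩,
        he.reflect_lt (hz'.1.trans_le hz.2), he.reflect_lt (hz'.1.trans_le hz'.2)⟩
    exact Set.disjoint_left.1 (hd hi hj hij)
      ⟨(le_max_left _ _).trans_lt hlt, min_le_left _ _⟩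
      ⟨(le_max_right _ _).trans_lt hlt, min_le_right _ _⟩
  refine (ENNReal.ofReal_le_ofReal_iff ((he0 0).trans (heK 0))).1 ?_
  calc ENNReal.ofReal (∑ i ∈ Finset.range n, (e (b i) - e (a i)))
      = volume (⋃ i ∈ Finset.range n, Ioc (e (a i)) (e (b i))) := by
        rw [measure_biUnion_finset hde fun i _ => measurableSet_Ioc,
          ENNReal.ofReal_sum_of_nonneg fun i _ => sub_nonneg.2 (he (hab i))]
        simp only [Real.volume_Ioc]
    _ ≤ volume (Ioc 0 K) := measure_mono (iUnion₂_subset fun i _ =>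
        Ioc_subset_Ioc (he0 _) (heK _))
    _ = ENNReal.ofReal K := by rw [Real.volume_Ioc, sub_zero]

theorem dist_le_mul_dist_add_of_isCumulativeEnergy {w e : ℝ → ℝ} {M K : ℝ}
    (he : IsCumulativeEnergy (fun t => max (|t| - M) 0) w e K) (s t : ℝ) :
    dist (w s) (w t) ≤ M * dist s t + (e (max s t) - e (min s t)) := by
  wlog hst : s ≤ t generalizing s t
  · rw [dist_comm, dist_comm s t, max_comm, min_comm]
    exact this t s (le_of_not_ge hst)
  rw [max_eq_right hst, min_eq_left hst, dist_comm, dist_comm s, Real.dist_eq, Real.dist_eq]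
  rcases hst.eq_or_lt with rfl | hst
  · simp
  have hpos : 0 < t - s := sub_pos.2 hst
  calc |w t - w s|
      = M * |t - s| + (|(w t - w s) / (t - s)| - M) * (t - s) := by
        rw [abs_div, abs_of_pos hpos]
        field_simp
        ring
    _ ≤ M * |t - s| + (e t - e s) := by
        gcongr
        exact (mul_le_mul_of_nonneg_right (le_max_left _ 0) hpos.le).trans (he.chord_le hst)

-- The truncated energies are the de la Vallée Poussin criterion for absolute continuity: below
-- the slope `M` the function is Lipschitz, and the part above `M` has small total variation.
theorem absolutelyContinuous_of_truncated_energy {w : ℝ → ℝ} {K : ℝ → ℝ}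
    (hK : Tendsto K atTop (𝓝 0))
    (hw : ∀ M, 1 ≤ M → ∃ e, IsCumulativeEnergy (fun t => max (|t| - M) 0) w e (K M)) (a b : ℝ) :
    AbsolutelyContinuousOnInterval w a b := by
  rw [absolutelyContinuousOnInterval_iff]
  intro ε hε
  obtain ⟨M, hM, hM1⟩ := ((hK.eventually (gt_mem_nhds (half_pos hε))).and
    (eventually_ge_atTop (1 : ℝ))).exists
  have hM0 : 0 < M := one_pos.trans_le hM1
  obtain ⟨e, he⟩ := hw M hM1
  refine ⟨ε / (2 * M), by positivity, fun P hP hlen => ?_⟩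
  have hsum := sum_increments_le (he.monotone (isEnergyDensity_truncated hM0.le)) he.nonneg he.le
    (n := P.1) (a := fun i => min (P.2 i).1 (P.2 i).2) (b := fun i => max (P.2 i).1 (P.2 i).2)
    (fun i => min_le_max) hP.2
  calc ∑ i ∈ Finset.range P.1, dist (w (P.2 i).1) (w (P.2 i).2)
      ≤ ∑ i ∈ Finset.range P.1, (M * dist (P.2 i).1 (P.2 i).2
          + (e (max (P.2 i).1 (P.2 i).2) - e (min (P.2 i).1 (P.2 i).2))) :=
        Finset.sum_le_sum fun i _ => dist_le_mul_dist_add_of_isCumulativeEnergy he _ _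
    _ ≤ M * (ε / (2 * M)) + K M := by
        rw [Finset.sum_add_distrib, ← Finset.mul_sum]
        gcongr
    _ < ε / 2 + ε / 2 := by
        rw [show M * (ε / (2 * M)) = ε / 2 by field_simp]
        gcongr
    _ = ε := add_halves ε

theorem integral_difference_quotient_le {e : ℝ → ℝ} {K : ℝ} (he : Monotone e)
    (he0 : ∀ x, 0 ≤ e x) (heK : ∀ x, e x ≤ K) (a b : ℝ) {r : ℝ} (hr : 0 < r) :
    ∫ x in a..b, (e (x + r) - e x) / r ≤ K := by
  have hint : ∀ c d, IntervalIntegrable e volume c d := fun c d => he.intervalIntegrable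
  have hshift : IntervalIntegrable (fun x => e (x + r)) volume a b :=
    (he.comp (monotone_id.add_const r)).intervalIntegrable
  have hupper : ∫ x in b..(b + r), e x ≤ K * r := by
    simpa [mul_comm] using intervalIntegral.integral_mono_on (le_add_of_nonneg_right hr.le)
      (hint _ _) (intervalIntegrable_const (c := K)) fun x _ => heK x
  have hlower : 0 ≤ ∫ x in a..(a + r), e x :=
    intervalIntegral.integral_nonneg (le_add_of_nonneg_right hr.le) fun x _ => he0 x
  rw [intervalIntegral.integral_div, div_le_iff₀ hr, intervalIntegral.integral_sub hshift
    (hint _ _), intervalIntegral.integral_comp_add_right,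
    intervalIntegral.integral_interval_sub_interval_comm' (hint _ _) (hint _ _) (hint _ _)]
  linarith

theorem lintegral_density_difference_quotient_le {ψ σ w e : ℝ → ℝ} {K : ℝ}
    (h : IsEnergyDensity ψ σ) (hw : Measurable w) (he : IsCumulativeEnergy ψ w e K) {r : ℝ}
    (hr : 0 < r) : ∫⁻ x, ENNReal.ofReal (ψ ((w (x + r) - w x) / r)) ≤ ENNReal.ofReal K := by
  have hmono := he.monotone h
  have hmeas : Measurable fun x => ENNReal.ofReal (ψ ((w (x + r) - w x) / r)) :=
    (h.continuous.measurable.comp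
      (((hw.comp (measurable_id.add_const r)).sub hw).div_const r)).ennreal_ofReal
  have hcover := aecover_Ioc (μ := volume) tendsto_neg_atTop_atBot (tendsto_id (α := ℝ))
  refine le_of_tendsto (hcover.lintegral_tendsto_of_countably_generated hmeas.aemeasurable) ?_
  filter_upwards [eventually_ge_atTop 0] with R hR
  have hint : IntervalIntegrable (fun x => (e (x + r) - e x) / r) volume (-R) R :=
    ((hmono.comp (monotone_id.add_const r)).intervalIntegrable.sub
      hmono.intervalIntegrable).div_const r
  have hR' : -R ≤ R := by linarith
  calc ∫⁻ x in Ioc (-R) R, ENNReal.ofReal (ψ ((w (x + r) - w x) / r))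
      ≤ ∫⁻ x in Ioc (-R) R, ENNReal.ofReal ((e (x + r) - e x) / r) := by
        refine lintegral_mono fun x => ENNReal.ofReal_le_ofReal ?_
        rw [le_div_iff₀ hr]
        simpa only [chordEnergy, add_sub_cancel_left] using he.chord_le (lt_add_of_pos_right x hr)
    _ = ENNReal.ofReal (∫ x in (-R)..R, (e (x + r) - e x) / r) := by
        rw [intervalIntegral.integral_of_le hR', ofReal_integral_eq_lintegral_ofReal]
        · exact (intervalIntegrable_iff_integrableOn_Ioc_of_le hR').1 hint
        · exact .of_forall fun x =>
            div_nonneg (sub_nonneg.2 (hmono (le_add_of_nonneg_right hr.le))) hr.le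
    _ ≤ ENNReal.ofReal K :=
        ENNReal.ofReal_le_ofReal (integral_difference_quotient_le hmono he.nonneg he.le _ _ hr)

theorem lintegral_density_deriv_le {ψ σ w e : ℝ → ℝ} {K : ℝ} (h : IsEnergyDensity ψ σ)
    (hw : Measurable w) (hdiff : ∀ᵐ x, DifferentiableAt ℝ w x)
    (he : IsCumulativeEnergy ψ w e K) :
    ∫⁻ x, ENNReal.ofReal (ψ (deriv w x)) ≤ ENNReal.ofReal K := by
  let r : ℕ → ℝ := fun k => 1 / ((k : ℝ) + 1)
  have hr : ∀ k, 0 < r k := fun k => by positivity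
  let F : ℕ → ℝ → ℝ≥0∞ := fun k x => ENNReal.ofReal (ψ ((w (x + r k) - w x) / r k))
  have hF : ∀ k, Measurable (F k) := fun k => (h.continuous.measurable.comp
    (((hw.comp (measurable_id.add_const _)).sub hw).div_const _)).ennreal_ofReal
  have hr0 : Tendsto r atTop (𝓝[>] 0) := tendsto_nhdsWithin_iff.2
    ⟨tendsto_one_div_add_atTop_nhds_zero_nat, .of_forall hr⟩
  have hlim : ∀ᵐ x, Tendsto (fun k => F k x) atTop (𝓝 (ENNReal.ofReal (ψ (deriv w x)))) := by
    filter_upwards [hdiff] with x hx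
    have hslope := hx.hasDerivAt.tendsto_slope_zero_right.comp hr0
    refine (((ENNReal.continuous_ofReal.comp h.continuous).tendsto _).comp hslope).congr fun k => ?_
    simp only [F, Function.comp_apply, smul_eq_mul, div_eq_inv_mul]
  calc ∫⁻ x, ENNReal.ofReal (ψ (deriv w x)) = ∫⁻ x, liminf (fun k => F k x) atTop := by
        refine lintegral_congr_ae ?_
        filter_upwards [hlim] with x hx
        exact hx.liminf_eq.symm
    _ ≤ liminf (fun k => ∫⁻ x, F k x) atTop := lintegral_liminf_le hF
    _ ≤ ENNReal.ofReal K := liminf_le_of_frequently_le' (.of_forall fun k =>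
        lintegral_density_difference_quotient_le h hw he (hr k))

end AbsoluteContinuity

section AbsolutelyContinuousWeakGradient

theorem ae_differentiableAt_of_absolutelyContinuousOnInterval {w : ℝ → ℝ}
    (hw : ∀ a b, AbsolutelyContinuousOnInterval w a b) : ∀ᵐ x, DifferentiableAt ℝ w x := by
  filter_upwards [ae_all_iff.2 fun n : ℕ => (hw (-(n : ℝ)) n).ae_differentiableAt] with x hx
  obtain ⟨n, hn⟩ := exists_nat_ge |x|
  exact hx n (Icc_subset_uIcc (abs_le.1 hn))

theorem locallyIntegrable_of_intervalIntegrable {f : ℝ → ℝ}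
    (hf : ∀ a b, IntervalIntegrable f volume a b) : LocallyIntegrable f volume := by
  refine locallyIntegrable_iff.2 fun k hk => ?_
  obtain ⟨S, hS, hkS⟩ := hk.isBounded.subset_ball_lt 0 0
  rw [Real.ball_zero_eq_Ioo] at hkS
  exact ((intervalIntegrable_iff_integrableOn_Ioc_of_le (by linarith)).1 (hf (-S) S)).mono_set
    (hkS.trans Ioo_subset_Ioc_self)

theorem hasWeakGradient_deriv {w : ℝ → ℝ} (hw : ∀ a b, AbsolutelyContinuousOnInterval w a b) :
    HasWeakGradient w (deriv w) where
  locallyIntegrable := locallyIntegrable_of_intervalIntegrable fun a b =>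
    (hw a b).continuousOn.intervalIntegrable
  locallyIntegrable_grad := locallyIntegrable_of_intervalIntegrable fun a b =>
    (hw a b).intervalIntegrable_deriv
  integral_eq φ hφ hφc v := by
    obtain ⟨S, _, hsupp⟩ := hφc.isCompact.isBounded.subset_ball_lt 0 0
    rw [Real.ball_zero_eq_Ioo] at hsupp
    have hφS : ∀ x, x ∉ Ioo (-S) S → φ x = 0 := fun x hx =>
      image_eq_zero_of_notMem_tsupport fun h => hx (hsupp h)
    have hφac : AbsolutelyContinuousOnInterval φ (-S) S :=
      (hφ.of_le (by exact_mod_cast le_top)).contDiffOn.absolutelyContinuousOnInterval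
    have hparts : ∫ x in (-S)..S, w x * deriv φ x = -∫ x in (-S)..S, deriv w x * φ x := by
      rw [(hw (-S) S).integral_mul_deriv_eq_deriv_mul hφac, hφS S (by simp), hφS (-S) (by simp)]
      ring
    have htsupport : tsupport φ ⊆ Ioc (-S) S := hsupp.trans Ioo_subset_Ioc_self
    rw [intervalIntegral.integral_eq_integral_of_support_subset
        ((Function.support_mul_subset_right _ _).trans
          (support_deriv_subset.trans htsupport)),
      intervalIntegral.integral_eq_integral_of_support_subset
        ((Function.support_mul_subset_right _ _).trans
          ((subset_tsupport φ).trans htsupport))] at hparts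
    calc ∫ x, w x * fderiv ℝ φ x v = v * ∫ x, w x * deriv φ x := by
          rw [← integral_const_mul]
          refine integral_congr_ae (.of_forall fun x => ?_)
          simp only [fderiv_eq_smul_deriv, smul_eq_mul]
          ring
      _ = -∫ x, inner ℝ (deriv w x) v * φ x := by
          rw [hparts, mul_neg, ← integral_const_mul]
          congr 2 with x
          simp only [RCLike.inner_apply, conj_trivial]
          ring

end AbsolutelyContinuousWeakGradient

section SobolevLine

open Filter Topology

variable {v G : ℝ → ℝ}

theorem chordEnergy_le_integral {ψ σ : ℝ → ℝ} (h : IsEnergyDensity ψ σ)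
    (hGi : ∀ a b, IntervalIntegrable G volume a b) (hv : ∀ a b, v b - v a = ∫ x in a..b, G x)
    (hψ : Integrable fun x => ψ (G x)) {a b : ℝ} (hab : a < b) :
    chordEnergy ψ v a b ≤ ∫ x in a..b, ψ (G x) := by
  let t := (v b - v a) / (b - a)
  have hmean : ∫ x in a..b, (G x - t) = 0 := by
    rw [intervalIntegral.integral_sub (hGi a b) intervalIntegrable_const, ← hv a b,
      intervalIntegral.integral_const, smul_eq_mul, mul_div_cancel₀ _ (sub_pos.2 hab).ne', sub_self]
  have hint : IntervalIntegrable (fun x => σ t * (G x - t)) volume a b :=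
    ((hGi a b).sub intervalIntegrable_const).const_mul _
  calc chordEnergy ψ v a b = ∫ x in a..b, (ψ t + σ t * (G x - t)) := by
        rw [intervalIntegral.integral_add intervalIntegrable_const hint,
          intervalIntegral.integral_const_mul, hmean, mul_zero, add_zero,
          intervalIntegral.integral_const, smul_eq_mul, mul_comm, chordEnergy]
    _ ≤ ∫ x in a..b, ψ (G x) := intervalIntegral.integral_mono_on hab.le
        (intervalIntegrable_const.add hint) hψ.intervalIntegrable fun x _ => h.subgradient (G x) t

theorem isCumulativeEnergy_integral_Iic {ψ σ : ℝ → ℝ} (h : IsEnergyDensity ψ σ)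
    (hGi : ∀ a b, IntervalIntegrable G volume a b) (hv : ∀ a b, v b - v a = ∫ x in a..b, G x)
    (hψ : Integrable fun x => ψ (G x)) :
    IsCumulativeEnergy ψ v (fun x => ∫ z in Iic x, ψ (G z)) (∫ z, ψ (G z)) where
  nonneg _ := integral_nonneg fun _ => h.nonneg _
  le _ := setIntegral_le_integral hψ (.of_forall fun _ => h.nonneg _)
  chord_le hab := by
    rw [intervalIntegral.integral_Iic_sub_Iic hψ.integrableOn hψ.integrableOn]
    exact chordEnergy_le_integral h hGi hv hψ hab

theorem continuous_of_sub_eq_integral (hGi : ∀ a b, IntervalIntegrable G volume a b)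
    (hv : ∀ a b, v b - v a = ∫ x in a..b, G x) : Continuous v := by
  have heq : v = fun x => v 0 + ∫ t in 0..x, G t := by
    funext x
    rw [← hv, add_sub_cancel]
  rw [heq]
  exact continuous_const.add (intervalIntegral.continuous_primitive hGi 0)

theorem exists_isCumulativeEnergy_poissonMaximal {ψ σ : ℝ → ℝ} (h : IsEnergyDensity ψ σ)
    {B : ℝ} (hB : ∀ z, |v z| ≤ B) (hGi : ∀ a b, IntervalIntegrable G volume a b)
    (hv : ∀ a b, v b - v a = ∫ x in a..b, G x) (hψ : Integrable fun x => ψ (G x)) :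
    ∃ e, IsCumulativeEnergy ψ (fun x => (poissonMaximal v x).toReal) e (∫ z, ψ (G z)) :=
  exists_isCumulativeEnergy h fun _ _ => partialEnergy_poissonMaximal_le h
    (continuous_of_sub_eq_integral hGi hv).measurable hB
    (isCumulativeEnergy_integral_Iic h hGi hv hψ)

theorem max_abs_sub_le_abs_rpow {M q : ℝ} (hM : 1 ≤ M) (hq : 1 ≤ q) (t : ℝ) :
    max (|t| - M) 0 ≤ |t| ^ q := by
  refine max_le ?_ (by positivity)
  rcases le_total 1 |t| with ht | ht
  · linarith [Real.self_le_rpow_of_one_le ht hq]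
  · linarith [Real.rpow_nonneg (abs_nonneg t) q]

theorem norm_max_abs_sub_le_abs_rpow {M q : ℝ} (hM : 1 ≤ M) (hq : 1 ≤ q) (t : ℝ) :
    ‖max (|t| - M) 0‖ ≤ |t| ^ q := by
  rw [Real.norm_of_nonneg (le_max_right _ _)]
  exact max_abs_sub_le_abs_rpow hM hq t

variable {α : Type*} [MeasurableSpace α] {μ : Measure α} {f : α → ℝ} {q : ℝ}

theorem aestronglyMeasurable_max_abs_sub (hf : AEStronglyMeasurable f μ) (M : ℝ) :
    AEStronglyMeasurable (fun x => max (|f x| - M) 0) μ :=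
  (by fun_prop : Continuous fun t : ℝ => max (|t| - M) 0).comp_aestronglyMeasurable hf

theorem integrable_max_abs_sub (hf : AEStronglyMeasurable f μ) (hq : 1 ≤ q)
    (hfq : Integrable (fun x => |f x| ^ q) μ) {M : ℝ} (hM : 1 ≤ M) :
    Integrable (fun x => max (|f x| - M) 0) μ :=
  hfq.mono' (aestronglyMeasurable_max_abs_sub hf M)
    (.of_forall fun x => norm_max_abs_sub_le_abs_rpow hM hq (f x))

theorem tendsto_integral_max_abs_sub (hf : AEStronglyMeasurable f μ) (hq : 1 ≤ q)
    (hfq : Integrable (fun x => |f x| ^ q) μ) :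
    Tendsto (fun M => ∫ x, max (|f x| - M) 0 ∂μ) atTop (𝓝 0) := by
  have hlim := tendsto_integral_filter_of_dominated_convergence (l := atTop)
    (F := fun M x => max (|f x| - M) 0) (f := fun _ => 0) _
    (.of_forall (aestronglyMeasurable_max_abs_sub hf))
    ((eventually_ge_atTop 1).mono fun M hM => .of_forall fun x =>
      norm_max_abs_sub_le_abs_rpow hM hq (f x)) hfq
    (.of_forall fun x => tendsto_const_nhds.congr' <| (eventually_ge_atTop |f x|).mono
      fun M hM => (max_eq_right (sub_nonpos.2 hM)).symm)
  rwa [integral_zero] at hlim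

theorem eLpNorm_le_of_lintegral_le {p : ℝ≥0∞} (hp : p ≠ 0) (hp' : p ≠ ⊤) {f g : α → ℝ}
    (hg : Integrable (fun x => |g x| ^ p.toReal) μ)
    (hfg : ∫⁻ x, ENNReal.ofReal (|f x| ^ p.toReal) ∂μ ≤
      ENNReal.ofReal (∫ x, |g x| ^ p.toReal ∂μ)) :
    eLpNorm f p μ ≤ eLpNorm g p μ := by
  have henorm : ∀ t : ℝ, ENNReal.ofReal (|t| ^ p.toReal) = ‖t‖ₑ ^ p.toReal := fun t => by
    rw [← ENNReal.ofReal_rpow_of_nonneg (abs_nonneg _) ENNReal.toReal_nonneg,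
      Real.enorm_eq_ofReal_abs]
  rw [ofReal_integral_eq_lintegral_ofReal hg (.of_forall fun x => by positivity)] at hfg
  simp_rw [henorm] at hfg
  rw [eLpNorm_eq_lintegral_rpow_enorm_toReal hp hp', eLpNorm_eq_lintegral_rpow_enorm_toReal hp hp']
  exact ENNReal.rpow_le_rpow hfg (by positivity)

theorem hasWeakGradient_poissonMaximal_of_sub_eq_integral {p : ℝ≥0∞} (hp : 1 ≤ p) (hp' : p ≠ ⊤)
    {B : ℝ} (hB : ∀ z, |v z| ≤ B) (hv : ∀ a b, v b - v a = ∫ x in a..b, G x)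
    (hG : MemLp G p volume) :
    HasWeakGradient (fun x => (poissonMaximal v x).toReal)
        (deriv fun x => (poissonMaximal v x).toReal) ∧
      eLpNorm (deriv fun x => (poissonMaximal v x).toReal) p volume ≤ eLpNorm G p volume := by
  have hp0 : p ≠ 0 := (zero_lt_one.trans_le hp).ne'
  have hq : 1 ≤ p.toReal := by simpa using ENNReal.toReal_mono hp' hp
  have hGi : ∀ a b, IntervalIntegrable G volume a b := fun a b =>
    ((hG.locallyIntegrable hp).integrableOn_isCompact isCompact_uIcc).intervalIntegrable
  have hGp : Integrable fun x => |G x| ^ p.toReal := hG.integrable_norm_rpow hp0 hp'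
  have hac : ∀ a b, AbsolutelyContinuousOnInterval (fun x => (poissonMaximal v x).toReal) a b :=
    absolutelyContinuous_of_truncated_energy (tendsto_integral_max_abs_sub hG.1 hq hGp)
      fun M hM => exists_isCumulativeEnergy_poissonMaximal
        (isEnergyDensity_truncated (by linarith)) hB hGi hv (integrable_max_abs_sub hG.1 hq hGp hM)
  obtain ⟨σ, hσ⟩ := exists_isEnergyDensity_rpow hq
  obtain ⟨e, he⟩ := exists_isCumulativeEnergy_poissonMaximal hσ hB hGi hv hGp
  exact ⟨hasWeakGradient_deriv hac, eLpNorm_le_of_lintegral_le hp0 hp' hGp <|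
    lintegral_density_deriv_le hσ (lowerSemicontinuous_poissonMaximal v).measurable.ennreal_toReal
      (ae_differentiableAt_of_absolutelyContinuousOnInterval hac) he⟩

end SobolevLine

section TranslationAndGradient

theorem hasCompactSupport_comp_sub_right {E : Type*} [NormedAddCommGroup E] {φ : E → ℝ}
    (hφc : HasCompactSupport φ) (h : E) :
    HasCompactSupport fun x => φ (x - h) :=
  hφc.comp_homeomorph (Homeomorph.subRight h)

theorem comp_sub_sub_eq_neg_integral_fderiv {E : Type*} [NormedAddCommGroup E] [NormedSpace ℝ E]
    {φ : E → ℝ} (hφ : ContDiff ℝ 1 φ) (h x : E) :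
    φ (x - h) - φ x = -∫ s in (0 : ℝ)..1, fderiv ℝ φ (x - s • h) h := by
  have hderiv : ∀ s : ℝ, HasDerivAt (fun s : ℝ => φ (x - s • h))
      (-(fderiv ℝ φ (x - s • h) h)) s := fun s => by
    have hline : HasDerivAt (fun s : ℝ => x - s • h) (-h) s := by
      simpa using ((hasDerivAt_id s).smul_const h).const_sub x
    simpa [Function.comp_def] using
      (hφ.differentiable one_ne_zero (x - s • h)).hasFDerivAt.comp_hasDerivAt s hline
  have hcont : Continuous fun s : ℝ => -(fderiv ℝ φ (x - s • h) h) :=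
    (((hφ.continuous_fderiv one_ne_zero).comp (by fun_prop)).clm_apply continuous_const).neg
  have hftc := intervalIntegral.integral_eq_sub_of_hasDerivAt (fun s _ => hderiv s)
    (hcont.intervalIntegrable 0 1)
  rw [intervalIntegral.integral_neg, one_smul, zero_smul, sub_zero] at hftc
  exact hftc.symm

theorem norm_gradient_le_of_lipschitzWith {E : Type*} [NormedAddCommGroup E]
    [InnerProductSpace ℝ E] [CompleteSpace E] {u : E → ℝ} {C : NNReal} (hu : LipschitzWith C u)
    {x : E} : ‖gradient u x‖ ≤ C := by
  rw [gradient, LinearIsometryEquiv.norm_map]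
  exact norm_fderiv_le_of_lipschitz ℝ hu

end TranslationAndGradient

section LineAverage

variable {E : Type*} [NormedAddCommGroup E] [InnerProductSpace ℝ E] [FiniteDimensional ℝ E]
  [MeasurableSpace E] [BorelSpace E] {F φ : E → ℝ}

theorem integrable_mul_of_hasCompactSupport (hF : LocallyIntegrable F volume)
    (hφ : Continuous φ) (hφc : HasCompactSupport φ) : Integrable fun x => F x * φ x :=
  hF.integrable_smul_right_of_hasCompactSupport hφ hφc

theorem locallyIntegrable_comp_add_right (hF : LocallyIntegrable F volume) (h : E) :
    LocallyIntegrable (fun x => F (x + h)) volume :=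
  (locallyIntegrable_map_homeomorph (Homeomorph.addRight h)).1 <| by
    rwa [Homeomorph.coe_addRight, map_add_right_eq_self]

theorem integrable_mul_comp_sub_smul (hF : LocallyIntegrable F volume)
    (hφ : Continuous φ) (hφc : HasCompactSupport φ) (h : E) :
    Integrable (fun p : ℝ × E => F p.2 * φ (p.2 - p.1 • h))
      ((volume.restrict (Ioc (0 : ℝ) 1)).prod volume) := by
  obtain ⟨C, hC⟩ := hφc.exists_bound_of_continuous hφ
  obtain ⟨R, hR⟩ := hφc.isCompact.isBounded.subset_closedBall 0
  let K := Metric.closedBall (0 : E) (R + ‖h‖)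
  have hFK : Integrable (K.indicator fun x => ‖F x‖ * C) volume :=
    (integrable_indicator_iff measurableSet_closedBall).2
      ((hF.integrableOn_isCompact (isCompact_closedBall 0 _)).norm.mul_const C)
  refine Integrable.mono' (g := fun p : ℝ × E => K.indicator (fun x => ‖F x‖ * C) p.2)
    (hFK.comp_snd (volume.restrict (Ioc (0 : ℝ) 1)))
    (hF.aestronglyMeasurable.comp_snd.mul (hφ.comp (by fun_prop)).aestronglyMeasurable) ?_
  filter_upwards [Measure.quasiMeasurePreserving_fst.ae (ae_restrict_mem measurableSet_Ioc)]
    with p hp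
  by_cases hx : p.2 ∈ K
  · rw [indicator_of_mem hx, norm_mul]
    exact mul_le_mul_of_nonneg_left (hC _) (norm_nonneg _)
  · rw [indicator_of_notMem hx, image_eq_zero_of_notMem_tsupport (f := φ), mul_zero, norm_zero]
    refine fun hmem => hx (mem_closedBall_zero_iff.2 ?_)
    have hsub : ‖p.2 - p.1 • h‖ ≤ R := mem_closedBall_zero_iff.1 (hR hmem)
    have hsmul : ‖p.1 • h‖ ≤ ‖h‖ := by
      rw [norm_smul, Real.norm_of_nonneg hp.1.le]
      exact mul_le_of_le_one_left (norm_nonneg _) hp.2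
    linarith [norm_le_norm_sub_add p.2 (p.1 • h)]

theorem measurePreserving_shear (h : E) :
    MeasurePreserving (fun p : ℝ × E => (p.1, p.2 + p.1 • h))
      ((volume.restrict (Ioc (0 : ℝ) 1)).prod volume)
      ((volume.restrict (Ioc (0 : ℝ) 1)).prod volume) :=
  (MeasurePreserving.id _).skew_product (g := fun s x => x + s • h) (by fun_prop)
    (.of_forall fun s => (measurePreserving_add_right volume (s • h)).map_eq)

theorem integrable_comp_add_smul_mul (hF : LocallyIntegrable F volume)
    (hφ : Continuous φ) (hφc : HasCompactSupport φ) (h : E) :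
    Integrable (fun p : ℝ × E => F (p.2 + p.1 • h) * φ p.2)
      ((volume.restrict (Ioc (0 : ℝ) 1)).prod volume) := by
  simpa [Function.comp_def] using (measurePreserving_shear h).integrable_comp_of_integrable
    (integrable_mul_comp_sub_smul hF hφ hφc h)

theorem locallyIntegrable_line_average (hF : LocallyIntegrable F volume) (h : E) :
    LocallyIntegrable (fun x => ∫ s in (0 : ℝ)..1, F (x + s • h)) volume := by
  intro x
  let η : ContDiffBump x := ⟨1, 2, one_pos, one_lt_two⟩
  have hη :=
    (integrable_comp_add_smul_mul hF η.continuous η.hasCompactSupport h).integral_prod_right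
  refine ⟨Metric.closedBall x 1, Metric.closedBall_mem_nhds x one_pos,
    hη.integrableOn.congr_fun (fun z hz => ?_) measurableSet_closedBall⟩
  simp only [intervalIntegral.integral_of_le zero_le_one, η.one_of_mem_closedBall hz, mul_one]

end LineAverage

section WeakGradient

variable {E : Type*} [NormedAddCommGroup E] [InnerProductSpace ℝ E] [FiniteDimensional ℝ E]
  [MeasurableSpace E] [BorelSpace E] {u φ : E → ℝ} {G : E → E}

theorem HasWeakGradient.locallyIntegrable_inner (hu : HasWeakGradient u G) (v : E) :
    LocallyIntegrable (fun x => inner ℝ (G x) v) volume := fun x =>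
  (hu.locallyIntegrable_grad x).imp fun _ hs => ⟨hs.1, hs.2.inner_const v⟩

theorem HasWeakGradient.integral_mul_fderiv_comp_sub (hu : HasWeakGradient u G)
    (hφ : ContDiff ℝ ∞ φ) (hφc : HasCompactSupport φ) (a h : E) :
    ∫ x, u x * fderiv ℝ φ (x - a) h = -∫ x, inner ℝ (G (x + a)) h * φ x := by
  have hweak := hu.integral_eq (fun x => φ (x - a)) (hφ.comp (contDiff_id.sub contDiff_const))
    (hasCompactSupport_comp_sub_right hφc a) h
  simp only [fderiv_comp_sub] at hweak
  rw [hweak, ← integral_add_right_eq_self (fun x => inner ℝ (G x) h * φ (x - a)) a]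
  simp only [add_sub_cancel_right]

theorem HasWeakGradient.integral_mul_comp_sub_sub (hu : HasWeakGradient u G)
    (hφ : ContDiff ℝ ∞ φ) (hφc : HasCompactSupport φ) (h : E) :
    ∫ x, u x * (φ (x - h) - φ x) =
      ∫ x, (∫ s in (0 : ℝ)..1, inner ℝ (G (x + s • h)) h) * φ x := by
  have hD : Continuous fun x => fderiv ℝ φ x h :=
    (hφ.continuous_fderiv (by simp)).clm_apply continuous_const
  have hswap := integral_integral_swap (f := fun s x => u x * fderiv ℝ φ (x - s • h) h)
    (integrable_mul_comp_sub_smul hu.locallyIntegrable hD (hφc.fderiv_apply ℝ h) h)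
  have hswapG := integral_integral_swap (f := fun s x => inner ℝ (G (x + s • h)) h * φ x)
    (integrable_comp_add_smul_mul (hu.locallyIntegrable_inner h) hφ.continuous hφc h)
  simp only [integral_const_mul] at hswap
  simp only [integral_mul_const] at hswapG
  simp only [comp_sub_sub_eq_neg_integral_fderiv (hφ.of_le (by exact_mod_cast le_top)),
    intervalIntegral.integral_of_le zero_le_one, mul_neg, integral_neg]
  rw [← hswap, ← hswapG, ← integral_neg]
  simp only [hu.integral_mul_fderiv_comp_sub hφ hφc, neg_neg]

theorem integral_translate_sub_mul (hu : LocallyIntegrable u volume) (hφ : Continuous φ)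
    (hφc : HasCompactSupport φ) (h : E) :
    ∫ x, (u (x + h) - u x) * φ x = ∫ x, u x * (φ (x - h) - φ x) := by
  have htranslate : ∫ x, u (x + h) * φ x = ∫ x, u x * φ (x - h) := by
    rw [← integral_add_right_eq_self (fun x => u x * φ (x - h)) h]
    simp only [add_sub_cancel_right]
  have hint := integrable_mul_of_hasCompactSupport hu hφ hφc
  have hintt : Integrable fun x => u x * φ (x - h) := integrable_mul_of_hasCompactSupport hu
    (hφ.comp (continuous_sub_right h)) (hasCompactSupport_comp_sub_right hφc h)
  simp only [mul_sub, sub_mul]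
  rw [integral_sub (integrable_mul_of_hasCompactSupport (locallyIntegrable_comp_add_right hu h)
      hφ hφc) hint, integral_sub hintt hint, htranslate]

theorem HasWeakGradient.sub_eq_integral (hu : HasWeakGradient u G) (h : E) :
    ∀ᵐ x, u (x + h) - u x = ∫ s in (0 : ℝ)..1, inner ℝ (G (x + s • h)) h := by
  refine ae_eq_of_integral_contDiff_smul_eq
    ((locallyIntegrable_comp_add_right hu.locallyIntegrable h).sub hu.locallyIntegrable)
    (locallyIntegrable_line_average (hu.locallyIntegrable_inner h) h) fun φ hφ hφc => ?_
  simp only [smul_eq_mul, mul_comm (φ _)]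
  exact (integral_translate_sub_mul hu.locallyIntegrable hφ.continuous hφc h).trans
    (hu.integral_mul_comp_sub_sub hφ hφc h)

theorem HasWeakGradient.ae_eq {G' : E → E} (hG : HasWeakGradient u G)
    (hG' : HasWeakGradient u G') : G =ᵐ[volume] G' := by
  have hcoord : ∀ i, ∀ᵐ x, inner ℝ (G x) (stdOrthonormalBasis ℝ E i) =
      inner ℝ (G' x) (stdOrthonormalBasis ℝ E i) := fun i => by
    refine ae_eq_of_integral_contDiff_smul_eq (hG.locallyIntegrable_inner _)
      (hG'.locallyIntegrable_inner _) fun φ hφ hφc => ?_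
    simp only [smul_eq_mul, mul_comm (φ _)]
    rw [← neg_inj, ← hG.integral_eq φ hφ hφc, hG'.integral_eq φ hφ hφc]
  filter_upwards [ae_all_iff.2 hcoord] with x hx
  exact InnerProductSpace.ext_inner_right_basis (stdOrthonormalBasis ℝ E).toBasis fun i => by
    simpa using hx i

theorem memLp_top_gradient_of_lipschitzWith {C : NNReal} (hu : LipschitzWith C u) :
    MemLp (gradient u) ⊤ volume :=
  memLp_top_of_bound ((InnerProductSpace.toDual ℝ E).symm.continuous.measurable.comp
    (measurable_fderiv ℝ u)).aestronglyMeasurable C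
    (.of_forall fun _ => norm_gradient_le_of_lipschitzWith hu)

theorem hasWeakGradient_of_lipschitzWith {C : NNReal} (hu : LipschitzWith C u) :
    HasWeakGradient u (gradient u) where
  locallyIntegrable := hu.continuous.locallyIntegrable
  locallyIntegrable_grad := (memLp_top_gradient_of_lipschitzWith hu).locallyIntegrable le_top
  integral_eq φ hφ hφc v := by
    obtain ⟨D, hD⟩ := hφ.lipschitzWith_of_hasCompactSupport hφc (by simp)
    calc ∫ x, u x * fderiv ℝ φ x v = -∫ x, lineDeriv ℝ φ x (-v) * u x := by
          rw [← integral_neg]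
          congr 1 with x
          rw [(hφ.differentiable (by simp) x).lineDeriv_eq_fderiv, map_neg]
          ring
      _ = -∫ x, lineDeriv ℝ u x v * φ x := by
          rw [hu.integral_lineDeriv_mul_eq (μ := volume) hD hφc v]
      _ = -∫ x, inner ℝ (gradient u x) v * φ x := by
          congr 1
          refine integral_congr_ae ?_
          filter_upwards [hu.ae_differentiableAt (μ := volume)] with x hx
          rw [hx.lineDeriv_eq_fderiv, gradient, InnerProductSpace.toDual_symm_apply]

end WeakGradient

section WeakCompactness

open Filter Topology

theorem exists_weak_limit {ι H : Type*} [NormedAddCommGroup H] [InnerProductSpace ℝ H]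
    [CompleteSpace H] {l : Filter ι} [l.NeBot] {g : ι → H} {K : ℝ} (hg : ∀ᶠ i in l, ‖g i‖ ≤ K) :
    ∃ z : H, ‖z‖ ≤ K ∧ ∃ U : Ultrafilter ι, ↑U ≤ l ∧
      ∀ ψ, Tendsto (fun i => inner ℝ (g i) ψ) U (𝓝 (inner ℝ z ψ)) := by
  let T : ι → WeakDual ℝ H := fun i => StrongDual.toWeakDual (InnerProductSpace.toDual ℝ H (g i))
  obtain ⟨y, hy, hle⟩ := (WeakDual.isCompact_closedBall (𝕜 := ℝ) (0 : StrongDual ℝ H)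
    K).ultrafilter_le_nhds ((Ultrafilter.of l).map T) (by
      rw [le_principal_iff]
      refine Filter.mem_map.2 ((hg.filter_mono (Ultrafilter.of_le l)).mono fun i hi => ?_)
      simpa [T] using hi)
  refine ⟨(InnerProductSpace.toDual ℝ H).symm (WeakDual.toStrongDual y), ?_, Ultrafilter.of l,
    Ultrafilter.of_le l, fun ψ => ?_⟩
  · rw [LinearIsometryEquiv.norm_map]
    simpa using hy
  · rw [InnerProductSpace.toDual_symm_apply]
    exact tendsto_iff_forall_eval_tendsto_topDualPairing.1 (show Tendsto T _ (𝓝 y) from hle) ψ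

theorem eLpNorm_two_sq {α F : Type*} [MeasurableSpace α] [NormedAddCommGroup F] (f : α → F)
    (μ : Measure α) : eLpNorm f 2 μ ^ 2 = ∫⁻ x, ‖f x‖ₑ ^ 2 ∂μ := by
  simpa using eLpNorm_nnreal_pow_eq_lintegral (f := f) (μ := μ) (p := 2) two_ne_zero

end WeakCompactness

section DiscreteGradient

open Filter Topology

variable {E ι : Type*} [NormedAddCommGroup E] [InnerProductSpace ℝ E] [Fintype ι]
  (b : OrthonormalBasis ι ℝ E) (w : E → ℝ)

/-- The discrete gradient of `w` with step `r`: its `i`-th coordinate in the orthonormal basis `b`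
is the difference quotient of `w` in the direction `b i`. -/
noncomputable def discreteGradient (r : ℝ) (x : E) : E :=
  ∑ i, (r⁻¹ * (w (x + r • b i) - w x)) • b i

theorem inner_discreteGradient (r : ℝ) (x v : E) :
    inner ℝ (discreteGradient b w r x) v =
      ∑ i, inner ℝ (b i) v * (r⁻¹ * (w (x + r • b i) - w x)) := by
  simp only [discreteGradient, sum_inner, real_inner_smul_left, mul_comm]

theorem enorm_discreteGradient_sq {r : ℝ} (hr : 0 < r) (x : E) :
    ‖discreteGradient b w r x‖ₑ ^ 2 =
      (ENNReal.ofReal r ^ 2)⁻¹ * ∑ i, ‖w (x + r • b i) - w x‖ₑ ^ 2 := by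
  have hnorm : ‖discreteGradient b w r x‖ ^ 2 =
      ∑ i, ‖r⁻¹ * (w (x + r • b i) - w x)‖ ^ 2 := by
    rw [← b.sum_sq_norm_inner_right]
    simp only [discreteGradient, b.orthonormal.inner_right_fintype]
  rw [← ofReal_norm, ← ENNReal.ofReal_pow (norm_nonneg _), hnorm,
    ENNReal.ofReal_sum_of_nonneg fun i _ => by positivity, Finset.mul_sum]
  refine Finset.sum_congr rfl fun i _ => ?_
  rw [ENNReal.ofReal_pow (norm_nonneg _), ofReal_norm, enorm_mul, mul_pow, ENNReal.inv_pow,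
    ← ofReal_norm r⁻¹, norm_inv, Real.norm_of_nonneg hr.le, ENNReal.ofReal_inv_of_pos hr]

variable [FiniteDimensional ℝ E] [MeasurableSpace E] [BorelSpace E] {w}

theorem memLp_comp_add_right {p : ℝ≥0∞} (hw : MemLp w p volume) (a : E) :
    MemLp (fun x => w (x + a)) p volume :=
  hw.comp_measurePreserving (measurePreserving_add_right volume a)

variable (w) in
/-- The discrete Dirichlet energy of `w` with step `r`: the sum of the squared `L²` norms of its
differences in the directions of the orthonormal basis `b`, not divided by `r ^ 2`. -/
noncomputable def differenceEnergy (r : ℝ) : ℝ≥0∞ :=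
  ∑ i, ∫⁻ x, ‖w (x + r • b i) - w x‖ₑ ^ 2

theorem aestronglyMeasurable_difference (hw : AEStronglyMeasurable w volume) (a : E) :
    AEStronglyMeasurable (fun x => w (x + a) - w x) volume :=
  (hw.comp_quasiMeasurePreserving (quasiMeasurePreserving_add_right volume a)).sub hw

theorem differenceEnergy_eq_lintegral_sum (hw : AEStronglyMeasurable w volume) (r : ℝ) :
    differenceEnergy b w r = ∫⁻ x, ∑ i, ‖w (x + r • b i) - w x‖ₑ ^ 2 :=
  (lintegral_finsetSum' _ fun _ _ =>
    (aestronglyMeasurable_difference hw _).enorm.pow_const 2).symm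

theorem memLp_discreteGradient {p : ℝ≥0∞} (hw : MemLp w p volume) (r : ℝ) :
    MemLp (discreteGradient b w r) p volume :=
  memLp_finsetSum _ fun i _ =>
    have hq := ((memLp_comp_add_right hw (r • b i)).sub hw).const_mul r⁻¹
    hq.of_le_mul (c := 1) (hq.1.smul_const _) (.of_forall fun x => by simp [norm_smul])

theorem eLpNorm_two_discreteGradient_le (hw : AEStronglyMeasurable w volume) {K : ℝ≥0∞} {r : ℝ}
    (hr : 0 < r) (h : differenceEnergy b w r ≤ ENNReal.ofReal r ^ 2 * K ^ 2) :
    eLpNorm (discreteGradient b w r) 2 volume ≤ K := by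
  have hr0 : ENNReal.ofReal r ^ 2 ≠ 0 := pow_ne_zero 2 (by simpa using hr)
  refine (ENNReal.pow_le_pow_left_iff two_ne_zero).1 ?_
  calc eLpNorm (discreteGradient b w r) 2 volume ^ 2
      = (ENNReal.ofReal r ^ 2)⁻¹ * differenceEnergy b w r := by
        simp only [eLpNorm_two_sq, enorm_discreteGradient_sq b w hr]
        rw [lintegral_const_mul' _ _ (ENNReal.inv_ne_top.2 hr0),
          differenceEnergy_eq_lintegral_sum b hw]
    _ ≤ (ENNReal.ofReal r ^ 2)⁻¹ * (ENNReal.ofReal r ^ 2 * K ^ 2) := mul_le_mul_right h _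
    _ = K ^ 2 := by
        rw [← mul_assoc, ENNReal.inv_mul_cancel hr0 (ENNReal.pow_ne_top ENNReal.ofReal_ne_top),
          one_mul]

variable {φ : E → ℝ}

-- Summation by parts moves the difference quotient to the test function, where Rademacher's
-- theorem applies after localizing `w` to a compact neighbourhood of the support of `φ`.
theorem tendsto_integral_difference_quotient (hw : LocallyIntegrable w volume)
    (hφ : ContDiff ℝ ∞ φ) (hφc : HasCompactSupport φ) (v : E) :
    Tendsto (fun r : ℝ => ∫ x, r⁻¹ * (w (x + r • v) - w x) * φ x) (𝓝[>] 0)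
      (𝓝 (-∫ x, w x * fderiv ℝ φ x v)) := by
  obtain ⟨D, hD⟩ := hφ.lipschitzWith_of_hasCompactSupport hφc (by simp)
  let K := Metric.cthickening ‖v‖ (tsupport φ)
  have hK : IsCompact K := hφc.isCompact.cthickening
  have hφK : ∀ x ∉ K, φ x = 0 := fun x hx => image_eq_zero_of_notMem_tsupport fun h =>
    hx (Metric.self_subset_cthickening _ h)
  have hloc : ∀ {f : E → ℝ}, (∀ x ∉ K, f x = 0) →
      ∫ x, f x * K.indicator w x = ∫ x, w x * f x := fun {f} hf => by
    congr 1 with x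
    by_cases hx : x ∈ K
    · rw [indicator_of_mem hx, mul_comm]
    · rw [hf x hx, zero_mul, mul_zero]
  have hlim := LipschitzWith.integral_inv_smul_sub_mul_tendsto_integral_lineDeriv_mul hD
    ((integrable_indicator_iff hK.measurableSet).2 (hw.integrableOn_isCompact hK)) (-v)
  have hlineDeriv : ∀ x, lineDeriv ℝ φ x (-v) = -fderiv ℝ φ x v := fun x => by
    rw [(hφ.differentiable (by simp) x).lineDeriv_eq_fderiv, map_neg]
  simp only [hlineDeriv] at hlim
  rw [hloc fun x hx => by
    rw [fderiv_of_notMem_tsupport ℝ fun h => hx (Metric.self_subset_cthickening _ h)]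
    simp] at hlim
  simp only [mul_neg, integral_neg] at hlim
  refine hlim.congr' ?_
  filter_upwards [Ioc_mem_nhdsGT one_pos] with r hr
  have hφt : ∀ x ∉ K, φ (x - r • v) = 0 := fun x hx => image_eq_zero_of_notMem_tsupport fun h =>
    hx (Metric.mem_cthickening_of_dist_le _ _ _ _ h (by
      rw [dist_eq_norm, sub_sub_cancel, norm_smul, Real.norm_of_nonneg hr.1.le]
      exact mul_le_of_le_one_left (norm_nonneg _) hr.2))
  simp only [mul_assoc, smul_eq_mul, integral_const_mul, smul_neg, ← sub_eq_add_neg]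
  rw [hloc fun x hx => by rw [hφt x hx, hφK x hx, sub_zero],
    integral_translate_sub_mul hw hφ.continuous hφc]

theorem tendsto_integral_inner_discreteGradient (hw : LocallyIntegrable w volume)
    (hφ : ContDiff ℝ ∞ φ) (hφc : HasCompactSupport φ) (v : E) :
    Tendsto (fun r => ∫ x, inner ℝ (discreteGradient b w r x) v * φ x) (𝓝[>] 0)
      (𝓝 (-∫ x, w x * fderiv ℝ φ x v)) := by
  have hsum : ∀ r, ∫ x, inner ℝ (discreteGradient b w r x) v * φ x =
      ∑ i, inner ℝ (b i) v * ∫ x, r⁻¹ * (w (x + r • b i) - w x) * φ x := fun r => by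
    simp only [inner_discreteGradient, Finset.sum_mul, ← integral_const_mul]
    rw [integral_finsetSum]
    · simp only [mul_assoc]
    · intro i _
      simp only [mul_assoc]
      exact ((integrable_mul_of_hasCompactSupport ((locallyIntegrable_comp_add_right hw
        (r • b i)).sub hw) hφ.continuous hφc).const_mul _).const_mul _
  have hlim : ∑ i, inner ℝ (b i) v * -∫ x, w x * fderiv ℝ φ x (b i) =
      -∫ x, w x * fderiv ℝ φ x v := by
    have hfderiv : ∀ x, w x * fderiv ℝ φ x v =
        ∑ i, inner ℝ (b i) v * (w x * fderiv ℝ φ x (b i)) := fun x => by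
      conv_lhs => rw [← b.sum_repr' v, map_sum, Finset.mul_sum]
      refine Finset.sum_congr rfl fun i _ => ?_
      rw [map_smul, smul_eq_mul]
      ring
    simp only [hfderiv, mul_neg, Finset.sum_neg_distrib]
    rw [integral_finsetSum _ fun i _ => (integrable_mul_of_hasCompactSupport hw
      ((hφ.continuous_fderiv (by simp)).clm_apply continuous_const)
      (hφc.fderiv_apply ℝ (b i))).const_mul _]
    simp only [integral_const_mul]
  simp only [hsum, ← hlim]
  exact tendsto_finsetSum _ fun i _ =>
    (tendsto_integral_difference_quotient hw hφ hφc (b i)).const_mul _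

theorem inner_toLp_smul_const {f : E → E} (hf : MemLp f 2 volume) {v : E}
    (hφ : MemLp (fun x => φ x • v) 2 volume) :
    inner ℝ hf.toLp hφ.toLp = ∫ x, inner ℝ (f x) v * φ x := by
  rw [L2.inner_def]
  refine integral_congr_ae ?_
  filter_upwards [hf.coeFn_toLp, hφ.coeFn_toLp] with x hx hx'
  rw [hx, hx', inner_smul_right, mul_comm]

theorem exists_hasWeakGradient_of_differenceEnergy_le (hw : MemLp w 2 volume) {K : ℝ≥0∞}
    (hK : K ≠ ⊤) (h : ∀ r, 0 < r → differenceEnergy b w r ≤ ENNReal.ofReal r ^ 2 * K ^ 2) :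
    ∃ G : E → E, HasWeakGradient w G ∧ eLpNorm G 2 volume ≤ K := by
  have hbound : ∀ᶠ r in 𝓝[>] 0, ‖(memLp_discreteGradient b hw r).toLp‖ ≤ K.toReal := by
    filter_upwards [self_mem_nhdsWithin] with r hr
    rw [Lp.norm_toLp]
    exact ENNReal.toReal_mono hK (eLpNorm_two_discreteGradient_le b hw.1 hr (h r hr))
  obtain ⟨z, hz, U, hU, hlim⟩ := exists_weak_limit hbound
  refine ⟨z, ⟨hw.locallyIntegrable one_le_two, (Lp.memLp z).locallyIntegrable one_le_two,
    fun φ hφ hφc v => ?_⟩, ?_⟩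
  · have hφv : MemLp (fun x => φ x • v) 2 volume :=
      (hφ.continuous.smul continuous_const).memLp_of_hasCompactSupport hφc.smul_right
    have hz : inner ℝ z hφv.toLp = ∫ x, inner ℝ (z x) v * φ x := by
      rw [← inner_toLp_smul_const (Lp.memLp z), Lp.toLp_coeFn]
    have hlimφ := hlim hφv.toLp
    simp only [inner_toLp_smul_const, hz] at hlimφ
    rw [tendsto_nhds_unique hlimφ ((tendsto_integral_inner_discreteGradient b
      (hw.locallyIntegrable one_le_two) hφ hφc v).mono_left hU), neg_neg]
  · rw [← Lp.enorm_def, ← ofReal_norm]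
    exact ENNReal.ofReal_le_of_le_toReal hz

end DiscreteGradient

section MaximalFunction

variable {E : Type*} [NormedAddCommGroup E] [InnerProductSpace ℝ E]

theorem setOf_lt_halfSpacePoissonKernel {y s : ℝ} (hy : 0 < y) (hs : 0 < s) (x : E) :
    ∃ r : ℝ, {z | s < halfSpacePoissonKernel y (x - z)} = Metric.ball x r := by
  have hc := poissonConst_pos (E := E)
  set a : ℝ := ((Module.finrank ℝ E : ℝ) + 1) / 2
  have ha : 0 < a := by positivity
  have hP : ∀ w : E, halfSpacePoissonKernel y w =
      poissonConst E * y * (‖w‖ ^ 2 + y ^ 2) ^ (-a) := fun w => by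
    rw [Real.rpow_neg (by positivity), ← div_eq_mul_inv, mul_div_assoc]
    rfl
  refine ⟨√((s / (poissonConst E * y)) ^ (-a)⁻¹ - y ^ 2), Set.ext fun z => ?_⟩
  rw [Metric.mem_ball', dist_eq_norm, Real.lt_sqrt (norm_nonneg _), lt_sub_iff_add_lt,
    Real.lt_rpow_inv_iff_of_neg (by positivity) (by positivity) (by linarith), mem_ofPred_eq, hP,
    div_lt_iff₀' (by positivity)]

variable [FiniteDimensional ℝ E] [MeasurableSpace E] [BorelSpace E]

/-- The centred Hardy–Littlewood maximal function of a measure. -/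
noncomputable def ballMaximal (ν : Measure E) (x : E) : ℝ≥0∞ :=
  ⨆ (r : ℝ) (_ : 0 < r), ν (Metric.ball x r) / volume (Metric.ball x r)

theorem measure_ball_le_ballMaximal (ν : Measure E) (x : E) (r : ℝ) :
    ν (Metric.ball x r) ≤ ballMaximal ν x * volume (Metric.ball x r) := by
  rcases le_or_gt r 0 with hr | hr
  · simp [Metric.ball_eq_empty.2 hr]
  · rw [← ENNReal.div_le_iff (Metric.measure_ball_pos volume x hr).ne' measure_ball_lt_top.ne]
    exact le_iSup₂_of_le r hr le_rfl

theorem setOf_lt_ballMaximal (ν : Measure E) (t : ℝ≥0∞) :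
    {x | t < ballMaximal ν x} = ⋃ n : ℕ, {x | ∃ r : ℝ, 0 < r ∧ r ≤ n ∧
      t * volume (Metric.ball x r) < ν (Metric.ball x r)} := by
  ext x
  simp only [ballMaximal, mem_ofPred_eq, lt_iSup_iff, exists_prop, mem_iUnion]
  have hdiv : ∀ {r : ℝ}, 0 < r → (t < ν (Metric.ball x r) / volume (Metric.ball x r) ↔
      t * volume (Metric.ball x r) < ν (Metric.ball x r)) := fun hr =>
    ENNReal.lt_div_iff_mul_lt (.inl (Metric.measure_ball_pos volume x hr).ne')
      (.inl measure_ball_lt_top.ne)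
  constructor
  · rintro ⟨r, hr, h⟩
    obtain ⟨n, hn⟩ := exists_nat_ge r
    exact ⟨n, r, hr, hn, (hdiv hr).1 h⟩
  · rintro ⟨-, r, hr, -, h⟩
    exact ⟨r, hr, (hdiv hr).2 h⟩

theorem volume_setOf_exists_ball_le (ν : Measure E) {t : ℝ≥0∞} (ht : t ≠ 0) (ht' : t ≠ ⊤)
    (R : ℝ) :
    volume {x : E | ∃ r : ℝ, 0 < r ∧ r ≤ R ∧ t * volume (Metric.ball x r) < ν (Metric.ball x r)} ≤
      4 ^ Module.finrank ℝ E / t * ν univ := by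
  set A := {x : E | ∃ r : ℝ, 0 < r ∧ r ≤ R ∧ t * volume (Metric.ball x r) < ν (Metric.ball x r)}
  choose! ρ hρ0 hρR hρ using fun (x : E) (hx : x ∈ A) => hx
  obtain ⟨s, hsA, hdisj, hcov⟩ := Vitali.exists_disjoint_subfamily_covering_enlargement_ball A
    (fun x => x) ρ R hρR 4 (by norm_num)
  have hcount : s.Countable := hdisj.countable_of_isOpen (fun _ _ => Metric.isOpen_ball)
    fun a ha => Metric.nonempty_ball.2 (hρ0 a (hsA ha))
  have := hcount.to_subtype
  calc volume A ≤ volume (⋃ a ∈ s, Metric.ball a (4 * ρ a)) := by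
        refine measure_mono fun x hx => ?_
        obtain ⟨b, hb, hxb⟩ := hcov x hx
        exact mem_biUnion hb (hxb (Metric.mem_ball_self (hρ0 x hx)))
    _ ≤ ∑' a : s, volume (Metric.ball (a : E) (4 * ρ a)) := measure_biUnion_le _ hcount _
    _ ≤ ∑' a : s, 4 ^ Module.finrank ℝ E / t * ν (Metric.ball (a : E) (ρ a)) := by
        refine ENNReal.tsum_le_tsum fun a => ?_
        rw [Measure.addHaar_ball_mul_of_pos volume _ (by norm_num : (0 : ℝ) < 4),
          ← Measure.addHaar_ball_center volume (a : E),
          ENNReal.ofReal_pow (by norm_num), ENNReal.ofReal_ofNat, ENNReal.mul_comm_div]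
        refine mul_le_mul_right ?_ _
        rw [ENNReal.le_div_iff_mul_le (.inl ht) (.inl ht'), mul_comm]
        exact (hρ a (hsA a.2)).le
    _ = 4 ^ Module.finrank ℝ E / t * ν (⋃ a ∈ s, Metric.ball (a : E) (ρ a)) := by
        rw [ENNReal.tsum_mul_left, measure_biUnion hcount hdisj fun _ _ => measurableSet_ball]
    _ ≤ 4 ^ Module.finrank ℝ E / t * ν univ := mul_le_mul_right (measure_mono (subset_univ _)) _

theorem volume_ballMaximal_gt_le (ν : Measure E) {t : ℝ≥0∞} (ht : t ≠ 0) (ht' : t ≠ ⊤) :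
    volume {x | t < ballMaximal ν x} ≤ 4 ^ Module.finrank ℝ E / t * ν univ := by
  rw [setOf_lt_ballMaximal, Monotone.measure_iUnion]
  · exact iSup_le fun n => volume_setOf_exists_ball_le ν ht ht' n
  · exact fun m n hmn x ⟨r, hr0, hrm, hr⟩ => ⟨r, hr0, hrm.trans (Nat.cast_le.2 hmn), hr⟩

theorem ballMaximal_le_restrict_add {ν : Measure E} {S : Set E} {a : ℝ≥0∞}
    (h : ∀ B, MeasurableSet B → ν (B \ S) ≤ a * volume B) (x : E) :
    ballMaximal ν x ≤ ballMaximal (ν.restrict S) x + a := by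
  refine iSup₂_le fun r hr => ?_
  rw [ENNReal.div_le_iff (Metric.measure_ball_pos volume x hr).ne' measure_ball_lt_top.ne,
    add_mul]
  refine (measure_le_inter_add_sdiff ν _ S).trans (add_le_add ?_ (h _ measurableSet_ball))
  rw [← Measure.restrict_apply measurableSet_ball]
  exact measure_ball_le_ballMaximal _ x r

-- The superlevel sets of the kernel are balls, so the kernel is a superposition of balls.
theorem poissonMaximal_le_ballMaximal {u : E → ℝ} (hu : AEStronglyMeasurable u volume) (x : E) :
    poissonMaximal u x ≤ ballMaximal (volume.withDensity fun z => ‖u z‖ₑ) x := by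
  set ν := (volume : Measure E).withDensity fun z => ‖u z‖ₑ
  refine iSup₂_le fun y hy => ?_
  have hPc : Continuous fun z : E => halfSpacePoissonKernel y (x - z) :=
    (continuous_halfSpacePoissonKernel hy).comp (continuous_sub_left x)
  have hP0 : ∀ z : E, 0 ≤ halfSpacePoissonKernel y (x - z) := fun z =>
    (halfSpacePoissonKernel_pos hy _).le
  calc poissonExtensionAbs u y x
      = ∫⁻ z, ENNReal.ofReal (halfSpacePoissonKernel y (x - z)) ∂ν := by
        rw [lintegral_withDensity_eq_lintegral_mul₀ hu.enorm
          hPc.measurable.ennreal_ofReal.aemeasurable]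
        refine lintegral_congr fun z => ?_
        rw [ENNReal.ofReal_mul (abs_nonneg _), ← Real.norm_eq_abs, ofReal_norm]
        rfl
    _ = ∫⁻ t in Ioi (0 : ℝ), ν {z | t < halfSpacePoissonKernel y (x - z)} :=
        lintegral_eq_lintegral_meas_lt ν (.of_forall hP0) hPc.measurable.aemeasurable
    _ ≤ ∫⁻ t in Ioi (0 : ℝ), ballMaximal ν x *
          volume {z | t < halfSpacePoissonKernel y (x - z)} := by
        refine setLIntegral_mono' measurableSet_Ioi fun t ht => ?_
        obtain ⟨r, hr⟩ := setOf_lt_halfSpacePoissonKernel hy ht x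
        rw [hr]
        exact measure_ball_le_ballMaximal ν x r
    _ = ballMaximal ν x * ∫⁻ z, ENNReal.ofReal (halfSpacePoissonKernel y (x - z)) := by
        rw [lintegral_const_mul, ← lintegral_eq_lintegral_meas_lt volume (.of_forall hP0)
          hPc.measurable.aemeasurable]
        exact (Antitone.measurable fun s t hst => measure_mono fun z hz => hst.trans_lt hz)
    _ = ballMaximal ν x := by
        rw [lintegral_sub_left_eq_self (fun z => ENNReal.ofReal (halfSpacePoissonKernel y z)),
          lintegral_halfSpacePoissonKernel hy, mul_one]

end MaximalFunction

section Layercake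

open Filter Topology

variable {α : Type*} [MeasurableSpace α] {μ : Measure α}

theorem lintegral_rpow_le_of_forall_min_natCast {f : α → ℝ≥0∞} (hf : Measurable f) {q : ℝ}
    (hq : 0 < q) {C : ℝ≥0∞} (h : ∀ N : ℕ, ∫⁻ x, min (f x) N ^ q ∂μ ≤ C) :
    ∫⁻ x, f x ^ q ∂μ ≤ C := by
  have hmono : ∀ x, Monotone fun N : ℕ => min (f x) N ^ q := fun x m n hmn =>
    ENNReal.rpow_le_rpow (min_le_min_left _ (Nat.cast_le.2 hmn)) hq.le
  have hlim : ∀ x, Tendsto (fun N : ℕ => min (f x) N ^ q) atTop (𝓝 (f x ^ q)) := fun x => by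
    simpa only [min_top_right, Function.comp_def] using
      (ENNReal.continuous_rpow_const.tendsto _).comp
        ((tendsto_const_nhds (x := f x)).min ENNReal.tendsto_nat_nhds_top)
  exact le_of_tendsto' (lintegral_tendsto_of_tendsto_of_monotone
    (fun N => ((hf.min measurable_const).pow_const q).aemeasurable) (.of_forall hmono)
    (.of_forall hlim)) h

theorem lintegral_rpow_le_lintegral_meas_ofReal_lt_mul {f : α → ℝ≥0∞} (hf : Measurable f) {q : ℝ}
    (hq : 0 < q) :
    ∫⁻ x, f x ^ q ∂μ ≤
      ENNReal.ofReal q *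
        ∫⁻ t in Ioi (0 : ℝ), μ {x | ENNReal.ofReal t < f x} * ENNReal.ofReal (t ^ (q - 1)) := by
  refine lintegral_rpow_le_of_forall_min_natCast hf hq fun N => ?_
  have hfin : ∀ x, min (f x) N ≠ ⊤ := fun x =>
    ((min_le_right _ _).trans_lt (ENNReal.natCast_lt_top N)).ne
  calc ∫⁻ x, min (f x) N ^ q ∂μ
      = ∫⁻ x, ENNReal.ofReal ((min (f x) N).toReal ^ q) ∂μ := lintegral_congr fun x => by
        rw [← ENNReal.ofReal_rpow_of_nonneg ENNReal.toReal_nonneg hq.le,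
          ENNReal.ofReal_toReal (hfin x)]
    _ = ENNReal.ofReal q * ∫⁻ t in Ioi (0 : ℝ),
          μ {x | t < (min (f x) N).toReal} * ENNReal.ofReal (t ^ (q - 1)) :=
        lintegral_rpow_eq_lintegral_meas_lt_mul μ (.of_forall fun x => ENNReal.toReal_nonneg)
          (hf.min measurable_const).ennreal_toReal.aemeasurable hq
    _ ≤ _ := by
        refine mul_le_mul_right (setLIntegral_mono' measurableSet_Ioi fun t ht => ?_) _
        refine mul_le_mul_left (measure_mono fun x hx => ?_) _
        exact ((ENNReal.ofReal_lt_iff_lt_toReal (le_of_lt ht) (hfin x)).2 hx).trans_le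
          (min_le_left _ _)

theorem lintegral_withDensity_enorm_meas_lt_mul {u : α → ℝ} (hu : AEStronglyMeasurable u μ)
    {c q : ℝ} (hc : 0 ≤ c) (hq : 1 < q) :
    ENNReal.ofReal (q - 1) * ∫⁻ t in Ioi (0 : ℝ),
        μ.withDensity (fun z => ‖u z‖ₑ) {z | t < c * |u z|} * ENNReal.ofReal (t ^ (q - 1 - 1)) =
      ENNReal.ofReal (c ^ (q - 1)) * ∫⁻ z, ‖u z‖ₑ ^ q ∂μ := by
  have hcu : AEMeasurable (fun z => c * |u z|) μ := hu.norm.aemeasurable.const_mul c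
  rw [← lintegral_rpow_eq_lintegral_meas_lt_mul _ (.of_forall fun z => by positivity)
      (hcu.mono_ac (withDensity_absolutelyContinuous _ _)) (sub_pos.2 hq),
    lintegral_withDensity_eq_lintegral_mul₀ hu.enorm (hcu.pow_const _).ennreal_ofReal,
    ← lintegral_const_mul' _ _ ENNReal.ofReal_ne_top]
  refine lintegral_congr fun z => ?_
  have hpow : ‖u z‖ₑ ^ q = ‖u z‖ₑ * ‖u z‖ₑ ^ (q - 1) := by
    nth_rw 1 [show q = 1 + (q - 1) by ring]
    rw [ENNReal.rpow_add_of_nonneg _ _ one_pos.le (sub_pos.2 hq).le, ENNReal.rpow_one]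
  rw [Pi.mul_apply, Real.mul_rpow hc (abs_nonneg _), ENNReal.ofReal_mul (by positivity),
    ← ENNReal.ofReal_rpow_of_nonneg (abs_nonneg _) (sub_pos.2 hq).le, ← Real.norm_eq_abs,
    ofReal_norm, mul_left_comm, hpow]

end Layercake

section MaximalInequality

variable {E : Type*} [NormedAddCommGroup E] [InnerProductSpace ℝ E] [FiniteDimensional ℝ E]
  [MeasurableSpace E] [BorelSpace E] {u : E → ℝ}

theorem ballMaximal_withDensity_le_restrict_add (hu : AEStronglyMeasurable u volume) (t : ℝ)
    (x : E) :
    ballMaximal (volume.withDensity fun z => ‖u z‖ₑ) x ≤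
      ballMaximal ((volume.withDensity fun z => ‖u z‖ₑ).restrict {z | t < 2 * |u z|}) x +
        ENNReal.ofReal (t / 2) := by
  have hS : NullMeasurableSet {z | t < 2 * |u z|} volume :=
    nullMeasurableSet_lt aemeasurable_const (hu.norm.aemeasurable.const_mul 2)
  refine ballMaximal_le_restrict_add (fun B hB => ?_) x
  have hBS := hB.nullMeasurableSet.diff hS
  calc _ = ∫⁻ z in B \ {z | t < 2 * |u z|}, ‖u z‖ₑ := withDensity_apply₀ _ hBS
    _ ≤ ∫⁻ _ in B \ {z | t < 2 * |u z|}, ENNReal.ofReal (t / 2) := by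
        refine lintegral_mono_ae ?_
        filter_upwards [ae_restrict_mem₀ hBS] with z hz
        rw [← ofReal_norm, Real.norm_eq_abs]
        exact ENNReal.ofReal_le_ofReal (by linarith [not_lt.1 (show ¬ t < 2 * |u z| from hz.2)])
    _ ≤ ENNReal.ofReal (t / 2) * volume B := by
        rw [setLIntegral_const]
        exact mul_le_mul_right (measure_mono sdiff_subset) _

theorem volume_poissonMaximal_gt_le (hu : AEStronglyMeasurable u volume) {t : ℝ} (ht : 0 < t) :
    volume {x | ENNReal.ofReal t < poissonMaximal u x} ≤
      2 * 4 ^ Module.finrank ℝ E / ENNReal.ofReal t *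
        volume.withDensity (fun z => ‖u z‖ₑ) {z | t < 2 * |u z|} := by
  have hhalf : ENNReal.ofReal t = ENNReal.ofReal (t / 2) + ENNReal.ofReal (t / 2) := by
    rw [← ENNReal.ofReal_add (by positivity) (by positivity), add_halves]
  set ν := (volume : Measure E).withDensity fun z => ‖u z‖ₑ
  calc volume {x | ENNReal.ofReal t < poissonMaximal u x}
      ≤ volume {x | ENNReal.ofReal (t / 2) < ballMaximal (ν.restrict {z | t < 2 * |u z|}) x} := by
        refine measure_mono fun x (hx : ENNReal.ofReal t < _) => ?_
        have h := hx.trans_le ((poissonMaximal_le_ballMaximal hu x).trans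
          (ballMaximal_withDensity_le_restrict_add hu t x))
        rw [hhalf] at h
        exact lt_of_add_lt_add_right h
    _ ≤ 4 ^ Module.finrank ℝ E / ENNReal.ofReal (t / 2) *
          ν.restrict {z | t < 2 * |u z|} univ :=
        volume_ballMaximal_gt_le _ (by simpa using ht) ENNReal.ofReal_ne_top
    _ = _ := by
        rw [Measure.restrict_apply_univ, ENNReal.ofReal_div_of_pos two_pos, ENNReal.ofReal_ofNat,
          div_eq_mul_inv, div_eq_mul_inv, div_eq_mul_inv,
          ENNReal.mul_inv (.inr (by simp)) (.inr (by simp)), inv_inv]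
        ring

theorem lintegral_poissonMaximal_rpow_le (hu : AEStronglyMeasurable u volume) {q : ℝ}
    (hq : 1 < q) :
    ENNReal.ofReal (q - 1) * ∫⁻ x, poissonMaximal u x ^ q ≤
      ENNReal.ofReal q * (2 * 4 ^ Module.finrank ℝ E) * ENNReal.ofReal (2 ^ (q - 1)) *
        ∫⁻ x, ‖u x‖ₑ ^ q := by
  set C : ℝ≥0∞ := 2 * 4 ^ Module.finrank ℝ E with hC
  have hCt : C ≠ ⊤ := by simp [hC, ENNReal.mul_eq_top]
  set ν := (volume : Measure E).withDensity fun z => ‖u z‖ₑ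
  have hweak : ∀ t : ℝ, 0 < t →
      volume {x | ENNReal.ofReal t < poissonMaximal u x} * ENNReal.ofReal (t ^ (q - 1)) ≤
        C * (ν {z | t < 2 * |u z|} * ENNReal.ofReal (t ^ (q - 1 - 1))) := fun t ht => by
    have hpow : ENNReal.ofReal (t ^ (q - 1)) =
        ENNReal.ofReal t * ENNReal.ofReal (t ^ (q - 1 - 1)) := by
      rw [← ENNReal.ofReal_mul ht.le, Real.rpow_sub_one ht.ne' (q - 1), mul_div_cancel₀ _ ht.ne']
    have hcancel : C / ENNReal.ofReal t * ENNReal.ofReal t = C :=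
      ENNReal.div_mul_cancel (by simpa using ht) ENNReal.ofReal_ne_top
    calc _ ≤ C / ENNReal.ofReal t * ν {z | t < 2 * |u z|} *
          (ENNReal.ofReal t * ENNReal.ofReal (t ^ (q - 1 - 1))) := by
          rw [hpow]
          exact mul_le_mul_left (volume_poissonMaximal_gt_le hu ht) _
      _ = C / ENNReal.ofReal t * ENNReal.ofReal t *
          (ν {z | t < 2 * |u z|} * ENNReal.ofReal (t ^ (q - 1 - 1))) := by ring
      _ = _ := by rw [hcancel]
  calc ENNReal.ofReal (q - 1) * ∫⁻ x, poissonMaximal u x ^ q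
      ≤ ENNReal.ofReal (q - 1) * (ENNReal.ofReal q * ∫⁻ t in Ioi (0 : ℝ),
          volume {x | ENNReal.ofReal t < poissonMaximal u x} * ENNReal.ofReal (t ^ (q - 1))) :=
        mul_le_mul_right (lintegral_rpow_le_lintegral_meas_ofReal_lt_mul
          (lowerSemicontinuous_poissonMaximal u).measurable (one_pos.trans hq)) _
    _ ≤ ENNReal.ofReal (q - 1) * (ENNReal.ofReal q * ∫⁻ t in Ioi (0 : ℝ),
          C * (ν {z | t < 2 * |u z|} * ENNReal.ofReal (t ^ (q - 1 - 1)))) := by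
        gcongr _ * (_ * ?_)
        exact setLIntegral_mono' measurableSet_Ioi hweak
    _ = ENNReal.ofReal q * C * (ENNReal.ofReal (q - 1) * ∫⁻ t in Ioi (0 : ℝ),
          ν {z | t < 2 * |u z|} * ENNReal.ofReal (t ^ (q - 1 - 1))) := by
        rw [lintegral_const_mul' _ _ hCt]
        ring
    _ = _ := by rw [lintegral_withDensity_enorm_meas_lt_mul hu two_pos.le hq, ← mul_assoc]

theorem lintegral_poissonMaximal_rpow_lt_top {p : ℝ≥0∞} (hp : 1 < p) (hp' : p ≠ ⊤)
    (hu : MemLp u p volume) : ∫⁻ x, poissonMaximal u x ^ p.toReal < ⊤ := by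
  have hq : 1 < p.toReal := ENNReal.toReal_one ▸ ENNReal.toReal_strict_mono hp' hp
  refine ENNReal.lt_top_of_mul_ne_top_right (ne_top_of_le_ne_top ?_
    (lintegral_poissonMaximal_rpow_le hu.1 hq)) (by simpa using hq)
  exact ENNReal.mul_ne_top (ENNReal.mul_ne_top (ENNReal.mul_ne_top ENNReal.ofReal_ne_top
    (ENNReal.mul_ne_top ENNReal.ofNat_ne_top (ENNReal.pow_ne_top ENNReal.ofNat_ne_top)))
    ENNReal.ofReal_ne_top)
    (lintegral_rpow_enorm_lt_top_of_eLpNorm_lt_top (one_pos.trans hp).ne' hp' hu.2).ne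

theorem ae_poissonMaximal_lt_top {p : ℝ≥0∞} (hp : 1 < p) (hp' : p ≠ ⊤) (hu : MemLp u p volume) :
    ∀ᵐ x, poissonMaximal u x < ⊤ := by
  filter_upwards [ae_lt_top ((lowerSemicontinuous_poissonMaximal u).measurable.pow_const _)
    (lintegral_poissonMaximal_rpow_lt_top hp hp' hu).ne] with x hx
  exact (ENNReal.rpow_lt_top_iff_of_pos
    (ENNReal.toReal_pos (one_pos.trans hp).ne' hp')).1 hx

theorem memLp_poissonMaximal {p : ℝ≥0∞} (hp : 1 < p) (hp' : p ≠ ⊤) (hu : MemLp u p volume) :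
    MemLp (fun x => (poissonMaximal u x).toReal) p volume := by
  refine ⟨(lowerSemicontinuous_poissonMaximal u).measurable.ennreal_toReal.aestronglyMeasurable, ?_⟩
  rw [eLpNorm_lt_top_iff_lintegral_rpow_enorm_lt_top (one_pos.trans hp).ne' hp']
  refine (lintegral_mono fun x => ENNReal.rpow_le_rpow ?_ ENNReal.toReal_nonneg).trans_lt
    (lintegral_poissonMaximal_rpow_lt_top hp hp' hu)
  rw [Real.enorm_of_nonneg ENNReal.toReal_nonneg]
  exact ENNReal.ofReal_toReal_le

end MaximalInequality

section Translation

variable {E : Type*} [NormedAddCommGroup E] [InnerProductSpace ℝ E] [FiniteDimensional ℝ E]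
  [MeasurableSpace E] [BorelSpace E] {u : E → ℝ} {G : E → E}

theorem poissonExtensionAbs_le_add_lintegral_poissonMeasure (hu : AEStronglyMeasurable u volume)
    {y : ℝ} (hy : 0 < y) (x x' : E) :
    poissonExtensionAbs u y x ≤
      poissonExtensionAbs u y x' + ∫⁻ z, ‖u (x - z) - u (x' - z)‖ₑ ∂poissonMeasure E y := by
  have hux : AEStronglyMeasurable (fun z => u (x' - z)) (poissonMeasure E y) :=
    (hu.comp_quasiMeasurePreserving (quasiMeasurePreserving_sub_left volume x')).mono_ac
      (withDensity_absolutelyContinuous _ _)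
  rw [poissonExtensionAbs_eq_lintegral_poissonMeasure hu hy,
    poissonExtensionAbs_eq_lintegral_poissonMeasure hu hy, ← lintegral_add_left' hux.enorm]
  exact lintegral_mono fun z => by
    simpa using enorm_add_le (u (x' - z)) (u (x - z) - u (x' - z))

theorem poissonMaximal_le_add (hu : AEStronglyMeasurable u volume) {h : E} {M : ℝ}
    (hM : ∀ᵐ x, |u (x + h) - u x| ≤ M) (x : E) :
    poissonMaximal u (x + h) ≤ poissonMaximal u x + ENNReal.ofReal M := by
  refine iSup₂_le fun y hy => ?_
  have := isProbabilityMeasure_poissonMeasure (E := E) hy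
  have hMx : ∀ᵐ z ∂poissonMeasure E y, ‖u (x + h - z) - u (x - z)‖ₑ ≤ ENNReal.ofReal M :=
    withDensity_absolutelyContinuous _ _ <| by
      filter_upwards [(quasiMeasurePreserving_sub_left volume x).ae hM] with z hz
      rw [← ofReal_norm, Real.norm_eq_abs, add_sub_right_comm]
      exact ENNReal.ofReal_le_ofReal hz
  calc poissonExtensionAbs u y (x + h)
      ≤ poissonExtensionAbs u y x + ∫⁻ z, ‖u (x + h - z) - u (x - z)‖ₑ ∂poissonMeasure E y :=
        poissonExtensionAbs_le_add_lintegral_poissonMeasure hu hy _ _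
    _ ≤ poissonExtensionAbs u y x + ∫⁻ _, ENNReal.ofReal M ∂poissonMeasure E y := by
        gcongr _ + ?_
        exact lintegral_mono_ae hMx
    _ = poissonExtensionAbs u y x + ENNReal.ofReal M := by
        rw [lintegral_const, measure_univ, mul_one]
    _ ≤ poissonMaximal u x + ENNReal.ofReal M := by
        gcongr
        exact le_iSup₂_of_le y hy le_rfl

theorem lipschitzWith_poissonMaximal (hu : AEStronglyMeasurable u volume) {L : NNReal}
    (hL : ∀ h, ∀ᵐ x, |u (x + h) - u x| ≤ L * ‖h‖) (hfin : ∀ x, poissonMaximal u x ≠ ⊤) :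
    LipschitzWith L fun x => (poissonMaximal u x).toReal := by
  refine LipschitzWith.of_le_add_mul L fun x x' => ?_
  have hle := poissonMaximal_le_add hu (hL (x - x')) x'
  rw [add_sub_cancel] at hle
  have hreal := ENNReal.toReal_mono
    (ENNReal.add_ne_top.2 ⟨hfin x', ENNReal.ofReal_ne_top⟩) hle
  rwa [ENNReal.toReal_add (hfin x') ENNReal.ofReal_ne_top,
    ENNReal.toReal_ofReal (by positivity), ← dist_eq_norm] at hreal

theorem ae_ae_add_smul {P : E → Prop} (hP : ∀ᵐ x, P x) (h : E) :
    ∀ᵐ x : E, ∀ᵐ s ∂volume.restrict (Ioc (0 : ℝ) 1), P (x + s • h) := by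
  let N := toMeasurable volume {x | ¬ P x}
  have hN : ∀ᵐ x : E, x ∉ N := measure_eq_zero_iff_ae_notMem.1 ((measure_toMeasurable _).trans hP)
  have hswap : ∀ᵐ x : E, ∀ᵐ s ∂volume.restrict (Ioc (0 : ℝ) 1), x + s • h ∉ N := by
    refine (Measure.ae_ae_comm ?_).1 (.of_forall fun s : ℝ =>
      (measurePreserving_add_right volume (s • h)).quasiMeasurePreserving.ae hN)
    exact (measurableSet_toMeasurable _ _).compl.preimage
      (f := fun p : ℝ × E => p.2 + p.1 • h) (by fun_prop)
  filter_upwards [hswap] with x hx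
  filter_upwards [hx] with s hs
  by_contra hPs
  exact hs (subset_toMeasurable _ _ hPs)

theorem HasWeakGradient.ae_abs_sub_le (hu : HasWeakGradient u G) {L : ℝ}
    (hG : ∀ᵐ x, ‖G x‖ ≤ L) (h : E) : ∀ᵐ x, |u (x + h) - u x| ≤ L * ‖h‖ := by
  filter_upwards [hu.sub_eq_integral h, ae_ae_add_smul hG h] with x hx hxs
  rw [hx, ← Real.norm_eq_abs]
  have hbound : ∀ᵐ s : ℝ, s ∈ uIoc 0 1 → ‖(inner ℝ (G (x + s • h)) h : ℝ)‖ ≤ L * ‖h‖ := by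
    rw [uIoc_of_le zero_le_one]
    filter_upwards [(ae_restrict_iff' measurableSet_Ioc).1 hxs] with s hs hs01
    exact (norm_inner_le_norm _ _).trans (mul_le_mul_of_nonneg_right (hs hs01) (norm_nonneg _))
  simpa using intervalIntegral.norm_integral_le_of_norm_le_const_ae hbound

theorem ae_norm_le_toReal_eLpNorm_top {α F : Type*} [MeasurableSpace α] {μ : Measure α}
    [NormedAddCommGroup F] {f : α → F} (hf : MemLp f ⊤ μ) :
    ∀ᵐ x ∂μ, ‖f x‖ ≤ (eLpNorm f ⊤ μ).toReal := by
  have h : ∀ᵐ x ∂μ, ‖f x‖ₑ ≤ eLpNorm f ⊤ μ := eLpNorm_exponent_top (f := f) ▸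
    ae_le_eLpNormEssSup
  filter_upwards [h] with x hx
  rw [← toReal_enorm]
  exact ENNReal.toReal_mono hf.2.ne hx

theorem poissonMaximal_memW1_top (hu : MemLp u ⊤ volume) (hG : HasWeakGradient u G)
    (hGm : MemLp G ⊤ volume) :
    (∀ x, poissonMaximal u x < ⊤) ∧ MemW1 ⊤ (fun x => (poissonMaximal u x).toReal) ∧
      ∃ G' : E → E, HasWeakGradient (fun x => (poissonMaximal u x).toReal) G' ∧
        eLpNorm G' ⊤ volume ≤ eLpNorm G ⊤ volume := by
  have hB := ae_norm_le_toReal_eLpNorm_top hu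
  have hfin : ∀ x, poissonMaximal u x < ⊤ := fun x =>
    (poissonMaximal_le_of_bound hB x).trans_lt ENNReal.ofReal_lt_top
  have hlip := lipschitzWith_poissonMaximal (L := (eLpNorm G ⊤ volume).toNNReal) hu.1
    (hG.ae_abs_sub_le (ae_norm_le_toReal_eLpNorm_top hGm)) fun x => (hfin x).ne
  have hgrad := hasWeakGradient_of_lipschitzWith hlip
  refine ⟨hfin, ⟨memLp_top_poissonMaximal hB, _, hgrad,
    memLp_top_gradient_of_lipschitzWith hlip⟩, _, hgrad, ?_⟩
  refine (eLpNorm_le_of_ae_bound (.of_forall fun x =>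
    norm_gradient_le_of_lipschitzWith hlip)).trans ?_
  simpa using ENNReal.coe_toNNReal_le_self

end Translation

section Line

variable {u v G : ℝ → ℝ} {p : ℝ≥0∞}

theorem exists_ae_eq_const_of_translation_invariant {w : ℝ → ℝ}
    (hw : AEStronglyMeasurable w volume) (h : ∀ a, ∀ᵐ x, w (x + a) = w x) :
    ∃ c, ∀ᵐ x, w x = c := by
  let w' := hw.mk w
  have hww' : w =ᵐ[volume] w' := hw.ae_eq_mk
  have hm : Measurable w' := hw.stronglyMeasurable_mk.measurable
  have h' : ∀ a, ∀ᵐ x, w' (x + a) = w' x := fun a => by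
    filter_upwards [h a, hww', (quasiMeasurePreserving_add_right volume a).ae hww']
      with x hwx hx hxa
    rw [← hx, ← hwx, hxa]
  have hswap : ∀ᵐ x : ℝ, ∀ᵐ a : ℝ, w' (x + a) = w' x := by
    refine (Measure.ae_ae_comm ?_).1 (.of_forall h')
    exact measurableSet_eq_fun (hm.comp (measurable_snd.add measurable_fst))
      (hm.comp measurable_snd)
  obtain ⟨x, hx⟩ := hswap.exists
  refine ⟨w' x, ?_⟩
  filter_upwards [hww', (measurePreserving_sub_right volume x).quasiMeasurePreserving.ae hx]
    with z hz hzx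
  rw [hz, ← hzx, add_sub_cancel]

theorem HasWeakGradient.exists_ae_eq_primitive (hG : HasWeakGradient u G) :
    ∃ v : ℝ → ℝ, u =ᵐ[volume] v ∧ ∀ a b, v b - v a = ∫ x in a..b, G x := by
  have hGi : ∀ a b, IntervalIntegrable G volume a b := fun a b =>
    (hG.locallyIntegrable_grad.integrableOn_isCompact isCompact_uIcc).intervalIntegrable
  let F : ℝ → ℝ := fun x => ∫ t in (0 : ℝ)..x, G t
  have hF : ∀ a b, F b - F a = ∫ x in a..b, G x := fun a b =>
    intervalIntegral.integral_interval_sub_left (hGi _ _) (hGi _ _)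
  have hFc : Continuous F := intervalIntegral.continuous_primitive hGi 0
  obtain ⟨c, hc⟩ := exists_ae_eq_const_of_translation_invariant (w := fun x => u x - F x)
    (hG.locallyIntegrable.aestronglyMeasurable.sub hFc.aestronglyMeasurable) fun a => by
      filter_upwards [hG.sub_eq_integral a] with x hx
      have hline : ∫ s in (0 : ℝ)..1, inner ℝ (G (x + s • a)) a = F (x + a) - F x := by
        rw [hF, ← (by simp : a * ∫ s in (0 : ℝ)..1, G (x + a * s) = ∫ t in x..x + a, G t),
          ← intervalIntegral.integral_const_mul]
        refine intervalIntegral.integral_congr fun s _ => ?_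
        simp [mul_comm]
      linarith
  refine ⟨fun x => F x + c, ?_, fun a b => by rw [← hF, add_sub_add_right_eq_sub]⟩
  filter_upwards [hc] with x hx
  rw [← hx, add_sub_cancel]

theorem setIntegral_norm_le_toReal_eLpNorm {α : Type*} [MeasurableSpace α] {μ : Measure α}
    {f : α → ℝ} (hp : 1 ≤ p) (hf : MemLp f p μ) {s : Set α} (hs : μ s = 1) :
    ∫ t in s, ‖f t‖ ∂μ ≤ (eLpNorm f p μ).toReal := by
  have : IsProbabilityMeasure (μ.restrict s) := ⟨by rw [Measure.restrict_apply_univ, hs]⟩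
  rw [integral_norm_eq_lintegral_enorm hf.1.restrict, ← eLpNorm_one_eq_lintegral_enorm]
  exact ENNReal.toReal_mono hf.2.ne ((eLpNorm_le_eLpNorm_of_exponent_le hp hf.1.restrict).trans
    (eLpNorm_mono_measure f Measure.restrict_le_self))

-- On a unit interval `|v|` is somewhere at most its mean, and varies by at most `∫ |G|`.
theorem abs_le_of_sub_eq_integral (hp : 1 ≤ p) (hvm : MemLp v p volume) (hGm : MemLp G p volume)
    (hv : ∀ a b, v b - v a = ∫ x in a..b, G x) (x : ℝ) :
    |v x| ≤ (eLpNorm v p volume).toReal + (eLpNorm G p volume).toReal := by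
  have hI : volume (Ioc x (x + 1)) = 1 := by simp
  obtain ⟨t, ht, hvt⟩ := exists_le_setAverage (by simp [hI]) (by simp [hI])
    ((hvm.locallyIntegrable hp).integrableOn_isCompact (isCompact_Icc (a := x) (b := x + 1))
      |>.mono_set Ioc_subset_Icc_self).norm
  have hGi : IntegrableOn (fun s => ‖G s‖) (Ioc x (x + 1)) :=
    ((hGm.locallyIntegrable hp).integrableOn_isCompact (isCompact_Icc (a := x) (b := x + 1))
      |>.mono_set Ioc_subset_Icc_self).norm
  have hvar : |v t - v x| ≤ ∫ s in Ioc x (x + 1), ‖G s‖ := by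
    rw [hv, ← Real.norm_eq_abs]
    refine (intervalIntegral.norm_integral_le_integral_norm ht.1.le).trans ?_
    rw [intervalIntegral.integral_of_le ht.1.le]
    exact setIntegral_mono_set hGi (.of_forall fun _ => norm_nonneg _)
      (Ioc_subset_Ioc_right ht.2).eventuallyLE
  rw [setAverage_eq, measureReal_def, hI, ENNReal.toReal_one, inv_one, one_smul] at hvt
  calc |v x| ≤ ‖v t‖ + |v t - v x| := by
        rw [Real.norm_eq_abs, abs_sub_comm]
        linarith [abs_sub_abs_le_abs_sub (v x) (v t)]
    _ ≤ _ := add_le_add (hvt.trans (setIntegral_norm_le_toReal_eLpNorm hp hvm hI))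
        (hvar.trans (setIntegral_norm_le_toReal_eLpNorm hp hGm hI))

theorem poissonMaximal_weakDerivative_line (hp : 1 ≤ p) (hp' : p ≠ ⊤) (hum : MemLp u p volume)
    (hG : HasWeakGradient u G) (hGm : MemLp G p volume) :
    (∀ x, poissonMaximal u x < ⊤) ∧ MemLp (fun x => (poissonMaximal u x).toReal) ⊤ volume ∧
      ∃ G' : ℝ → ℝ, HasWeakGradient (fun x => (poissonMaximal u x).toReal) G' ∧
        eLpNorm G' p volume ≤ eLpNorm G p volume := by
  obtain ⟨v, huv, hv⟩ := hG.exists_ae_eq_primitive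
  have hB := abs_le_of_sub_eq_integral hp (hum.ae_eq huv) hGm hv
  rw [poissonMaximal_congr huv]
  exact ⟨fun x => (poissonMaximal_le_of_bound (.of_forall hB) x).trans_lt ENNReal.ofReal_lt_top,
    memLp_top_poissonMaximal (.of_forall hB), _,
    hasWeakGradient_poissonMaximal_of_sub_eq_integral hp hp' hB hv hGm⟩

end Line

section DifferenceEnergy

theorem lintegral_enorm_sq_le {α F : Type*} [MeasurableSpace α] [NormedAddCommGroup F]
    {μ : Measure α} [IsProbabilityMeasure μ] {f : α → F} (hf : AEStronglyMeasurable f μ) :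
    (∫⁻ x, ‖f x‖ₑ ∂μ) ^ 2 ≤ ∫⁻ x, ‖f x‖ₑ ^ 2 ∂μ := by
  rw [← eLpNorm_two_sq, ← eLpNorm_one_eq_lintegral_enorm]
  gcongr
  exact eLpNorm_le_eLpNorm_of_exponent_le one_le_two hf

theorem enorm_integral_sq_le {α F : Type*} [MeasurableSpace α] [NormedAddCommGroup F]
    [NormedSpace ℝ F] {μ : Measure α} [IsProbabilityMeasure μ] (f : α → F) :
    ‖∫ x, f x ∂μ‖ₑ ^ 2 ≤ ∫⁻ x, ‖f x‖ₑ ^ 2 ∂μ := by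
  by_cases hf : AEStronglyMeasurable f μ
  · exact (pow_le_pow_left' (enorm_integral_le_lintegral_enorm f) 2).trans
      (lintegral_enorm_sq_le hf)
  · simp [integral_non_aestronglyMeasurable hf]

theorem enorm_toReal_sub_le {a b d : ℝ≥0∞} (ha : a ≠ ⊤) (hb : b ≠ ⊤) (hab : a ≤ b + d)
    (hba : b ≤ a + d) : ‖a.toReal - b.toReal‖ₑ ≤ d := by
  rcases eq_or_ne d ⊤ with rfl | hd
  · exact le_top
  rw [← ofReal_norm, Real.norm_eq_abs]
  refine ENNReal.ofReal_le_of_le_toReal (abs_sub_le_iff.2 ⟨?_, ?_⟩)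
  · have := ENNReal.toReal_mono (ENNReal.add_ne_top.2 ⟨hb, hd⟩) hab
    rw [ENNReal.toReal_add hb hd] at this
    linarith
  · have := ENNReal.toReal_mono (ENNReal.add_ne_top.2 ⟨ha, hd⟩) hba
    rw [ENNReal.toReal_add ha hd] at this
    linarith

theorem sum_enorm_inner_sq {E ι : Type*} [NormedAddCommGroup E] [InnerProductSpace ℝ E] [Fintype ι]
    (b : OrthonormalBasis ι ℝ E) (v : E) : ∑ i, ‖(inner ℝ v (b i) : ℝ)‖ₑ ^ 2 = ‖v‖ₑ ^ 2 := by
  rw [← ofReal_norm, ← ENNReal.ofReal_pow (norm_nonneg _), ← b.sum_sq_norm_inner_left,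
    ENNReal.ofReal_sum_of_nonneg fun i _ => by positivity]
  simp_rw [ENNReal.ofReal_pow (norm_nonneg _), ofReal_norm]

variable {E : Type*} [NormedAddCommGroup E] [InnerProductSpace ℝ E] [FiniteDimensional ℝ E]
  [MeasurableSpace E] [BorelSpace E] {ι : Type*} [Fintype ι] (b : OrthonormalBasis ι ℝ E)
  {u w : E → ℝ} {G : E → E}

theorem HasWeakGradient.lintegral_difference_sq_le (hu : HasWeakGradient u G) (h : E) :
    ∫⁻ x, ‖u (x + h) - u x‖ₑ ^ 2 ≤ ∫⁻ x, ‖(inner ℝ (G x) h : ℝ)‖ₑ ^ 2 := by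
  have : IsProbabilityMeasure ((volume : Measure ℝ).restrict (Ioc 0 1)) := ⟨by simp⟩
  have hmeas : AEMeasurable (Function.uncurry fun (s : ℝ) (x : E) =>
      ‖(inner ℝ (G (x + s • h)) h : ℝ)‖ₑ ^ 2) ((volume.restrict (Ioc (0 : ℝ) 1)).prod volume) :=
    ((hu.locallyIntegrable_inner h).aestronglyMeasurable.comp_snd.comp_quasiMeasurePreserving
      (measurePreserving_shear h).quasiMeasurePreserving).enorm.pow_const 2
  calc ∫⁻ x, ‖u (x + h) - u x‖ₑ ^ 2
      ≤ ∫⁻ x, ∫⁻ s in Ioc (0 : ℝ) 1, ‖(inner ℝ (G (x + s • h)) h : ℝ)‖ₑ ^ 2 := by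
        refine lintegral_mono_ae ?_
        filter_upwards [hu.sub_eq_integral h] with x hx
        rw [hx, intervalIntegral.integral_of_le zero_le_one]
        exact enorm_integral_sq_le _
    _ = ∫⁻ s in Ioc (0 : ℝ) 1, ∫⁻ x, ‖(inner ℝ (G (x + s • h)) h : ℝ)‖ₑ ^ 2 :=
        (lintegral_lintegral_swap hmeas).symm
    _ = ∫⁻ x, ‖(inner ℝ (G x) h : ℝ)‖ₑ ^ 2 := by
        simp_rw [fun s : ℝ => lintegral_add_right_eq_self (μ := (volume : Measure E))
          (fun x => ‖(inner ℝ (G x) h : ℝ)‖ₑ ^ 2) (s • h)]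
        simp

theorem HasWeakGradient.differenceEnergy_le (hu : HasWeakGradient u G) (r : ℝ) :
    differenceEnergy b u r ≤ ‖r‖ₑ ^ 2 * eLpNorm G 2 volume ^ 2 := by
  calc differenceEnergy b u r
      ≤ ∑ i, ∫⁻ x, ‖(inner ℝ (G x) (r • b i) : ℝ)‖ₑ ^ 2 :=
        Finset.sum_le_sum fun i _ => hu.lintegral_difference_sq_le _
    _ = ∫⁻ x, ‖r‖ₑ ^ 2 * ‖G x‖ₑ ^ 2 := by
        rw [← lintegral_finsetSum' _ fun i _ =>
          (hu.locallyIntegrable_inner _).aestronglyMeasurable.enorm.pow_const 2]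
        simp_rw [inner_smul_right, enorm_mul, mul_pow, ← Finset.mul_sum, sum_enorm_inner_sq]
    _ = ‖r‖ₑ ^ 2 * eLpNorm G 2 volume ^ 2 := by
        rw [lintegral_const_mul' _ _ (by finiteness), eLpNorm_two_sq]

theorem enorm_poissonExtensionAbs_difference_sq_le (hu : AEStronglyMeasurable u volume) {y : ℝ}
    (hy : 0 < y) {x x' : E} (hx : poissonExtensionAbs u y x ≠ ⊤)
    (hx' : poissonExtensionAbs u y x' ≠ ⊤) :
    ‖(poissonExtensionAbs u y x).toReal - (poissonExtensionAbs u y x').toReal‖ₑ ^ 2 ≤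
      ∫⁻ z, ‖u (x - z) - u (x' - z)‖ₑ ^ 2 ∂poissonMeasure E y := by
  have := isProbabilityMeasure_poissonMeasure (E := E) hy
  have hmeas : AEStronglyMeasurable (fun z => u (x - z) - u (x' - z)) (poissonMeasure E y) :=
    ((hu.comp_quasiMeasurePreserving (quasiMeasurePreserving_sub_left volume x)).sub
      (hu.comp_quasiMeasurePreserving (quasiMeasurePreserving_sub_left volume x'))).mono_ac
      (withDensity_absolutelyContinuous _ _)
  refine (pow_le_pow_left' (enorm_toReal_sub_le hx hx' ?_ ?_) 2).trans
    (lintegral_enorm_sq_le hmeas)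
  · exact poissonExtensionAbs_le_add_lintegral_poissonMeasure hu hy x x'
  · simp_rw [enorm_sub_rev (u (x - _))]
    exact poissonExtensionAbs_le_add_lintegral_poissonMeasure hu hy x' x

theorem lintegral_poissonExtensionAbs_difference_sq_le (hu : AEStronglyMeasurable u volume)
    {y : ℝ} (hy : 0 < y) (hfin : ∀ x, poissonExtensionAbs u y x ≠ ⊤) (h : E) :
    ∫⁻ x, ‖(poissonExtensionAbs u y (x + h)).toReal - (poissonExtensionAbs u y x).toReal‖ₑ ^ 2 ≤
      ∫⁻ x, ‖u (x + h) - u x‖ₑ ^ 2 := by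
  have := isProbabilityMeasure_poissonMeasure (E := E) hy
  have hmeas : AEMeasurable (Function.uncurry fun (x z : E) => ‖u (x - z + h) - u (x - z)‖ₑ ^ 2)
      (volume.prod (poissonMeasure E y)) :=
    (((aestronglyMeasurable_difference hu h).comp_quasiMeasurePreserving
      (quasiMeasurePreserving_sub volume volume)).enorm.pow_const 2).mono_ac
      (Measure.AbsolutelyContinuous.rfl.prod (withDensity_absolutelyContinuous _ _))
  calc ∫⁻ x, ‖(poissonExtensionAbs u y (x + h)).toReal - (poissonExtensionAbs u y x).toReal‖ₑ ^ 2
      ≤ ∫⁻ x, ∫⁻ z, ‖u (x - z + h) - u (x - z)‖ₑ ^ 2 ∂poissonMeasure E y :=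
        lintegral_mono fun x => by
          simpa only [add_sub_right_comm] using
            enorm_poissonExtensionAbs_difference_sq_le hu hy (hfin (x + h)) (hfin x)
    _ = ∫⁻ z, ∫⁻ x, ‖u (x - z + h) - u (x - z)‖ₑ ^ 2 ∂volume ∂poissonMeasure E y :=
        lintegral_lintegral_swap hmeas
    _ = ∫⁻ x, ‖u (x + h) - u x‖ₑ ^ 2 := by
        simp_rw [fun z : E => lintegral_sub_right_eq_self (μ := (volume : Measure E))
          (fun x => ‖u (x + h) - u x‖ₑ ^ 2) z]
        simp

theorem differenceEnergy_poissonExtensionAbs_le (hu : AEStronglyMeasurable u volume) {y : ℝ}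
    (hy : 0 < y) (hfin : ∀ x, poissonExtensionAbs u y x ≠ ⊤) (r : ℝ) :
    differenceEnergy b (fun x => (poissonExtensionAbs u y x).toReal) r ≤ differenceEnergy b u r :=
  Finset.sum_le_sum fun _ _ => lintegral_poissonExtensionAbs_difference_sq_le hu hy hfin _

theorem eLpNorm_difference_le (hw : AEStronglyMeasurable w volume) {p : ℝ≥0∞} (hp : 1 ≤ p) (a : E)
    (n : ℕ) :
    eLpNorm (fun x => w (x + (n : ℝ) • a) - w x) p volume ≤
      n * eLpNorm (fun x => w (x + a) - w x) p volume := by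
  have hd := aestronglyMeasurable_difference hw
  induction n with
  | zero => simp
  | succ n ih =>
    have htranslate := measurePreserving_add_right (volume : Measure E) ((n : ℝ) • a)
    have hsplit : (fun x => w (x + ((n + 1 : ℕ) : ℝ) • a) - w x) =
        (fun x => w (x + (n : ℝ) • a) - w x) +
          (fun x => w (x + a) - w x) ∘ fun x => x + (n : ℝ) • a := by
      funext x
      simp [add_smul, add_assoc]
    rw [hsplit, Nat.cast_succ, add_mul, one_mul]
    exact (eLpNorm_add_le (hd _) ((hd a).comp_measurePreserving htranslate) hp).trans
      (add_le_add ih (eLpNorm_comp_measurePreserving (hd a) htranslate).le)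

theorem differenceEnergy_le_sq_mul (hw : AEStronglyMeasurable w volume) (r : ℝ) {n : ℕ}
    (hn : n ≠ 0) : differenceEnergy b w r ≤ (n : ℝ≥0∞) ^ 2 * differenceEnergy b w (r / n) := by
  rw [differenceEnergy, differenceEnergy, Finset.mul_sum]
  refine Finset.sum_le_sum fun i _ => ?_
  rw [← eLpNorm_two_sq, ← eLpNorm_two_sq, ← mul_pow]
  have hle := eLpNorm_difference_le hw one_le_two ((r / n) • b i) n
  rw [smul_smul, mul_div_cancel₀ _ (Nat.cast_ne_zero.2 hn)] at hle
  exact pow_le_pow_left' hle 2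

end DifferenceEnergy

section DiscreteIntegrationByParts

variable {E : Type*} [NormedAddCommGroup E] [InnerProductSpace ℝ E] [FiniteDimensional ℝ E]
  [MeasurableSpace E] [BorelSpace E] {ι : Type*} [Fintype ι] (b : OrthonormalBasis ι ℝ E)
  {f g h w : E → ℝ}

theorem memLp_comp_sub_right {p : ℝ≥0∞} (hw : MemLp w p volume) (a : E) :
    MemLp (fun x => w (x - a)) p volume := by
  simpa only [sub_eq_add_neg] using memLp_comp_add_right hw (-a)

theorem memLp_difference {p : ℝ≥0∞} (hw : MemLp w p volume) (a : E) :
    MemLp (fun x => w (x + a) - w x) p volume :=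
  (memLp_comp_add_right hw a).sub hw

theorem integral_difference_mul_difference (hg : MemLp g 2 volume) (hh : MemLp h 2 volume)
    (a : E) :
    ∫ x, (g (x + a) - g x) * (h (x + a) - h x) =
      -∫ x, (g (x + a) + g (x - a) - 2 * g x) * h x := by
  have hd := memLp_difference hg a
  have hshift : ∫ x, (g (x + a) - g x) * h (x + a) = ∫ x, (g x - g (x - a)) * h x := by
    rw [← integral_sub_right_eq_self _ a]
    simp only [sub_add_cancel]
  calc ∫ x, (g (x + a) - g x) * (h (x + a) - h x)
      = (∫ x, (g (x + a) - g x) * h (x + a)) - ∫ x, (g (x + a) - g x) * h x := by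
        simp only [mul_sub]
        exact integral_sub (hd.integrable_mul (memLp_comp_add_right hh a)) (hd.integrable_mul hh)
    _ = ∫ x, ((g x - g (x - a)) * h x - (g (x + a) - g x) * h x) := by
        rw [hshift]
        exact (integral_sub ((hg.sub (memLp_comp_sub_right hg a)).integrable_mul hh)
          (hd.integrable_mul hh)).symm
    _ = -∫ x, (g (x + a) + g (x - a) - 2 * g x) * h x := by
        rw [← integral_neg]
        exact integral_congr_ae (.of_forall fun x => by ring)

theorem integral_difference_sq_le (hf : MemLp f 2 volume) (hg : MemLp g 2 volume) (a : E) :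
    ∫ x, (g (x + a) - g x) ^ 2 ≤ (∫ x, (f (x + a) - f x) ^ 2) +
      2 * -∫ x, (g (x + a) + g (x - a) - 2 * g x) * (g x - f x) := by
  have hgf : MemLp (fun x => g x - f x) 2 volume := hg.sub hf
  have hmul : Integrable fun x =>
      (g (x + a) - g x) * ((g (x + a) - f (x + a)) - (g x - f x)) :=
    (memLp_difference hg a).integrable_mul (memLp_difference hgf a)
  have hfi := (memLp_difference hf a).integrable_sq
  rw [← integral_difference_mul_difference hg hgf, ← integral_const_mul,
    ← integral_add hfi (hmul.const_mul 2)]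
  refine integral_mono (memLp_difference hg a).integrable_sq (hfi.add (hmul.const_mul 2))
    fun x => ?_
  dsimp only
  nlinarith [sq_nonneg ((g (x + a) - g x) - (f (x + a) - f x))]

theorem sum_neg_integral_second_difference_mul_le (hf : MemLp f 2 volume) (hg : MemLp g 2 volume)
    (hf0 : ∀ x, 0 ≤ f x) (hfg : ∀ x, f x ≤ g x) {r A : ℝ} (hA : 0 ≤ A)
    (h2 : ∀ x, f x < g x → 0 ≤ ∑ i, (g (x + r • b i) + g (x - r • b i) - 2 * g x) + A * g x) :
    ∑ i, -∫ x, (g (x + r • b i) + g (x - r • b i) - 2 * g x) * (g x - f x) ≤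
      A * ∫ x, g x ^ 2 := by
  have hint : ∀ i, Integrable fun x =>
      (g (x + r • b i) + g (x - r • b i) - 2 * g x) * (g x - f x) := fun i =>
    (((memLp_comp_add_right hg _).add (memLp_comp_sub_right hg _)).sub
      (hg.const_mul 2)).integrable_mul (hg.sub hf)
  rw [Finset.sum_neg_distrib, ← integral_finsetSum _ fun i _ => hint i,
    ← integral_const_mul, ← integral_neg]
  refine integral_mono (integrable_finsetSum _ fun i _ => hint i).neg
    (hg.integrable_sq.const_mul A) fun x => ?_
  simp only [← Finset.sum_mul]
  rcases (hfg x).eq_or_lt with hx | hx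
  · rw [hx, sub_self, mul_zero, neg_zero]
    positivity
  · have hmul := mul_nonneg (h2 x hx) (sub_nonneg.2 hx.le)
    have hgf : 0 ≤ A * (g x * f x) := mul_nonneg hA (mul_nonneg ((hf0 x).trans hx.le) (hf0 x))
    nlinarith

theorem lintegral_enorm_sq_eq {α : Type*} [MeasurableSpace α] {μ : Measure α} {f : α → ℝ}
    (hf : MemLp f 2 μ) : ∫⁻ x, ‖f x‖ₑ ^ 2 ∂μ = ENNReal.ofReal (∫ x, f x ^ 2 ∂μ) := by
  rw [ofReal_integral_eq_lintegral_ofReal hf.integrable_sq (.of_forall fun x => sq_nonneg _)]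
  refine lintegral_congr fun x => ?_
  rw [← ofReal_norm, ← ENNReal.ofReal_pow (norm_nonneg _), Real.norm_eq_abs, sq_abs]

theorem differenceEnergy_eq_ofReal (hw : MemLp w 2 volume) (r : ℝ) :
    differenceEnergy b w r = ENNReal.ofReal (∑ i, ∫ x, (w (x + r • b i) - w x) ^ 2) := by
  rw [ENNReal.ofReal_sum_of_nonneg fun i _ => integral_nonneg fun x => sq_nonneg _]
  exact Finset.sum_congr rfl fun i _ => lintegral_enorm_sq_eq (memLp_difference hw _)

-- Testing the discrete Laplacian of `g` against `g - f`, which is supported where `g` is almost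
-- subharmonic, bounds the cross term of the energies.
theorem differenceEnergy_le_of_second_differences (hf : MemLp f 2 volume) (hg : MemLp g 2 volume)
    (hf0 : ∀ x, 0 ≤ f x) (hfg : ∀ x, f x ≤ g x) {r A : ℝ} (hA : 0 ≤ A)
    (h2 : ∀ x, f x < g x → 0 ≤ ∑ i, (g (x + r • b i) + g (x - r • b i) - 2 * g x) + A * g x) :
    differenceEnergy b g r ≤
      differenceEnergy b f r + ENNReal.ofReal (2 * A) * eLpNorm g 2 volume ^ 2 := by
  have hsum : ∑ i, ∫ x, (g (x + r • b i) - g x) ^ 2 ≤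
      (∑ i, ∫ x, (f (x + r • b i) - f x) ^ 2) + 2 * A * ∫ x, g x ^ 2 := by
    have hcoord := Finset.sum_le_sum fun i (_ : i ∈ Finset.univ) =>
      integral_difference_sq_le hf hg (r • b i)
    rw [Finset.sum_add_distrib, ← Finset.mul_sum] at hcoord
    linarith [sum_neg_integral_second_difference_mul_le b hf hg hf0 hfg hA h2]
  have hg0 : 0 ≤ ∫ x, g x ^ 2 := integral_nonneg fun x => sq_nonneg _
  rw [differenceEnergy_eq_ofReal b hg, differenceEnergy_eq_ofReal b hf, eLpNorm_two_sq,
    lintegral_enorm_sq_eq hg, ← ENNReal.ofReal_mul (by positivity),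
    ← ENNReal.ofReal_add (Finset.sum_nonneg fun i _ => integral_nonneg fun x => sq_nonneg _)
      (mul_nonneg (by positivity) hg0)]
  exact ENNReal.ofReal_le_ofReal hsum

end DiscreteIntegrationByParts

section DirichletEnergy

open Filter Topology

variable {E : Type*} [NormedAddCommGroup E] [InnerProductSpace ℝ E] [FiniteDimensional ℝ E]
  [MeasurableSpace E] [BorelSpace E] {ι : Type*} [Fintype ι] (b : OrthonormalBasis ι ℝ E)
  {u w : E → ℝ} {G : E → E} {p : ℝ≥0∞}

-- A step `r` is split into `n` steps `r / n`, at the cost of a factor `n ^ 2`.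
theorem differenceEnergy_le_of_forall_small (hw : AEStronglyMeasurable w volume) {K M : ℝ≥0∞}
    (hM : M ≠ ⊤) {δ : ℝ} (hδ : 0 < δ)
    (h : ∀ s, 0 < s → s ≤ δ →
      differenceEnergy b w s ≤ ENNReal.ofReal s ^ 2 * (K + ENNReal.ofReal s * M))
    {r : ℝ} (hr : 0 < r) : differenceEnergy b w r ≤ ENNReal.ofReal r ^ 2 * K := by
  have hdiv := tendsto_const_div_atTop_nhds_zero_nat r
  have hle : ∀ᶠ n : ℕ in atTop, differenceEnergy b w r ≤
      ENNReal.ofReal r ^ 2 * (K + ENNReal.ofReal (r / n) * M) := by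
    filter_upwards [hdiv.eventually (ge_mem_nhds hδ), eventually_ne_atTop 0] with n hnδ hn
    have hn0 : (0 : ℝ) < n := by positivity
    calc differenceEnergy b w r ≤ (n : ℝ≥0∞) ^ 2 * differenceEnergy b w (r / n) :=
          differenceEnergy_le_sq_mul b hw r hn
      _ ≤ (n : ℝ≥0∞) ^ 2 * (ENNReal.ofReal (r / n) ^ 2 * (K + ENNReal.ofReal (r / n) * M)) := by
          gcongr
          exact h _ (by positivity) hnδ
      _ = ENNReal.ofReal r ^ 2 * (K + ENNReal.ofReal (r / n) * M) := by
          rw [← mul_assoc, ← mul_pow, ← ENNReal.ofReal_natCast, ← ENNReal.ofReal_mul hn0.le,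
            mul_div_cancel₀ _ hn0.ne']
  have hlim : Tendsto (fun n : ℕ => ENNReal.ofReal r ^ 2 * (K + ENNReal.ofReal (r / n) * M)) atTop
      (𝓝 (ENNReal.ofReal r ^ 2 * (K + ENNReal.ofReal 0 * M))) :=
    ENNReal.Tendsto.const_mul
      ((ENNReal.Tendsto.mul_const (ENNReal.tendsto_ofReal hdiv) (.inr hM)).const_add K)
      (.inr (by finiteness))
  simpa using ge_of_tendsto hlim hle

theorem differenceEnergy_le_of_tendsto {g : ℕ → E → ℝ} {r : ℝ} {B : ℝ≥0∞}
    (hg : ∀ k, AEStronglyMeasurable (g k) volume)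
    (hlim : ∀ᵐ x, Tendsto (fun k => g k x) atTop (𝓝 (w x)))
    (hB : ∀ k, differenceEnergy b (g k) r ≤ B) : differenceEnergy b w r ≤ B := by
  have hlim_shift : ∀ᵐ x, ∀ i, Tendsto (fun k => g k (x + r • b i)) atTop (𝓝 (w (x + r • b i))) :=
    ae_all_iff.2 fun i => (quasiMeasurePreserving_add_right volume (r • b i)).ae hlim
  rw [differenceEnergy_eq_lintegral_sum b (aestronglyMeasurable_of_tendsto_ae atTop hg hlim)]
  calc ∫⁻ x, ∑ i, ‖w (x + r • b i) - w x‖ₑ ^ 2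
      ≤ ∫⁻ x, liminf (fun k => ∑ i, ‖g k (x + r • b i) - g k x‖ₑ ^ 2) atTop := by
        refine lintegral_mono_ae ?_
        filter_upwards [hlim, hlim_shift] with x hx hxi
        exact (tendsto_finsetSum _ fun i _ => ((ENNReal.continuous_pow 2).tendsto _).comp
          ((hxi i).sub hx).enorm).liminf_eq.ge
    _ ≤ liminf (fun k => ∫⁻ x, ∑ i, ‖g k (x + r • b i) - g k x‖ₑ ^ 2) atTop :=
        lintegral_liminf_le' fun k => Finset.aemeasurable_fun_sum _ fun i _ =>
          (aestronglyMeasurable_difference (hg k) _).enorm.pow_const 2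
    _ ≤ B := by
        simp_rw [← fun k => differenceEnergy_eq_lintegral_sum b (hg k) r]
        exact liminf_le_of_le (by isBoundedDefault) fun c hc =>
          let ⟨k, hk⟩ := hc.exists
          hk.trans (hB k)

theorem poissonMaximalFrom_ne_top (hu : ∀ᵐ x, poissonMaximal u x < ⊤) {ε : ℝ} (hε : 0 < ε)
    (x : E) : poissonMaximalFrom u ε x ≠ ⊤ := by
  obtain ⟨x', hx', hfin⟩ := ((frequently_ae_mem_iff.2
    (Metric.measure_ball_pos volume x hε).ne').and_eventually hu).exists
  have hle := (poissonMaximalFrom_harnack u hε x x' hx'.le).trans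
    (poissonMaximalFrom_le_poissonMaximal u hε x')
  have hpos : 0 < 1 - dist x' x / ε := sub_pos.2 ((div_lt_one hε).2 hx')
  intro htop
  rw [htop, ENNReal.mul_top (by simpa using pow_pos hpos _), top_le_iff] at hle
  exact hfin.ne hle

theorem memLp_poissonMaximalFrom (hp : 1 < p) (hp' : p ≠ ⊤) (hu : MemLp u p volume) {ε : ℝ}
    (hε : 0 < ε) : MemLp (fun x => (poissonMaximalFrom u ε x).toReal) p volume := by
  have hae := ae_poissonMaximal_lt_top hp hp' hu
  refine (memLp_poissonMaximal hp hp' hu).mono (continuous_poissonMaximalFrom u hε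
    (poissonMaximalFrom_ne_top hae hε)).aestronglyMeasurable ?_
  filter_upwards [hae] with x hx
  rw [Real.norm_of_nonneg ENNReal.toReal_nonneg, Real.norm_of_nonneg ENNReal.toReal_nonneg]
  exact ENNReal.toReal_mono hx.ne (poissonMaximalFrom_le_poissonMaximal u hε x)

theorem differenceEnergy_poissonMaximalFrom_le (hu : MemLp u 2 volume) (hG : HasWeakGradient u G)
    {ε : ℝ} (hε : 0 < ε) {r : ℝ} (hr : 0 < r) :
    differenceEnergy b (fun x => (poissonMaximalFrom u ε x).toReal) r ≤
      ENNReal.ofReal r ^ 2 * eLpNorm G 2 volume ^ 2 := by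
  have hfin := poissonMaximalFrom_ne_top
    (ae_poissonMaximal_lt_top ENNReal.one_lt_two ENNReal.ofNat_ne_top hu) hε
  have hgm := memLp_poissonMaximalFrom ENNReal.one_lt_two ENNReal.ofNat_ne_top hu hε
  have hVle := poissonExtensionAbs_le_poissonMaximalFrom u (le_refl ε)
  have hVfin : ∀ x, poissonExtensionAbs u ε x ≠ ⊤ := fun x => ne_top_of_le_ne_top (hfin x) (hVle x)
  have hle : ∀ x, (poissonExtensionAbs u ε x).toReal ≤ (poissonMaximalFrom u ε x).toReal :=
    fun x => ENNReal.toReal_mono (hfin x) (hVle x)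
  have hfm : MemLp (fun x => (poissonExtensionAbs u ε x).toReal) 2 volume :=
    hgm.mono (continuous_poissonExtensionAbs u hε hVfin).aestronglyMeasurable
      (.of_forall fun x => by simpa using hle x)
  let C := poissonThirdConst E * Fintype.card ι / ε ^ 3
  have hC : 0 ≤ C := by have := poissonThirdConst_nonneg (E := E); positivity
  refine differenceEnergy_le_of_forall_small b hgm.1
    (M := ENNReal.ofReal (2 * C) *
      eLpNorm (fun x => (poissonMaximalFrom u ε x).toReal) 2 volume ^ 2)
    (ENNReal.mul_ne_top ENNReal.ofReal_ne_top (ENNReal.pow_ne_top hgm.2.ne))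
    (δ := ε / 8) (by positivity) (fun s hs hsε => ?_) hr
  refine (differenceEnergy_le_of_second_differences b hfm hgm (fun _ => ENNReal.toReal_nonneg) hle
    (A := C * s ^ 3) (by positivity) fun x hx =>
      poissonMaximalFrom_second_differences b hu.1 hε hfin hx hs hsε).trans ?_
  have herror : ENNReal.ofReal (2 * (C * s ^ 3)) =
      ENNReal.ofReal s ^ 2 * ENNReal.ofReal s * ENNReal.ofReal (2 * C) := by
    rw [← pow_succ, ← ENNReal.ofReal_pow hs.le, ← ENNReal.ofReal_mul (by positivity)]
    congr 1
    ring
  rw [mul_add, herror, mul_assoc, mul_assoc]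
  gcongr
  refine (differenceEnergy_poissonExtensionAbs_le b hu.1 hε hVfin s).trans ?_
  rw [← Real.enorm_of_nonneg hs.le]
  exact hG.differenceEnergy_le b s

theorem differenceEnergy_poissonMaximal_le (hu : MemLp u 2 volume) (hG : HasWeakGradient u G)
    {r : ℝ} (hr : 0 < r) :
    differenceEnergy b (fun x => (poissonMaximal u x).toReal) r ≤
      ENNReal.ofReal r ^ 2 * eLpNorm G 2 volume ^ 2 := by
  have hε : ∀ k : ℕ, 0 < 1 / ((k : ℝ) + 1) := fun k => by positivity
  refine differenceEnergy_le_of_tendsto b (fun k => (memLp_poissonMaximalFrom ENNReal.one_lt_two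
    ENNReal.ofNat_ne_top hu (hε k)).1) ?_ fun k =>
      differenceEnergy_poissonMaximalFrom_le b hu hG (hε k) hr
  filter_upwards [ae_poissonMaximal_lt_top ENNReal.one_lt_two ENNReal.ofNat_ne_top hu] with x hx
  exact (ENNReal.tendsto_toReal hx.ne).comp (tendsto_poissonMaximalFrom u x)

theorem poissonMaximal_memW1_two (hu : MemLp u 2 volume) (hG : HasWeakGradient u G)
    (hGm : MemLp G 2 volume) :
    (∀ᵐ x, poissonMaximal u x < ⊤) ∧ MemW1 2 (fun x => (poissonMaximal u x).toReal) ∧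
      ∃ G' : E → E, HasWeakGradient (fun x => (poissonMaximal u x).toReal) G' ∧
        eLpNorm G' 2 volume ≤ eLpNorm G 2 volume := by
  have hmax := memLp_poissonMaximal ENNReal.one_lt_two ENNReal.ofNat_ne_top hu
  obtain ⟨G', hG', hle⟩ := exists_hasWeakGradient_of_differenceEnergy_le
    (stdOrthonormalBasis ℝ E) hmax hGm.2.ne fun r hr =>
      differenceEnergy_poissonMaximal_le (stdOrthonormalBasis ℝ E) hu hG hr
  exact ⟨ae_poissonMaximal_lt_top ENNReal.one_lt_two ENNReal.ofNat_ne_top hu, ⟨hmax, G', hG',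
    hG'.locallyIntegrable_grad.aestronglyMeasurable, hle.trans_lt hGm.2⟩, G', hG', hle⟩

end DirichletEnergy

section SobolevInvariance

variable {E : Type*} [NormedAddCommGroup E] [InnerProductSpace ℝ E] [FiniteDimensional ℝ E]
  [MeasurableSpace E] [BorelSpace E]

theorem MemW1.memLp_of_hasWeakGradient {p : ℝ≥0∞} {u : E → ℝ} {G₀ : E → E} (hu : MemW1 p u)
    (hG₀ : HasWeakGradient u G₀) : MemLp G₀ p volume := by
  obtain ⟨-, G, hG, hGm⟩ := hu
  exact hGm.ae_eq (hG.ae_eq hG₀)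

end SobolevInvariance

theorem theorem2_general.{v} :
    (∀ (p : ℝ≥0∞), 1 ≤ p → ∀ (u₀ G₀ : ℝ → ℝ), MemW1 p u₀ → HasWeakGradient u₀ G₀ →
      (∀ x, poissonMaximal u₀ x < ⊤) ∧
      MemLp (fun x => (poissonMaximal u₀ x).toReal) ⊤ volume ∧
      (1 < p → MemW1 p fun x => (poissonMaximal u₀ x).toReal) ∧
      ∃ G : ℝ → ℝ, HasWeakGradient (fun x => (poissonMaximal u₀ x).toReal) G ∧
        eLpNorm G p volume ≤ eLpNorm G₀ p volume) ∧
    (∀ (u₀ : ℝ → ℝ), BoundedVariationOn u₀ univ →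
      (∀ x, poissonMaximal u₀ x < ⊤) ∧
      BoundedVariationOn (fun x => (poissonMaximal u₀ x).toReal) univ ∧
      eVariationOn (fun x => (poissonMaximal u₀ x).toReal) univ ≤ eVariationOn u₀ univ) ∧
    (∀ (E : Type v) [NormedAddCommGroup E] [InnerProductSpace ℝ E] [FiniteDimensional ℝ E]
        [MeasurableSpace E] [BorelSpace E] (p : ℝ≥0∞), p = 2 ∨ p = ⊤ →
      ∀ (u₀ : E → ℝ) (G₀ : E → E), MemW1 p u₀ → HasWeakGradient u₀ G₀ →
      (∀ᵐ x, poissonMaximal u₀ x < ⊤) ∧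
      MemW1 p (fun x => (poissonMaximal u₀ x).toReal) ∧
      ∃ G : E → E, HasWeakGradient (fun x => (poissonMaximal u₀ x).toReal) G ∧
        eLpNorm G p volume ≤ eLpNorm G₀ p volume) := by
  refine ⟨fun p hp u₀ G₀ hu hG₀ => ?_, fun u₀ hu => boundedVariation_poissonMaximal hu,
    fun E _ _ _ _ _ p hp u₀ G₀ hu hG₀ => ?_⟩
  · have hGm := hu.memLp_of_hasWeakGradient hG₀
    rcases eq_or_ne p ⊤ with rfl | hp'
    · obtain ⟨hfin, hW, hG⟩ := poissonMaximal_memW1_top hu.1 hG₀ hGm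
      exact ⟨hfin, hW.1, fun _ => hW, hG⟩
    · obtain ⟨hfin, htop, G, hG, hle⟩ := poissonMaximal_weakDerivative_line hp hp' hu.1 hG₀ hGm
      exact ⟨hfin, htop, fun hp1 => ⟨memLp_poissonMaximal hp1 hp' hu.1, G, hG,
        hG.locallyIntegrable_grad.aestronglyMeasurable, hle.trans_lt hGm.2⟩, G, hG, hle⟩
  · have hGm := hu.memLp_of_hasWeakGradient hG₀
    rcases hp with rfl | rfl
    · exact poissonMaximal_memW1_two hu.1 hG₀ hGm
    · obtain ⟨hfin, hW⟩ := poissonMaximal_memW1_top hu.1 hG₀ hGm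
      exact ⟨.of_forall hfin, hW⟩

/-- The weak gradient is unique up to null sets, so `‖∇f‖_p` is `eLpNorm G p` for any weak gradient
`G` of `f`. The maximal function has values in `[0, ∞]`; its finiteness (everywhere in dimension
one, almost everywhere in higher dimensions) is part of the conclusion. -/
theorem theorem2 :
    -- (i) dimension one, `1 < p ≤ ∞`
    (∀ (p : ℝ≥0∞), 1 < p → ∀ (u₀ G₀ : ℝ → ℝ), MemW1 p u₀ → HasWeakGradient u₀ G₀ →
      (∀ x, poissonMaximal u₀ x < ⊤) ∧
      MemW1 p (fun x => (poissonMaximal u₀ x).toReal) ∧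
      ∃ G : ℝ → ℝ, HasWeakGradient (fun x => (poissonMaximal u₀ x).toReal) G ∧
        eLpNorm G p volume ≤ eLpNorm G₀ p volume) ∧
    -- (ii) dimension one, `p = 1`
    (∀ (u₀ G₀ : ℝ → ℝ), MemW1 1 u₀ → HasWeakGradient u₀ G₀ →
      (∀ x, poissonMaximal u₀ x < ⊤) ∧
      MemLp (fun x => (poissonMaximal u₀ x).toReal) ⊤ volume ∧
      ∃ G : ℝ → ℝ, HasWeakGradient (fun x => (poissonMaximal u₀ x).toReal) G ∧
        eLpNorm G 1 volume ≤ eLpNorm G₀ 1 volume) ∧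
    -- (iii) dimension one, bounded variation
    (∀ (u₀ : ℝ → ℝ), BoundedVariationOn u₀ univ →
      (∀ x, poissonMaximal u₀ x < ⊤) ∧
      BoundedVariationOn (fun x => (poissonMaximal u₀ x).toReal) univ ∧
      eVariationOn (fun x => (poissonMaximal u₀ x).toReal) univ ≤ eVariationOn u₀ univ) ∧
    -- (iv) dimension `d > 1`, `p = 2` or `p = ∞`
    (∀ (d : ℕ), 1 < d → ∀ (p : ℝ≥0∞), p = 2 ∨ p = ⊤ →
      ∀ (u₀ : EuclideanSpace ℝ (Fin d) → ℝ)
        (G₀ : EuclideanSpace ℝ (Fin d) → EuclideanSpace ℝ (Fin d)),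
      MemW1 p u₀ → HasWeakGradient u₀ G₀ →
      (∀ᵐ x, poissonMaximal u₀ x < ⊤) ∧
      MemW1 p (fun x => (poissonMaximal u₀ x).toReal) ∧
      ∃ G : EuclideanSpace ℝ (Fin d) → EuclideanSpace ℝ (Fin d),
        HasWeakGradient (fun x => (poissonMaximal u₀ x).toReal) G ∧
        eLpNorm G p volume ≤ eLpNorm G₀ p volume) := by
  obtain ⟨hline, hvar, hspace⟩ := theorem2_general
  exact ⟨fun p hp u₀ G₀ hu hG₀ => let h := hline p hp.le u₀ G₀ hu hG₀; ⟨h.1, h.2.2.1 hp, h.2.2.2⟩,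
    fun u₀ G₀ hu hG₀ => let h := hline 1 le_rfl u₀ G₀ hu hG₀; ⟨h.1, h.2.1, h.2.2.2⟩,
    hvar, fun d _ => hspace (EuclideanSpace ℝ (Fin d))⟩
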